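/- Let $K$ be a knot in $S^3$, given by a planar diagram. Let $Kh(K)=\bigoplus_{b,a}Kh^{b,a}(K)$ be its Khovanov homology over $\mathbb{Q}$, with homological degree $b$ and $q$-degree $a$, and let $P_{Kh}(K)=\sum_{b,a}\dim_{\mathbb{Q}}Kh^{b,a}(K)\,t^bq^a$. Let $W(K)$ be the homological width, that is, the number of diagonals $a-2b=m$ in the convex hull of the support of $Kh(K)$: $$W(K)=\tfrac12\bigl(\max\mu-\min\mu\bigr)+1,\qquad \mu=\{a-2b : Kh^{b,a}(K)\neq 0\}$$ (all elements of $\mu$ have the same parity). Let $(E_k,d_k)_{k\ge 1}$ be Lee's spectral sequence, induced by the $q$-filtration on Lee's complex $CKh'(K)$ and numbered so that $E_1=CKh(K)$ and $E_2=Kh(K)$; the differential $d_k$ raises the homological degree by $1$ and the $q$-degree by $4(k-1)$. It converges to Lee homology $Kh'(K)$. Let $s_{\min}$ and $s_{\max}$ be the minimum and the maximum, over the nonzero $x\in Kh'(K)$, of the grading on $Kh'(K)$ induced by the $q$-filtration, and let $s(K)=s_{\min}+1=s_{\max}-1$. If $W(K)\le 3$, then: 1. The spectral sequence converges after the $E_2$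 term: $d_k=0$ for all $k\ge 3$, and for all $k\ge 3$ the term $E_k$ is in each bidegree isomorphic to the limit term $E_\infty$, the graded space associated to the induced filtration on $Kh'(K)$. 2. The invariant $s(K)$ is the exponent in Bar-Natan's form of the Poincaré polynomial: for an integer $e$, there is a Laurent polynomial $Q$ in $t$ and $q$ with non-negative integer coefficients such that $$P_{Kh}(K)=q^{e}(q+q^{-1})+(1+tq^4)\,Q$$ if and only if $e=s(K)$. -/

import Mathlib

/-!  Rational Khovanov homology, Lee's deformation of it and the associated spectral sequence,
for knot diagrams. -/

noncomputable section

/-- The subquotient of a vector space `M` given by two subspaces, `Z / (B ∩ Z)`. -/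
abbrev Subquotient {M : Type*} [AddCommGroup M] [Module ℚ M] (Z B : Submodule ℚ M) : Type _ :=
  Z ⧸ B.submoduleOf Z

/-! ### The spectral sequence of a filtered complex

`d` is an endomorphism of `M`, `C b` is the part of homological degree `b`, and `F a` is a
decreasing filtration: `F (a + 1) ≤ F a`. -/

namespace Filtered

variable {M : Type*} [AddCommGroup M] [Module ℚ M]

/-- `Z_r^{b,a} = {x ∈ C^b ∩ F_a : d x ∈ F_{a+r}}`. -/
def cycles (d : M →ₗ[ℚ] M) (C F : ℤ → Submodule ℚ M) (r b a : ℤ) : Submodule ℚ M :=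
  C b ⊓ F a ⊓ (F (a + r)).comap d

/-- `B_r^{b,a} = Z_{r-1}^{b,a+1} + d Z_{r-1}^{b-1,a-r+1}`. -/
def boundaries (d : M →ₗ[ℚ] M) (C F : ℤ → Submodule ℚ M) (r b a : ℤ) : Submodule ℚ M :=
  cycles d C F (r - 1) b (a + 1) ⊔ (cycles d C F (r - 1) (b - 1) (a - r + 1)).map d

/-- The term of homological degree `b` and filtration degree `a` on the `r`-th page of the spectral
sequence of the filtered complex, `E_r^{b,a} = Z_r^{b,a} / B_r^{b,a}`.  Page `0` is the associated
graded complex. -/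
abbrev Page (d : M →ₗ[ℚ] M) (C F : ℤ → Submodule ℚ M) (r b a : ℤ) : Type _ :=
  Subquotient (cycles d C F r b a) (boundaries d C F r b a)

theorem map_mem_cycles {d : M →ₗ[ℚ] M} {C F : ℤ → Submodule ℚ M} (hd : d ∘ₗ d = 0)
    (hC : ∀ b, ∀ x ∈ C b, d x ∈ C (b + 1)) (r b a : ℤ) :
    ∀ x ∈ cycles d C F r b a, d x ∈ cycles d C F r (b + 1) (a + r) := by
  rintro x ⟨⟨h1, -⟩, h3⟩
  refine ⟨⟨hC b x h1, h3⟩, ?_⟩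
  have h : d (d x) = 0 := LinearMap.congr_fun hd x
  simp [h]

theorem map_mem_boundaries {d : M →ₗ[ℚ] M} {C F : ℤ → Submodule ℚ M} (hd : d ∘ₗ d = 0)
    (r b a : ℤ) :
    ∀ x ∈ boundaries d C F r b a, d x ∈ boundaries d C F r (b + 1) (a + r) := by
  intro x hx
  obtain ⟨z, hz, w, ⟨y, -, rfl⟩, rfl⟩ := Submodule.mem_sup.1 hx
  have h : d (d y) = 0 := LinearMap.congr_fun hd y
  rw [map_add, h, add_zero]
  refine Submodule.mem_sup_right ⟨z, ?_, rfl⟩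
  have e1 : b + 1 - 1 = b := by ring
  have e2 : a + r - r + 1 = a + 1 := by ring
  rw [e1, e2]
  exact hz

/-- The differential `d_r : E_r^{b,a} → E_r^{b+1,a+r}`, `[x] ↦ [d x]`. -/
def pageDiff {d : M →ₗ[ℚ] M} {C F : ℤ → Submodule ℚ M} (hd : d ∘ₗ d = 0)
    (hC : ∀ b, ∀ x ∈ C b, d x ∈ C (b + 1)) (r b a : ℤ) :
    Page d C F r b a →ₗ[ℚ] Page d C F r (b + 1) (a + r) :=
  Submodule.mapQ _ _ (d.restrict (map_mem_cycles hd hC r b a))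
    fun x hx => map_mem_boundaries hd r b a x.1 hx

/-- The homology `ker d / im d` of `(M, d)`, all homological degrees together. -/
abbrev Homology (d : M →ₗ[ℚ] M) : Type _ :=
  Subquotient (LinearMap.ker d) (LinearMap.range d)

/-- The image in the homology of the cycles that lie in `N`. -/
def homologyImage (d : M →ₗ[ℚ] M) (N : Submodule ℚ M) : Submodule ℚ (Homology d) :=
  (N.submoduleOf (LinearMap.ker d)).map
    ((LinearMap.range d).submoduleOf (LinearMap.ker d)).mkQ

/-- The grading on homology induced by the filtration: the largest `a` such that `x` has a
representative in `F a`. -/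
def grading (d : M →ₗ[ℚ] M) (F : ℤ → Submodule ℚ M) (x : Homology d) : ℤ :=
  sSup {a : ℤ | x ∈ homologyImage d (F a)}

/-- The limit term `E_∞^{b,a}`: the associated graded space of the induced filtration on the
homology in homological degree `b`. -/
abbrev LimitTerm (d : M →ₗ[ℚ] M) (C F : ℤ → Submodule ℚ M) (b a : ℤ) : Type _ :=
  Subquotient (homologyImage d (C b ⊓ F a)) (homologyImage d (C b ⊓ F (a + 1)))

end Filtered

/-! ### Knot diagrams -/

/-- The arcs (edges) of a knot diagram with `n` crossings, numbered along the oriented knot: there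
are `2 * n` of them, or a single closed one if there is no crossing.  The arc after `a` is `a + 1`,
cyclically. -/
abbrev Arc (n : ℕ) : Type := Fin (max 1 (2 * n))

instance (n : ℕ) : NeZero (max 1 (2 * n)) := ⟨by omega⟩

/-- A signed Gauss code: one closed oriented curve that runs once over and once under each of
`n` crossings, each crossing having a sign.  `underIn c` and `overIn c` are the arcs that end at the
crossing `c` on its lower and its upper strand; these strands leave along the next arcs. -/
structure GaussCode where
  n : ℕ
  underIn : Fin n → Arc n
  overIn : Fin n → Arc n
  positive : Fin n → Bool
  injective : Function.Injective (Sum.elim underIn overIn)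

namespace GaussCode

variable (D : GaussCode)

def underOut (c : Fin D.n) : Arc D.n := D.underIn c + 1

def overOut (c : Fin D.n) : Arc D.n := D.overIn c + 1

/-- The boundaries of the faces.  A pair `(a, true)` is the left side of the arc `a`, traversed in
the direction of the knot, and `(a, false)` is the left side of `a` traversed backwards (so, its
right side).  Walking along the boundary of a face with the face on the left, one turns left at
each crossing.  Around a positive crossing, the arcs in counterclockwise order are
`underIn, overOut, underOut, overIn`; around a negative one, they are
`underIn, overIn, underOut, overOut`. -/
inductive FaceStep : Arc D.n × Bool → Arc D.n × Bool → Prop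
  | pos_underIn (c : Fin D.n) : D.positive c = true →
      FaceStep (D.underIn c, true) (D.overIn c, false)
  | pos_overOut (c : Fin D.n) : D.positive c = true →
      FaceStep (D.overOut c, false) (D.underIn c, false)
  | pos_underOut (c : Fin D.n) : D.positive c = true →
      FaceStep (D.underOut c, false) (D.overOut c, true)
  | pos_overIn (c : Fin D.n) : D.positive c = true →
      FaceStep (D.overIn c, true) (D.underOut c, true)
  | neg_underIn (c : Fin D.n) : D.positive c = false →
      FaceStep (D.underIn c, true) (D.overOut c, true)
  | neg_overIn (c : Fin D.n) : D.positive c = false →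
      FaceStep (D.overIn c, true) (D.underIn c, false)
  | neg_underOut (c : Fin D.n) : D.positive c = false →
      FaceStep (D.underOut c, false) (D.overIn c, false)
  | neg_overOut (c : Fin D.n) : D.positive c = false →
      FaceStep (D.overOut c, false) (D.underOut c, true)

/-- The faces of the surface in which the code is drawn. -/
abbrev Face : Type := Quot D.FaceStep

/-- The code is that of a diagram in the sphere: by Euler's formula, `n - 2n + (number of faces)`
has to be `2`. -/
def Planar : Prop := Nat.card D.Face = D.n + 2

end GaussCode

/-- A knot diagram: a planar signed Gauss code. -/
structure KnotDiagram extends GaussCode where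
  planar : toGaussCode.Planar

namespace KnotDiagram

variable (D : KnotDiagram)

/-! ### The cube of resolutions -/

/-- A vertex of the cube of resolutions: `v c = true` if `c` gets the `1`-resolution and
`v c = false` if it gets the `0`-resolution. -/
abbrev Vertex : Type := Fin D.n → Bool

/-- `D.Joined v a a'`: the resolution `v` joins the arcs `a` and `a'` at some crossing.  The
`0`-resolution of a positive crossing and the `1`-resolution of a negative one are the oriented
resolution; the other two are the unoriented one. -/
inductive Joined (v : D.Vertex) : Arc D.n → Arc D.n → Prop
  | oriented_under (c : Fin D.n) : v c ≠ D.positive c → Joined v (D.underIn c) (D.overOut c)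
  | oriented_over (c : Fin D.n) : v c ≠ D.positive c → Joined v (D.overIn c) (D.underOut c)
  | unoriented_in (c : Fin D.n) : v c = D.positive c → Joined v (D.underIn c) (D.overIn c)
  | unoriented_out (c : Fin D.n) : v c = D.positive c → Joined v (D.underOut c) (D.overOut c)

/-- The circles of the resolved diagram `D_v`. -/
abbrev Circle (v : D.Vertex) : Type := Quot (D.Joined v)

/-- The circle of `D_v` that contains the arc `a`. -/
def circle (v : D.Vertex) (a : Arc D.n) : D.Circle v := Quot.mk _ a

instance (v : D.Vertex) : Finite (D.Circle v) := Quot.finite _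

instance (v : D.Vertex) : Fintype (D.Circle v) := Fintype.ofFinite _

/-- A state: a complete resolution, with a label at each circle, `true` for `v₊` and `false`
for `v₋`. -/
abbrev State : Type := Σ v : D.Vertex, D.Circle v → Bool

instance : Finite D.State := by
  unfold State; infer_instance

instance : Fintype D.State := Fintype.ofFinite _

/-- The number of negative crossings. -/
def nNeg : ℕ := (Finset.univ.filter fun c => D.positive c = false).card

/-- The number of positive crossings. -/
def nPos : ℕ := (Finset.univ.filter fun c => D.positive c = true).card

/-- The homological grading of a state. -/
def gr (S : D.State) : ℤ := (Finset.univ.filter fun c => S.1 c = true).card - D.nNeg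

/-- The grading `p` of a state, where `p(v₊) = 1` and `p(v₋) = -1`. -/
def pGrading (S : D.State) : ℤ := ∑ C : D.Circle S.1, if S.2 C = true then 1 else -1

/-- The `q`-grading of a state. -/
def qGrading (S : D.State) : ℤ := D.pGrading S + D.gr S + D.nPos - D.nNeg

/-! ### The complexes

`t = 0` gives Khovanov's TQFT, and `t = 1` gives Lee's. -/

/-- `mCoeff t x y z` is the coefficient of `z` in `m (x ⊗ y)`, where
`m (v₊ ⊗ v₊) = v₊`, `m (v₊ ⊗ v₋) = m (v₋ ⊗ v₊) = v₋` and `m (v₋ ⊗ v₋) = t v₊`. -/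
def mCoeff (t : ℚ) : Bool → Bool → Bool → ℚ
  | true, true, true => 1
  | true, false, false => 1
  | false, true, false => 1
  | false, false, true => t
  | _, _, _ => 0

/-- `deltaCoeff t x y z` is the coefficient of `y ⊗ z` in `Δ x`, where
`Δ v₊ = v₊ ⊗ v₋ + v₋ ⊗ v₊` and `Δ v₋ = v₋ ⊗ v₋ + t v₊ ⊗ v₊`. -/
def deltaCoeff (t : ℚ) : Bool → Bool → Bool → ℚ
  | true, true, false => 1
  | true, false, true => 1
  | false, false, false => 1
  | false, true, true => t
  | _, _, _ => 0

/-- `D.IsEdge c v w`: there is an edge of the cube from `v` to `w`, changing the crossing `c` from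
its `0`-resolution to its `1`-resolution. -/
def IsEdge (c : Fin D.n) (v w : D.Vertex) : Prop :=
  v c = false ∧ w = Function.update v c true

/-- The sign of an edge that changes the crossing `c`: `-1` to the number of earlier crossings
with a `1`-resolution. -/
def edgeSign (c : Fin D.n) (v : D.Vertex) : ℚ :=
  (-1) ^ (Finset.univ.filter fun c' => c' < c ∧ v c' = true).card

/-- The labels of the states `S` and `S'` agree on all circles that do not touch the
crossing `c`.  (In each resolution, one of the two strands at `c` contains the end of `underIn c`
and the other one the end of `underOut c`.) -/
def AgreeAway (c : Fin D.n) (S S' : D.State) : Prop :=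
  ∀ a : Arc D.n, D.circle S.1 a ≠ D.circle S.1 (D.underIn c) →
    D.circle S.1 a ≠ D.circle S.1 (D.underOut c) →
    S.2 (D.circle S.1 a) = S'.2 (D.circle S'.1 a)

open scoped Classical in
/-- The coefficient of the state `S'` in the image of the state `S` under the map that the TQFT
assigns to the edge from `S.1` to `S'.1` at `c`.  If the two strands at `c` lie on different
circles, these merge; otherwise the circle splits. -/
def edgeCoeff (t : ℚ) (c : Fin D.n) (S S' : D.State) : ℚ :=
  if D.IsEdge c S.1 S'.1 ∧ D.AgreeAway c S S' then
    if D.circle S.1 (D.underIn c) ≠ D.circle S.1 (D.underOut c) then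
      mCoeff t (S.2 (D.circle S.1 (D.underIn c))) (S.2 (D.circle S.1 (D.underOut c)))
        (S'.2 (D.circle S'.1 (D.underIn c)))
    else
      deltaCoeff t (S.2 (D.circle S.1 (D.underIn c)))
        (S'.2 (D.circle S'.1 (D.underIn c))) (S'.2 (D.circle S'.1 (D.underOut c)))
  else 0

/-- The underlying vector space of the complexes, with basis the states. -/
abbrev Chain : Type := D.State →₀ ℚ

/-- The differential: the signed sum of the maps of the edges. -/
def diff (t : ℚ) : D.Chain →ₗ[ℚ] D.Chain :=
  Finsupp.linearCombination ℚ fun S : D.State =>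
    ∑ S' : D.State, Finsupp.single S' (∑ c, D.edgeSign c S.1 * D.edgeCoeff t c S S')

/-- The chains of homological degree `b`. -/
def homDegree (b : ℤ) : Submodule ℚ D.Chain := Finsupp.supported ℚ ℚ {S | D.gr S = b}

/-- The chains that are homogeneous of `q`-degree `a`. -/
def qDegree (a : ℤ) : Submodule ℚ D.Chain := Finsupp.supported ℚ ℚ {S | D.qGrading S = a}

/-- The filtration by the `q`-grading. -/
def qFiltration (a : ℤ) : Submodule ℚ D.Chain := Finsupp.supported ℚ ℚ {S | a ≤ D.qGrading S}

/-- Khovanov's differential. -/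
def khovanovDiff : D.Chain →ₗ[ℚ] D.Chain := D.diff 0

/-- Lee's differential. -/
def leeDiff : D.Chain →ₗ[ℚ] D.Chain := D.diff 1

/-! ### Khovanov homology, its Poincaré polynomial and its width -/

/-- Khovanov homology in homological degree `b` and `q`-degree `a`. -/
abbrev Kh (b a : ℤ) : Type :=
  Subquotient (LinearMap.ker D.khovanovDiff ⊓ (D.homDegree b ⊓ D.qDegree a))
    ((D.homDegree (b - 1) ⊓ D.qDegree a).map D.khovanovDiff)

/-- Laurent polynomials in `t` and `q` with integer coefficients. -/
abbrev Laurent : Type := AddMonoidAlgebra ℤ (ℤ × ℤ)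

/-- The monomial `t ^ b * q ^ a`. -/
def tq (b a : ℤ) : Laurent := AddMonoidAlgebra.single (b, a) 1

open scoped Classical in
/-- The bidegrees `(b, a)` of the states; `Kh` vanishes in all other bidegrees. -/
def bidegrees : Finset (ℤ × ℤ) := Finset.univ.image fun S : D.State => (D.gr S, D.qGrading S)

/-- The graded Poincaré polynomial `P_Kh = ∑ dim Kh^{b,a} t^b q^a`. -/
def poincare : Laurent :=
  ∑ p ∈ D.bidegrees, (Module.finrank ℚ (D.Kh p.1 p.2) : ℤ) • tq p.1 p.2

/-- The set of all `a - 2 * b` such that `t ^ b * q ^ a` is a monomial of `P_Kh`. -/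
def diagonals : Set ℤ := {m | ∃ b a : ℤ, D.poincare.coeff (b, a) ≠ 0 ∧ m = a - 2 * b}

/-- The homological width: the number of diagonals `a - 2 * b = m` in the convex hull of the support
of `Kh`.  As all `m` that occur have the same parity, this is one more than half of the difference
between the largest one and the smallest one. -/
def width : ℤ := (sSup D.diagonals - sInf D.diagonals) / 2 + 1

/-- `P_Kh` has the form `q^e (q + q⁻¹) + (1 + t q⁴) Q`, where no coefficient of `Q` is negative. -/
def HasBarNatanForm (e : ℤ) : Prop :=
  ∃ Q : Laurent, (∀ p, 0 ≤ Q.coeff p) ∧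
    D.poincare = tq 0 e * (tq 0 1 + tq 0 (-1)) + (1 + tq 1 4) * Q

/-! ### Lee's spectral sequence and the invariant `s` -/

theorem diff_mem_homDegree (t : ℚ) (b : ℤ) :
    ∀ x ∈ D.homDegree b, D.diff t x ∈ D.homDegree (b + 1) := by
  intro x hx
  rw [diff, Finsupp.linearCombination_apply]
  refine Submodule.sum_mem _ fun S hS => Submodule.smul_mem _ _ ?_
  have hS' : D.gr S = b := (Finsupp.mem_supported ℚ x).1 hx hS
  refine Submodule.sum_mem _ fun S' _ => ?_
  by_cases h : ∃ c, D.IsEdge c S.1 S'.1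
  · obtain ⟨c, h1, h2⟩ := h
    refine Finsupp.single_mem_supported ℚ _ ?_
    have h3 : (Finset.univ.filter fun c' => S'.1 c' = true) =
        insert c (Finset.univ.filter fun c' => S.1 c' = true) := by
      ext c'
      by_cases h4 : c' = c
      · subst h4; simp [h2]
      · simp [h2, h4]
    have h5 : c ∉ Finset.univ.filter fun c' => S.1 c' = true := by simp [h1]
    change D.gr S' = b + 1
    rw [← hS', gr, gr, h3, Finset.card_insert_of_notMem h5]
    push_cast
    ring
  · have h0 : (∑ c, D.edgeSign c S.1 * D.edgeCoeff t c S S') = 0 := by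
      refine Finset.sum_eq_zero fun c _ => ?_
      have h6 : ¬ (D.IsEdge c S.1 S'.1 ∧ D.AgreeAway c S S') := fun h7 => h ⟨c, h7.1⟩
      simp [edgeCoeff, h6]
    rw [h0, Finsupp.single_zero]
    exact Submodule.zero_mem _

/-- The term in homological degree `b` and `q`-degree `a` of `E_k`, in the numbering in which
`E_1` is the complex `CKh` and `E_2` is `Kh`.  Lee's differential is a sum of terms that raise the
`q`-grading by `0` and by `4`, so in the spectral sequence of the `q`-filtration only the
differentials on the pages `0, 4, 8, …` can be nonzero.  The differential `d_k` on `E_k` is the one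
that raises the `q`-grading by `4 * (k - 1)`. -/
abbrev LeePage (k : ℕ) (b a : ℤ) : Type :=
  Filtered.Page D.leeDiff D.homDegree D.qFiltration (4 * ((k : ℤ) - 1)) b a

/-- The differential `d_k` on the term of bidegree `(b, a)` of `E_k`. -/
def leePageDiff (hd : D.leeDiff ∘ₗ D.leeDiff = 0) (k : ℕ) (b a : ℤ) :
    D.LeePage k b a →ₗ[ℚ] D.LeePage k (b + 1) (a + 4 * ((k : ℤ) - 1)) :=
  Filtered.pageDiff hd (D.diff_mem_homDegree 1) _ b a

/-- The limit term of the spectral sequence: the graded space associated to the filtration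
of Lee homology. -/
abbrev LeeLimit (b a : ℤ) : Type :=
  Filtered.LimitTerm D.leeDiff D.homDegree D.qFiltration b a

/-- Lee's homology `Kh'`, all homological degrees together. -/
abbrev LeeHomology : Type := Filtered.Homology D.leeDiff

/-- The gradings of the nonzero elements of Lee homology. -/
def leeGradings : Set ℤ :=
  {m | ∃ x : D.LeeHomology, x ≠ 0 ∧ m = Filtered.grading D.leeDiff D.qFiltration x}

def sMin : ℤ := sInf D.leeGradings

def sMax : ℤ := sSup D.leeGradings

/-- The invariant `s = s_min + 1` (which is also `s_max - 1`). -/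
def s : ℤ := D.sMin + 1

end KnotDiagram

end

noncomputable section

/-! ### Permutations and a transposition -/

namespace Equiv.Perm

variable {α : Type*} [Fintype α] [DecidableEq α]

theorem SameCycle.not_sameCycle_mul_swap {σ : Equiv.Perm α} {x y : α} (hxy : x ≠ y)
    (h : σ.SameCycle x y) : ¬ (σ * Equiv.swap x y).SameCycle x y := by
  intro h'
  have hex : ∃ k : ℕ, (σ ^ k) x = y := by
    obtain ⟨i, -, hi⟩ := h.exists_pow_eq'
    exact ⟨i, hi⟩
  classical
  set k := Nat.find hex with hk
  have hkx : (σ ^ k) x = y := Nat.find_spec hex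
  have hmin : ∀ j < k, (σ ^ j) x ≠ y := fun j hj => Nat.find_min hex hj
  have hk0 : 1 ≤ k := by
    rcases Nat.eq_zero_or_pos k with h0 | h0
    · rw [h0] at hkx; exact absurd hkx hxy
    · exact h0
  have hx : ∀ i, 1 ≤ i → i ≤ k → (σ ^ i) x ≠ x := by
    intro i h1 h2 h3
    refine hmin (k - i) (by omega) ?_
    conv_rhs => rw [← hkx, ← Nat.sub_add_cancel h2, pow_add, mul_apply, h3]
  have hstep : ∀ j : ℕ, ∃ i, 1 ≤ i ∧ i ≤ k ∧ ((σ * Equiv.swap x y) ^ j) y = (σ ^ i) x := by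
    intro j
    induction j with
    | zero => exact ⟨k, hk0, le_rfl, by simp [hkx]⟩
    | succ j ih =>
      obtain ⟨i, h1, h2, h3⟩ := ih
      rw [pow_succ', mul_apply, h3]
      by_cases hik : i = k
      · refine ⟨1, le_rfl, hk0, ?_⟩
        rw [hik, hkx]; simp
      · refine ⟨i + 1, by omega, by omega, ?_⟩
        rw [mul_apply, Equiv.swap_apply_of_ne_of_ne (hx i h1 h2) (hmin i (by omega)), pow_succ',
          mul_apply]
  obtain ⟨j, -, hj⟩ := h'.symm.exists_pow_eq'
  obtain ⟨i, h1, h2, h3⟩ := hstep j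
  exact hx i h1 h2 (h3.symm.trans hj)

theorem sameCycle_mul_swap_of_not_sameCycle {σ : Equiv.Perm α} {x y : α}
    (h : ¬ σ.SameCycle x y) : (σ * Equiv.swap x y).SameCycle x y := by
  classical
  have hex : ∃ k : ℕ, 0 < k ∧ (σ ^ k) x = x :=
    ⟨orderOf σ, orderOf_pos σ, by simp [pow_orderOf_eq_one]⟩
  set k := Nat.find hex with hk
  obtain ⟨hk0, hkx⟩ : 0 < k ∧ (σ ^ k) x = x := Nat.find_spec hex
  have hmin : ∀ j, 0 < j → j < k → (σ ^ j) x ≠ x := fun j h0 hj h1 => Nat.find_min hex hj ⟨h0, h1⟩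
  have hstep : ∀ j, j < k → ((σ * Equiv.swap x y) ^ (j + 1)) y = (σ ^ (j + 1)) x := by
    intro j
    induction j with
    | zero => intro _; simp
    | succ j ih =>
      intro hj
      have hy : (σ ^ (j + 1)) x ≠ y := fun h1 => h ⟨(j + 1 : ℕ), by rw [zpow_natCast]; exact h1⟩
      rw [pow_succ', mul_apply, ih (by omega), mul_apply,
        Equiv.swap_apply_of_ne_of_ne (hmin _ (by omega) hj) hy, pow_succ' _ (j + 1), mul_apply]
  refine SameCycle.symm ⟨(k : ℕ), ?_⟩
  have h2 := hstep (k - 1) (by omega)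
  rw [Nat.sub_add_cancel hk0, hkx] at h2
  rw [zpow_natCast]; exact h2

theorem sameCycle_mul_swap_iff {σ : Equiv.Perm α} {x y : α} (hxy : x ≠ y) :
    (σ * Equiv.swap x y).SameCycle x y ↔ ¬ σ.SameCycle x y :=
  ⟨fun h h' => h'.not_sameCycle_mul_swap hxy h, sameCycle_mul_swap_of_not_sameCycle⟩

end Equiv.Perm

theorem Fin.eq_of_forall_add_one {m : ℕ} [NeZero m] {β : Type*} {f : Fin m → β}
    (h : ∀ a, f (a + 1) = f a) (a b : Fin m) : f a = f b := by
  obtain _ | k := m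
  · exact a.elim0
  · have key : ∀ a : Fin (k + 1), f a = f 0 := by
      intro a
      induction a using Fin.induction with
      | zero => rfl
      | succ i ih => rw [← ih, ← h i.castSucc, Fin.coeSucc_eq_succ]
    rw [key a, key b]

/-! ### The checkerboard colouring of a planar diagram -/

namespace GaussCode

variable (D : GaussCode)

theorem underIn_inj {c c' : Fin D.n} : D.underIn c = D.underIn c' ↔ c = c' :=
  ⟨fun h => Sum.inl_injective (D.injective (a₁ := Sum.inl c) (a₂ := Sum.inl c') h), fun h => h ▸ rfl⟩

theorem overIn_inj {c c' : Fin D.n} : D.overIn c = D.overIn c' ↔ c = c' :=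
  ⟨fun h => Sum.inr_injective (D.injective (a₁ := Sum.inr c) (a₂ := Sum.inr c') h), fun h => h ▸ rfl⟩

theorem underIn_ne_overIn (c c' : Fin D.n) : D.underIn c ≠ D.overIn c' := fun h =>
  Sum.inl_ne_inr (D.injective (a₁ := Sum.inl c) (a₂ := Sum.inr c') h)

theorem ends_bijective (hn : D.n ≠ 0) : Function.Bijective (Sum.elim D.underIn D.overIn) := by
  rw [Fintype.bijective_iff_injective_and_card]
  refine ⟨D.injective, ?_⟩
  simp only [Fintype.card_sum, Fintype.card_fin]
  omega

theorem exists_end (hn : D.n ≠ 0) (a : Arc D.n) : ∃ c, D.underIn c = a ∨ D.overIn c = a := by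
  obtain ⟨c | c, h⟩ := (D.ends_bijective hn).2 a
  · exact ⟨c, Or.inl h⟩
  · exact ⟨c, Or.inr h⟩

/-- The coboundary of a function on the faces. -/
def faceBoundary : (D.Face → ZMod 2) →ₗ[ZMod 2] (Arc D.n → ZMod 2) where
  toFun f a := f (Quot.mk _ (a, true)) + f (Quot.mk _ (a, false))
  map_add' f g := by ext a; simp only [Pi.add_apply]; ring
  map_smul' r f := by ext a; simp only [Pi.smul_apply, smul_eq_mul, RingHom.id_apply]; ring

/-- The boundary of a function on the arcs. -/
def arcBoundary : (Arc D.n → ZMod 2) →ₗ[ZMod 2] (Fin D.n → ZMod 2) where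
  toFun f c := f (D.underIn c) + f (D.overIn c) + f (D.underOut c) + f (D.overOut c)
  map_add' f g := by ext a; simp only [Pi.add_apply]; ring
  map_smul' r f := by ext a; simp only [Pi.smul_apply, smul_eq_mul, RingHom.id_apply]; ring

instance : Finite D.Face := Quot.finite _

instance : Fintype D.Face := Fintype.ofFinite _

theorem face_relations (c : Fin D.n) :
    (D.positive c = true ∧
      (Quot.mk _ (D.underIn c, true) : D.Face) = Quot.mk _ (D.overIn c, false) ∧
      (Quot.mk _ (D.overOut c, false) : D.Face) = Quot.mk _ (D.underIn c, false) ∧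
      (Quot.mk _ (D.underOut c, false) : D.Face) = Quot.mk _ (D.overOut c, true) ∧
      (Quot.mk _ (D.overIn c, true) : D.Face) = Quot.mk _ (D.underOut c, true)) ∨
    (D.positive c = false ∧
      (Quot.mk _ (D.underIn c, true) : D.Face) = Quot.mk _ (D.overOut c, true) ∧
      (Quot.mk _ (D.overIn c, true) : D.Face) = Quot.mk _ (D.underIn c, false) ∧
      (Quot.mk _ (D.underOut c, false) : D.Face) = Quot.mk _ (D.overIn c, false) ∧
      (Quot.mk _ (D.overOut c, false) : D.Face) = Quot.mk _ (D.underOut c, true)) := by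
  cases h : D.positive c
  · exact Or.inr ⟨rfl, Quot.sound (.neg_underIn c h), Quot.sound (.neg_overIn c h),
      Quot.sound (.neg_underOut c h), Quot.sound (.neg_overOut c h)⟩
  · exact Or.inl ⟨rfl, Quot.sound (.pos_underIn c h), Quot.sound (.pos_overOut c h),
      Quot.sound (.pos_underOut c h), Quot.sound (.pos_overIn c h)⟩

theorem arcBoundary_faceBoundary (f : D.Face → ZMod 2) : D.arcBoundary (D.faceBoundary f) = 0 := by
  ext c
  simp only [arcBoundary, faceBoundary, LinearMap.coe_mk, AddHom.coe_mk, Pi.zero_apply]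
  have h2 : ∀ z : ZMod 2, z + z = 0 := CharTwo.add_self_eq_zero
  rcases D.face_relations c with ⟨-, h1, h3, h4, h5⟩ | ⟨-, h1, h3, h4, h5⟩ <;>
  · rw [h1, h3, h4, h5]
    linear_combination h2 (f (Quot.mk _ (D.overIn c, false))) +
      h2 (f (Quot.mk _ (D.underIn c, false))) + h2 (f (Quot.mk _ (D.overOut c, true))) +
      h2 (f (Quot.mk _ (D.underOut c, true)))

theorem faceBoundary_ker_const (hn : D.n ≠ 0) {f : D.Face → ZMod 2} (hf : D.faceBoundary f = 0)
    (x y : D.Face) : f x = f y := by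
  have h1 : ∀ a, f (Quot.mk _ (a, true)) = f (Quot.mk _ (a, false)) := fun a =>
    CharTwo.add_eq_zero.1 (congrFun hf a)
  have h2 : ∀ a, f (Quot.mk _ (a + 1, true)) = f (Quot.mk _ (a, true)) := by
    intro a
    obtain ⟨c, rfl | rfl⟩ := D.exists_end hn a
    · change f (Quot.mk _ (D.underOut c, true)) = _
      rcases D.face_relations c with ⟨-, e1, e3, e4, e5⟩ | ⟨-, e1, e3, e4, e5⟩
      · rw [← e5, h1, ← e1]
      · rw [e1, h1 (D.overOut c), e5]
    · change f (Quot.mk _ (D.overOut c, true)) = _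
      rcases D.face_relations c with ⟨-, e1, e3, e4, e5⟩ | ⟨-, e1, e3, e4, e5⟩
      · rw [← e4, ← h1, e5]
      · rw [← e1, h1, ← e3]
  have h3 := Fin.eq_of_forall_add_one (f := fun a => f (Quot.mk _ (a, true))) h2
  induction x using Quot.ind with | mk p =>
  induction y using Quot.ind with | mk p' =>
  obtain ⟨a, b⟩ := p
  obtain ⟨a', b'⟩ := p'
  have h4 : ∀ a b, f (Quot.mk _ (a, b)) = f (Quot.mk _ (a, true)) := by
    rintro a (_ | _)
    exacts [(h1 a).symm, rfl]
  rw [h4, h4 a']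
  exact h3 _ _

theorem finrank_ker_arcBoundary_le (hn : D.n ≠ 0) :
    Module.finrank (ZMod 2) (LinearMap.ker D.arcBoundary) ≤ D.n + 1 := by
  classical
  obtain ⟨e, he⟩ : ∃ e : Fin D.n ⊕ Fin D.n ≃ Arc D.n, ⇑e = Sum.elim D.underIn D.overIn :=
    ⟨Equiv.ofBijective _ (D.ends_bijective hn), rfl⟩
  set hc : Arc D.n → Fin D.n := fun a => Sum.elim id id (e.symm a) with hhc
  have hcu : ∀ c, hc (D.underIn c) = c := by
    intro c
    have : D.underIn c = e (Sum.inl c) := by rw [he]; rfl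
    simp [hhc, this]
  have hco : ∀ c, hc (D.overIn c) = c := by
    intro c
    have : D.overIn c = e (Sum.inr c) := by rw [he]; rfl
    simp [hhc, this]
  have hin : ∀ (a : Arc D.n) c, (if D.underIn c = a then (1 : ZMod 2) else 0) +
      (if D.overIn c = a then 1 else 0) = if c = hc a then 1 else 0 := by
    intro a c
    obtain ⟨c', rfl | rfl⟩ := D.exists_end hn a
    · rw [hcu]; simp [D.underIn_inj, (D.underIn_ne_overIn c' c).symm]
    · rw [hco]; simp [D.overIn_inj, D.underIn_ne_overIn c c']
  have hsingle : ∀ a, D.arcBoundary (Pi.single a 1) =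
      Pi.single (hc a) 1 + Pi.single (hc (a - 1)) 1 := by
    intro a
    ext c
    simp only [arcBoundary, LinearMap.coe_mk, AddHom.coe_mk,
      Pi.single_apply, Pi.add_apply, underOut, overOut, ← hin, ← eq_sub_iff_add_eq]
    ring
  set R := LinearMap.range D.arcBoundary
  have hcl : ∀ a, R.mkQ (Pi.single (hc (a + 1)) 1) = R.mkQ (Pi.single (hc a) 1) := by
    intro a
    rw [← sub_eq_zero, ← map_sub, Submodule.mkQ_apply, Submodule.Quotient.mk_eq_zero]
    refine ⟨Pi.single (a + 1) 1, ?_⟩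
    rw [hsingle, add_sub_cancel_right]
    ext c
    exact (CharTwo.sub_eq_add _ _).symm
  have hcl' := Fin.eq_of_forall_add_one (f := fun a => R.mkQ (Pi.single (hc a) 1)) hcl
  have hq : Module.finrank (ZMod 2) ((Fin D.n → ZMod 2) ⧸ R) ≤ 1 := by
    refine finrank_le_one (R.mkQ (Pi.single (hc 0) 1)) fun w => ?_
    obtain ⟨g, rfl⟩ := R.mkQ_surjective w
    refine ⟨∑ c, g c, ?_⟩
    rw [Finset.sum_smul]
    conv_rhs => rw [← Finset.univ_sum_single g, map_sum]
    refine Finset.sum_congr rfl fun c _ => ?_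
    have : (Pi.single c (g c) : Fin D.n → ZMod 2) = g c • Pi.single c 1 := by
      rw [← Pi.single_smul, smul_eq_mul, mul_one]
    rw [this, map_smul, ← hcu c]
    congr 1
    rw [hcl' 0 (D.underIn c)]
  have h1 := Submodule.finrank_quotient_add_finrank R
  have h2 := LinearMap.finrank_range_add_finrank_ker D.arcBoundary
  simp only [Module.finrank_fintype_fun_eq_card, Fintype.card_fin] at h1 h2
  change _ + Module.finrank (ZMod 2) R = _ at h1
  change Module.finrank (ZMod 2) R + _ = _ at h2
  omega

theorem Planar.exists_faceColoring {D : GaussCode} (hD : D.Planar) (hn : D.n ≠ 0) :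
    ∃ f : D.Face → ZMod 2, ∀ a, f (Quot.mk _ (a, true)) + f (Quot.mk _ (a, false)) = 1 := by
  have hker : Module.finrank (ZMod 2) (LinearMap.ker D.faceBoundary) ≤ 1 := by
    refine finrank_le_one (⟨fun _ => 1, ?_⟩ : LinearMap.ker D.faceBoundary) fun w => ?_
    · ext a
      exact CharTwo.add_self_eq_zero (1 : ZMod 2)
    · refine ⟨w.1 (Quot.mk _ (0, true)), ?_⟩
      ext x
      simpa using D.faceBoundary_ker_const hn w.2 _ _
  have h1 := LinearMap.finrank_range_add_finrank_ker D.faceBoundary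
  have h2 := D.finrank_ker_arcBoundary_le hn
  have hle : LinearMap.range D.faceBoundary ≤ LinearMap.ker D.arcBoundary := by
    rintro _ ⟨f, rfl⟩
    exact D.arcBoundary_faceBoundary f
  have hcard : Fintype.card D.Face = D.n + 2 := by
    rw [← hD, Nat.card_eq_fintype_card]
  rw [Module.finrank_fintype_fun_eq_card, hcard] at h1
  have heq := Submodule.eq_of_le_of_finrank_le hle (by omega)
  have hone : (fun _ => 1 : Arc D.n → ZMod 2) ∈ LinearMap.ker D.arcBoundary := by
    ext c
    change (1 : ZMod 2) + 1 + 1 + 1 = 0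
    decide
  rw [← heq] at hone
  obtain ⟨f, hf⟩ := hone
  exact ⟨f, fun a => congrFun hf a⟩

/-- A colouring of the arcs that alternates along the knot and in which the two strands of each
crossing enter with different colours. -/
structure IsAlternating (φ : Arc D.n → Bool) : Prop where
  underIn_eq (c : Fin D.n) : φ (D.underIn c) = !φ (D.overIn c)
  overOut_eq (c : Fin D.n) : φ (D.overOut c) = !φ (D.overIn c)
  underOut_eq (c : Fin D.n) : φ (D.underOut c) = φ (D.overIn c)

theorem Planar.exists_isAlternating {D : GaussCode} (hD : D.Planar) :
    ∃ φ, D.IsAlternating φ := by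
  by_cases hn : D.n = 0
  · exact ⟨fun _ => true, ⟨fun c => absurd c.2 (by omega), fun c => absurd c.2 (by omega),
      fun c => absurd c.2 (by omega)⟩⟩
  obtain ⟨f, hf⟩ := hD.exists_faceColoring hn
  have hz : ∀ x y : ZMod 2, x + y = 1 → decide (x = 1) = !decide (y = 1) := by decide
  have hz' : ∀ x y : ZMod 2, x + y = 1 → decide (y = 1) = !decide (x = 1) := by decide
  have key : ∀ c, decide (f (Quot.mk _ (D.underIn c, true)) = 1) =
        !decide (f (Quot.mk _ (D.overIn c, true)) = 1) ∧
      decide (f (Quot.mk _ (D.overOut c, true)) = 1) =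
        !decide (f (Quot.mk _ (D.overIn c, true)) = 1) ∧
      decide (f (Quot.mk _ (D.underOut c, true)) = 1) =
        decide (f (Quot.mk _ (D.overIn c, true)) = 1) := by
    intro c
    rcases D.face_relations c with ⟨-, e1, e3, e4, e5⟩ | ⟨-, e1, e3, e4, e5⟩
    · refine ⟨?_, ?_, ?_⟩
      · rw [e1]; exact hz' _ _ (hf _)
      · rw [← e4, e5]; exact hz' _ _ (hf _)
      · rw [e5]
    · refine ⟨?_, ?_, ?_⟩
      · rw [e3]; exact hz _ _ (hf _)
      · rw [← e1, e3]; exact hz _ _ (hf _)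
      · have h6 := hz _ _ (hf (D.underOut c))
        have h7 := hz _ _ (hf (D.overIn c))
        rw [h6, e4, ← h7]
  exact ⟨fun a => decide (f (Quot.mk _ (a, true)) = 1),
    ⟨fun c => (key c).1, fun c => (key c).2.1, fun c => (key c).2.2⟩⟩

end GaussCode
end
noncomputable section

/-! ### Circles and the change of a resolution at one crossing -/

@[to_additive]
theorem Fintype.prod_mul_eq_of_identify {A B M : Type*} [Fintype A] [Fintype B] [CommMonoid M]
    {f : A → B} (hf : Function.Surjective f) {p q : A} (hpq : p ≠ q) (hfpq : f p = f q)
    (hinj : ∀ a b, f a = f b → a = b ∨ (a = p ∨ a = q) ∧ (b = p ∨ b = q))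
    {F : A → M} {G : B → M} (h : ∀ a, a ≠ p → a ≠ q → F a = G (f a)) :
    (∏ a, F a) * G (f p) = (∏ b, G b) * (F p * F q) := by
  classical
  have h1 : ∏ a, F a = F p * (F q * ∏ a ∈ (Finset.univ.erase p).erase q, F a) := by
    rw [Finset.mul_prod_erase _ _ (by simp [hpq.symm]), Finset.mul_prod_erase _ _ (by simp)]
  have h2 : ∏ b, G b = G (f p) * ∏ b ∈ Finset.univ.erase (f p), G b :=
    (Finset.mul_prod_erase _ _ (by simp)).symm
  have h3 : ∏ a ∈ (Finset.univ.erase p).erase q, F a = ∏ b ∈ Finset.univ.erase (f p), G b := by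
    refine Finset.prod_bij (fun a _ => f a) ?_ ?_ ?_ ?_
    · intro a ha
      simp only [Finset.mem_erase, Finset.mem_univ, and_true, ne_eq] at ha ⊢
      intro hfa
      rcases hinj _ _ hfa with rfl | ⟨rfl | rfl, -⟩
      exacts [ha.2 rfl, ha.2 rfl, ha.1 rfl]
    · intro a ha b _ hab
      simp only [Finset.mem_erase, Finset.mem_univ, and_true, ne_eq] at ha
      rcases hinj _ _ hab with rfl | ⟨rfl | rfl, -⟩
      exacts [rfl, absurd rfl ha.2, absurd rfl ha.1]
    · intro b hb
      obtain ⟨a, rfl⟩ := hf b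
      simp only [Finset.mem_erase, Finset.mem_univ, and_true, ne_eq] at hb
      refine ⟨a, ?_, rfl⟩
      simp only [Finset.mem_erase, Finset.mem_univ, and_true, ne_eq]
      exact ⟨fun h => hb (by rw [h, hfpq]), fun h => hb (by rw [h])⟩
    · intro a ha
      simp only [Finset.mem_erase, Finset.mem_univ, and_true, ne_eq] at ha
      exact h a ha.2 ha.1
  rw [h1, h2, h3]
  ac_rfl

namespace KnotDiagram

variable (D : KnotDiagram)

theorem n_ne_zero {D : KnotDiagram} (c : Fin D.n) : D.n ≠ 0 := fun h => absurd c.2 (by omega)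

theorem circle_eq_of_joined {D : KnotDiagram} {v : D.Vertex} {a b : Arc D.n} (h : D.Joined v a b) :
    D.circle v a = D.circle v b := Quot.sound h

theorem circle_surjective (v : D.Vertex) : Function.Surjective (D.circle v) := Quot.mk_surjective

/-- A function on the arcs that does not distinguish joined arcs is constant on circles. -/
theorem eq_of_circle_eq {D : KnotDiagram} {v : D.Vertex} {β : Sort*} {f : Arc D.n → β}
    (hf : ∀ a b, D.Joined v a b → f a = f b) {a b : Arc D.n} (h : D.circle v a = D.circle v b) :
    f a = f b :=
  congrArg (Quot.lift f hf) h

/-- The arcs at `c` that point towards `c` in the orientation that follows the knot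
on the arcs of colour `true` and is opposite to it on the others. -/
def sink (φ : Arc D.n → Bool) : Fin D.n × Bool → Arc D.n
  | (c, true) => if φ (D.underIn c) = true then D.underIn c else D.overIn c
  | (c, false) => if φ (D.underIn c) = true then D.underOut c else D.overOut c

/-- The arcs at `c` that point away from `c` in the orientation of `sink`. -/
def source (φ : Arc D.n → Bool) : Fin D.n × Bool → Arc D.n
  | (c, true) => if φ (D.underIn c) = true then D.overIn c else D.underIn c
  | (c, false) => if φ (D.underIn c) = true then D.overOut c else D.underOut c

variable {D}

theorem underOut_inj {c c' : Fin D.n} : D.underOut c = D.underOut c' ↔ c = c' := by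
  rw [GaussCode.underOut, GaussCode.underOut, add_left_inj, GaussCode.underIn_inj]

theorem overOut_inj {c c' : Fin D.n} : D.overOut c = D.overOut c' ↔ c = c' := by
  rw [GaussCode.overOut, GaussCode.overOut, add_left_inj, GaussCode.overIn_inj]

theorem underOut_ne_overOut (c c' : Fin D.n) : D.underOut c ≠ D.overOut c' := by
  rw [GaussCode.underOut, GaussCode.overOut, ne_eq, add_left_inj]
  exact D.underIn_ne_overIn c c'

variable {φ : Arc D.n → Bool}

theorem apply_sink (hφ : D.IsAlternating φ) (x : Fin D.n × Bool) : φ (D.sink φ x) = x.2 := by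
  obtain ⟨c, b⟩ := x
  have h1 := hφ.underIn_eq c
  have h2 := hφ.overOut_eq c
  have h3 := hφ.underOut_eq c
  cases b <;> simp only [sink] <;> split_ifs with h <;> grind

theorem apply_source (hφ : D.IsAlternating φ) (x : Fin D.n × Bool) :
    φ (D.source φ x) = !x.2 := by
  obtain ⟨c, b⟩ := x
  have h1 := hφ.underIn_eq c
  have h2 := hφ.overOut_eq c
  have h3 := hφ.underOut_eq c
  cases b <;> simp only [source] <;> split_ifs with h <;> grind

theorem sink_injective (hφ : D.IsAlternating φ) : Function.Injective (D.sink φ) := by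
  rintro ⟨c, b⟩ ⟨c', b'⟩ h
  have hb : b = b' := by
    have := congrArg φ h
    rwa [apply_sink hφ, apply_sink hφ] at this
  subst hb
  have h1 := fun x y => (D.underIn_ne_overIn x y).symm
  have h2 := fun x y => (underOut_ne_overOut (D := D) x y).symm
  cases b <;> simp only [sink] at h <;> split_ifs at h <;>
    simp_all [underOut_inj, overOut_inj, underOut_ne_overOut, GaussCode.underIn_inj,
      GaussCode.overIn_inj, GaussCode.underIn_ne_overIn]

theorem source_injective (hφ : D.IsAlternating φ) : Function.Injective (D.source φ) := by
  rintro ⟨c, b⟩ ⟨c', b'⟩ h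
  have hb : b = b' := by
    have := congrArg φ h
    rw [apply_source hφ, apply_source hφ] at this
    simpa using this
  subst hb
  have h1 := fun x y => (D.underIn_ne_overIn x y).symm
  have h2 := fun x y => (underOut_ne_overOut (D := D) x y).symm
  cases b <;> simp only [source] at h <;> split_ifs at h <;>
    simp_all [underOut_inj, overOut_inj, underOut_ne_overOut, GaussCode.underIn_inj,
      GaussCode.overIn_inj, GaussCode.underIn_ne_overIn]

theorem bijective_of_injective_of_ne_zero (hn : D.n ≠ 0) {f : Fin D.n × Bool → Arc D.n}
    (hf : Function.Injective f) : Function.Bijective f := by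
  rw [Fintype.bijective_iff_injective_and_card]
  refine ⟨hf, ?_⟩
  simp only [Fintype.card_prod, Fintype.card_fin, Fintype.card_bool]
  omega

theorem exists_sink (hφ : D.IsAlternating φ) (hn : D.n ≠ 0) (a : Arc D.n) :
    ∃ x, D.sink φ x = a :=
  (bijective_of_injective_of_ne_zero hn (sink_injective hφ)).2 a

/-- The position of the source that follows a sink in the resolution `v`. -/
def turn (v : D.Vertex) (x : Fin D.n × Bool) : Fin D.n × Bool :=
  (x.1, x.2 ^^ (v x.1 != D.positive x.1))

theorem turn_turn (v : D.Vertex) (x : Fin D.n × Bool) : turn v (turn v x) = x := by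
  simp [turn]

/-- The permutation of the arcs whose cycles are the circles of the resolution `v`. -/
def circlePerm (hφ : D.IsAlternating φ) (hn : D.n ≠ 0) (v : D.Vertex) : Equiv.Perm (Arc D.n) :=
  (Equiv.ofBijective _ (bijective_of_injective_of_ne_zero hn (sink_injective hφ))).symm.trans
    ((Function.Involutive.toPerm (turn v) (turn_turn v)).trans
      (Equiv.ofBijective _ (bijective_of_injective_of_ne_zero hn (source_injective hφ))))

theorem turn_of_eq {v : D.Vertex} {c : Fin D.n} (hv : v c = D.positive c) (b : Bool) :
    turn v (c, b) = (c, b) := by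
  simp [turn, hv]

theorem turn_of_ne {v : D.Vertex} {c : Fin D.n} (hv : v c ≠ D.positive c) (b : Bool) :
    turn v (c, b) = (c, !b) := by
  have : (v c != D.positive c) = true := bne_iff_ne.2 hv
  simp [turn, this]

theorem circlePerm_sink (hφ : D.IsAlternating φ) (hn : D.n ≠ 0) (v : D.Vertex)
    (x : Fin D.n × Bool) : circlePerm hφ hn v (D.sink φ x) = D.source φ (turn v x) := by
  have h : (Equiv.ofBijective _ (bijective_of_injective_of_ne_zero hn
      (sink_injective hφ))).symm (D.sink φ x) = x := by
    rw [Equiv.symm_apply_eq]; rfl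
  simp only [circlePerm, Equiv.trans_apply, h]
  rfl

theorem circle_source_turn (φ : Arc D.n → Bool) (v : D.Vertex) (x : Fin D.n × Bool) :
    D.circle v (D.source φ (turn v x)) = D.circle v (D.sink φ x) := by
  obtain ⟨c, b⟩ := x
  by_cases hv : v c = D.positive c
  · have h1 := circle_eq_of_joined (Joined.unoriented_in c hv)
    have h2 := circle_eq_of_joined (Joined.unoriented_out c hv)
    rw [turn_of_eq hv]
    cases b <;> simp only [source, sink] <;> split_ifs <;> simp only [h1, h2]
  · have h1 := circle_eq_of_joined (Joined.oriented_under c hv)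
    have h2 := circle_eq_of_joined (Joined.oriented_over c hv)
    rw [turn_of_ne hv]
    cases b <;> simp only [source, sink, Bool.not_true, Bool.not_false] <;> split_ifs <;>
      simp only [h1, h2]

theorem sameCycle_of_joined (hφ : D.IsAlternating φ) (hn : D.n ≠ 0) {v : D.Vertex}
    {a b : Arc D.n} (h : D.Joined v a b) : (circlePerm hφ hn v).SameCycle a b := by
  have key : ∀ x, (circlePerm hφ hn v).SameCycle (D.sink φ x) (D.source φ (turn v x)) := fun x =>
    ⟨1, by rw [zpow_one, circlePerm_sink]⟩
  cases h with
  | oriented_under c hv =>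
    have h1 := key (c, true)
    have h2 := key (c, false)
    rw [turn_of_ne hv] at h1 h2
    by_cases hu : φ (D.underIn c) = true <;> simp [sink, source, hu] at h1 h2
    · exact h1
    · exact h2.symm
  | oriented_over c hv =>
    have h1 := key (c, true)
    have h2 := key (c, false)
    rw [turn_of_ne hv] at h1 h2
    by_cases hu : φ (D.underIn c) = true <;> simp [sink, source, hu] at h1 h2
    · exact h2.symm
    · exact h1
  | unoriented_in c hv =>
    have h1 := key (c, true)
    have h2 := key (c, false)
    rw [turn_of_eq hv] at h1 h2
    by_cases hu : φ (D.underIn c) = true <;> simp [sink, source, hu] at h1 h2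
    · exact h1
    · exact h1.symm
  | unoriented_out c hv =>
    have h1 := key (c, true)
    have h2 := key (c, false)
    rw [turn_of_eq hv] at h1 h2
    by_cases hu : φ (D.underIn c) = true <;> simp [sink, source, hu] at h1 h2
    · exact h2
    · exact h2.symm

theorem circle_eq_iff_sameCycle (hφ : D.IsAlternating φ) (hn : D.n ≠ 0) {v : D.Vertex}
    {a b : Arc D.n} : D.circle v a = D.circle v b ↔ (circlePerm hφ hn v).SameCycle a b := by
  constructor
  · intro h
    have h1 := eq_of_circle_eq (f := fun x => (circlePerm hφ hn v).SameCycle a x)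
      (fun x y hxy => propext ⟨fun h => h.trans (sameCycle_of_joined hφ hn hxy),
        fun h => h.trans (sameCycle_of_joined hφ hn hxy).symm⟩) h
    exact h1.mp (Equiv.Perm.SameCycle.refl _ _)
  · intro h
    obtain ⟨i, -, rfl⟩ := h.exists_pow_eq'
    have key : ∀ i : ℕ, D.circle v a = D.circle v ((circlePerm hφ hn v ^ i) a) := by
      intro i
      induction i with
      | zero => rfl
      | succ i ih =>
        obtain ⟨x, hx⟩ := exists_sink hφ hn ((circlePerm hφ hn v ^ i) a)
        rw [pow_succ', Equiv.Perm.mul_apply, ih, ← hx, circlePerm_sink, circle_source_turn]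
    exact key i

/-- The resolutions `v` and `w` differ at the crossing `c` and nowhere else. -/
def DifferAt (c : Fin D.n) (v w : D.Vertex) : Prop := v c ≠ w c ∧ ∀ c', c' ≠ c → v c' = w c'

theorem DifferAt.symm {c : Fin D.n} {v w : D.Vertex} (h : DifferAt c v w) : DifferAt c w v :=
  ⟨h.1.symm, fun c' hc' => (h.2 c' hc').symm⟩

theorem DifferAt.circlePerm_eq {c : Fin D.n} {v w : D.Vertex} (h : DifferAt c v w)
    (hφ : D.IsAlternating φ) (hn : D.n ≠ 0) : circlePerm hφ hn w =
      circlePerm hφ hn v * Equiv.swap (D.sink φ (c, true)) (D.sink φ (c, false)) := by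
  ext1 a
  obtain ⟨⟨c', b⟩, rfl⟩ := exists_sink hφ hn a
  rw [circlePerm_sink, Equiv.Perm.mul_apply]
  by_cases hc : c' = c
  · subst hc
    have h1 : w c' = !v c' := by
      have := h.1
      revert this
      cases v c' <;> cases w c' <;> simp
    cases b
    · rw [Equiv.swap_apply_right, circlePerm_sink]
      simp only [turn, h1]
      cases v c' <;> cases D.positive c' <;> rfl
    · rw [Equiv.swap_apply_left, circlePerm_sink]
      simp only [turn, h1]
      cases v c' <;> cases D.positive c' <;> rfl
  · rw [Equiv.swap_apply_of_ne_of_ne, circlePerm_sink]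
    · simp [turn, h.2 c' hc]
    · exact fun h1 => hc (congrArg Prod.fst (sink_injective hφ h1))
    · exact fun h1 => hc (congrArg Prod.fst (sink_injective hφ h1))

theorem circle_sink_eq_iff (φ : Arc D.n → Bool) (v : D.Vertex) (c : Fin D.n) :
    D.circle v (D.sink φ (c, true)) = D.circle v (D.sink φ (c, false)) ↔
      D.circle v (D.underIn c) = D.circle v (D.underOut c) := by
  have key : D.circle v (D.sink φ (c, true)) = D.circle v (D.sink φ (c, false)) ↔
      D.circle v (D.source φ (c, true)) = D.circle v (D.source φ (c, false)) := by
    rw [← circle_source_turn, ← circle_source_turn]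
    by_cases hv : v c = D.positive c
    · simp only [turn_of_eq hv]
    · simp only [turn_of_ne hv]
      exact eq_comm
  by_cases hu : φ (D.underIn c) = true
  · simp only [sink, hu, if_true]
  · rw [key]; simp [source, hu]

/-- Changing the resolution at a crossing of a planar diagram either merges two circles or splits
one. -/
theorem DifferAt.circle_eq_iff {c : Fin D.n} {v w : D.Vertex} (h : DifferAt c v w) :
    D.circle w (D.underIn c) = D.circle w (D.underOut c) ↔
      D.circle v (D.underIn c) ≠ D.circle v (D.underOut c) := by
  obtain ⟨φ, hφ⟩ := D.planar.exists_isAlternating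
  rw [← circle_sink_eq_iff φ, ne_eq, ← circle_sink_eq_iff φ v,
    circle_eq_iff_sameCycle hφ (n_ne_zero c), circle_eq_iff_sameCycle hφ (n_ne_zero c),
    h.circlePerm_eq hφ (n_ne_zero c)]
  exact Equiv.Perm.sameCycle_mul_swap_iff fun h1 => by
    have := sink_injective hφ h1
    simp at this

theorem circle_ends (v : D.Vertex) (c : Fin D.n) :
    (D.circle v (D.overIn c) = D.circle v (D.underIn c) ∧
      D.circle v (D.overOut c) = D.circle v (D.underOut c)) ∨
    (D.circle v (D.overIn c) = D.circle v (D.underOut c) ∧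
      D.circle v (D.overOut c) = D.circle v (D.underIn c)) := by
  by_cases hv : v c = D.positive c
  · exact Or.inl ⟨(circle_eq_of_joined (.unoriented_in c hv)).symm,
      (circle_eq_of_joined (.unoriented_out c hv)).symm⟩
  · exact Or.inr ⟨circle_eq_of_joined (.oriented_over c hv),
      (circle_eq_of_joined (.oriented_under c hv)).symm⟩

theorem DifferAt.joined {c : Fin D.n} {v w : D.Vertex} (h : DifferAt c v w) {a b : Arc D.n}
    (hj : D.Joined v a b) : D.Joined w a b ∨
      (a = D.underIn c ∨ a = D.underOut c ∨ a = D.overIn c ∨ a = D.overOut c) ∧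
      (b = D.underIn c ∨ b = D.underOut c ∨ b = D.overIn c ∨ b = D.overOut c) := by
  cases hj with
  | oriented_under c' hv =>
    by_cases hc : c' = c
    · subst hc; exact Or.inr ⟨by simp, by simp⟩
    · exact Or.inl (.oriented_under c' (by rwa [← h.2 c' hc]))
  | oriented_over c' hv =>
    by_cases hc : c' = c
    · subst hc; exact Or.inr ⟨by simp, by simp⟩
    · exact Or.inl (.oriented_over c' (by rwa [← h.2 c' hc]))
  | unoriented_in c' hv =>
    by_cases hc : c' = c
    · subst hc; exact Or.inr ⟨by simp, by simp⟩
    · exact Or.inl (.unoriented_in c' (by rwa [← h.2 c' hc]))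
  | unoriented_out c' hv =>
    by_cases hc : c' = c
    · subst hc; exact Or.inr ⟨by simp, by simp⟩
    · exact Or.inl (.unoriented_out c' (by rwa [← h.2 c' hc]))

theorem circle_of_end (v : D.Vertex) {c : Fin D.n} {a : Arc D.n}
    (ha : a = D.underIn c ∨ a = D.underOut c ∨ a = D.overIn c ∨ a = D.overOut c) :
    D.circle v a = D.circle v (D.underIn c) ∨ D.circle v a = D.circle v (D.underOut c) := by
  have h := circle_ends v c
  rcases ha with rfl | rfl | rfl | rfl <;> tauto

theorem circle_eq_of_merge {c : Fin D.n} {v w : D.Vertex} (h : DifferAt c v w)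
    (hm : D.circle v (D.underIn c) ≠ D.circle v (D.underOut c))
    {a b : Arc D.n} (hab : D.circle v a = D.circle v b) :
    D.circle w a = D.circle w b := by
  refine eq_of_circle_eq (fun x y hxy => ?_) hab
  have hw := h.circle_eq_iff.2 hm
  rcases h.joined hxy with h1 | ⟨h1, h2⟩
  · exact circle_eq_of_joined h1
  · rcases circle_of_end w h1 with h3 | h3 <;> rcases circle_of_end w h2 with h4 | h4 <;>
      simp only [h3, h4, hw]

theorem circle_eq_or_of_merge {c : Fin D.n} {v w : D.Vertex} (h : DifferAt c v w)
    {a b : Arc D.n} (hab : D.circle w a = D.circle w b) :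
    D.circle v a = D.circle v b ∨
      (D.circle v a = D.circle v (D.underIn c) ∨ D.circle v a = D.circle v (D.underOut c)) ∧
      (D.circle v b = D.circle v (D.underIn c) ∨ D.circle v b = D.circle v (D.underOut c)) := by
  classical
  have key := eq_of_circle_eq (f := fun x => if D.circle v x = D.circle v (D.underOut c) then
    D.circle v (D.underIn c) else D.circle v x) (fun x y hxy => ?_) hab
  · split_ifs at key with h1 h2 h2
    · exact Or.inl (h1.trans h2.symm)
    · exact Or.inr ⟨Or.inr h1, Or.inl key.symm⟩
    · exact Or.inr ⟨Or.inl key, Or.inr h2⟩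
    · exact Or.inl key
  · rcases h.symm.joined hxy with h1 | ⟨h1, h2⟩
    · simp only [circle_eq_of_joined h1]
    · rcases circle_of_end v h1 with h3 | h3 <;> rcases circle_of_end v h2 with h4 | h4 <;>
        simp [h3, h4]

@[to_additive]
theorem prod_circle_merge {M : Type*} [CommMonoid M] {c : Fin D.n} {v w : D.Vertex}
    (h : DifferAt c v w)
    (hm : D.circle v (D.underIn c) ≠ D.circle v (D.underOut c))
    {F : D.Circle v → M} {G : D.Circle w → M}
    (hFG : ∀ a, D.circle v a ≠ D.circle v (D.underIn c) →
      D.circle v a ≠ D.circle v (D.underOut c) → F (D.circle v a) = G (D.circle w a)) :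
    (∏ C, F C) * G (D.circle w (D.underIn c)) =
      (∏ C, G C) * (F (D.circle v (D.underIn c)) * F (D.circle v (D.underOut c))) := by
  let f : D.Circle v → D.Circle w := Quot.lift (D.circle w) fun a b hab =>
    circle_eq_of_merge h hm (circle_eq_of_joined hab)
  have hf : ∀ a, f (D.circle v a) = D.circle w a := fun a => rfl
  refine Fintype.prod_mul_eq_of_identify (f := f) ?_ hm ?_ ?_ ?_
  · intro C
    obtain ⟨a, rfl⟩ := D.circle_surjective w C
    exact ⟨D.circle v a, rfl⟩
  · exact h.circle_eq_iff.2 hm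
  · intro C C'
    obtain ⟨a, rfl⟩ := D.circle_surjective v C
    obtain ⟨b, rfl⟩ := D.circle_surjective v C'
    exact circle_eq_or_of_merge h
  · intro C
    obtain ⟨a, rfl⟩ := D.circle_surjective v C
    exact hFG a

end KnotDiagram
end
noncomputable section

/-! ### Lee's differential in the basis of idempotents -/

theorem Fintype.sum_eq_sum_update {ι M : Type*} [Fintype ι] [DecidableEq ι] [AddCommMonoid M]
    {F : (ι → Bool) → M} (y : ι → Bool) (r : ι) (hF : ∀ z, (∃ i, i ≠ r ∧ z i ≠ y i) → F z = 0) :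
    ∑ z, F z = ∑ b, F (Function.update y r b) := by
  refine (Fintype.sum_of_injective (Function.update y r) (Function.update_injective y r) _ _
    (fun z hz => hF z ?_) fun _ => rfl).symm
  by_contra! h
  exact hz ⟨z r, by
    ext i
    by_cases hi : i = r
    · subst hi; simp
    · rw [Function.update_of_ne hi, h i hi]⟩

theorem Fintype.sum_eq_sum_update_update {ι M : Type*} [Fintype ι] [DecidableEq ι]
    [AddCommMonoid M] {F : (ι → Bool) → M} (y : ι → Bool) {p q : ι} (hpq : p ≠ q)
    (hF : ∀ z, (∃ i, i ≠ p ∧ i ≠ q ∧ z i ≠ y i) → F z = 0) :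
    ∑ z, F z = ∑ b : Bool × Bool, F (Function.update (Function.update y p b.1) q b.2) := by
  refine (Fintype.sum_of_injective
    (fun b : Bool × Bool => Function.update (Function.update y p b.1) q b.2)
    (fun b b' h => ?_) _ _ (fun z hz => hF z ?_) fun _ => rfl).symm
  · have h1 := congrFun h p
    have h2 := congrFun h q
    simp only [Function.update_self, Function.update_of_ne hpq] at h1 h2
    exact Prod.ext h1 h2
  · by_contra! h
    exact hz ⟨(z p, z q), by
      ext i
      by_cases hi : i = q
      · subst hi; simp
      · simp only [Function.update_of_ne hi]
        by_cases hi' : i = p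
        · subst hi'; simp
        · rw [Function.update_of_ne hi', h i hi' hi]⟩

namespace KnotDiagram

variable {D : KnotDiagram}

instance (v : D.Vertex) : DecidableEq (D.Circle v) := Classical.decEq _

theorem IsEdge.differAt {c : Fin D.n} {v w : D.Vertex} (h : D.IsEdge c v w) : DifferAt c v w := by
  obtain ⟨h1, rfl⟩ := h
  refine ⟨by simp [h1], fun c' hc' => (Function.update_of_ne hc' _ _).symm⟩

variable (D) in
/-- The colouring `φ` of the arcs is constant on the circles of the resolution `v`. -/
def Compatible (v : D.Vertex) (φ : Arc D.n → Bool) : Prop := ∀ a b, D.Joined v a b → φ a = φ b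

theorem Compatible.apply_eq {v : D.Vertex} {φ : Arc D.n → Bool} (h : D.Compatible v φ)
    {a b : Arc D.n} (hab : D.circle v a = D.circle v b) : φ a = φ b := eq_of_circle_eq h hab

theorem circle_out {v : D.Vertex} (C : D.Circle v) : D.circle v C.out = C := Quot.out_eq C

theorem Compatible.apply_out {v : D.Vertex} {φ : Arc D.n → Bool} (h : D.Compatible v φ)
    (a : Arc D.n) : φ (D.circle v a).out = φ a := h.apply_eq (circle_out _)

theorem Compatible.of_merge {c : Fin D.n} {v w : D.Vertex} {φ : Arc D.n → Bool}
    (hw : D.Compatible w φ) (h : DifferAt c v w)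
    (hm : D.circle v (D.underIn c) ≠ D.circle v (D.underOut c)) : D.Compatible v φ :=
  fun _ _ hab => hw.apply_eq (circle_eq_of_merge h hm (circle_eq_of_joined hab))

theorem Compatible.iff_of_split {c : Fin D.n} {v w : D.Vertex} {φ : Arc D.n → Bool}
    (hw : D.Compatible w φ) (h : DifferAt c v w)
    (hm : D.circle v (D.underIn c) = D.circle v (D.underOut c)) :
    D.Compatible v φ ↔ φ (D.underIn c) = φ (D.underOut c) := by
  refine ⟨fun hv => hv.apply_eq hm, fun hφ a b hab => ?_⟩
  rcases h.joined hab with h1 | ⟨h1, h2⟩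
  · exact hw _ _ h1
  · rcases circle_of_end w h1 with h3 | h3 <;> rcases circle_of_end w h2 with h4 | h4 <;>
      simp only [hw.apply_eq h3, hw.apply_eq h4, hφ]

/-- The two characters of `ℚ[X] / (X ^ 2 - 1)`, where `true` is `1` and `false` is `X`. -/
def chi (ψ x : Bool) : ℚ := if x = true then 1 else if ψ = true then 1 else -1

theorem chi_mul_self (ψ x : Bool) : chi ψ x * chi ψ x = 1 := by
  cases ψ <;> cases x <;> norm_num [chi]

/-- The value of `1 ⊗ 1 + X ⊗ X` at a pair of equal characters, times that of `X`. -/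
def splitFactor (ψ : Bool) : ℚ := if ψ = true then 2 else -2

theorem splitFactor_ne_zero (ψ : Bool) : splitFactor ψ ≠ 0 := by
  cases ψ <;> norm_num [splitFactor]

variable (D) in
/-- The value at a labelling of the circles of the product of characters given by a colouring. -/
def weight (v : D.Vertex) (φ : Arc D.n → Bool) (x : D.Circle v → Bool) : ℚ :=
  ∏ C, chi (φ C.out) (x C)

open scoped Classical in
variable (D) in
/-- The factor that Lee's differential acquires along an edge of the cube. -/
def edgeFactor (c : Fin D.n) (v : D.Vertex) (φ : Arc D.n → Bool) : ℚ :=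
  if D.circle v (D.underIn c) ≠ D.circle v (D.underOut c) then 1 else splitFactor (φ (D.underIn c))

theorem sum_weight_mul_edgeCoeff_of_merge {c : Fin D.n} {v w : D.Vertex} {φ : Arc D.n → Bool}
    (hw : D.Compatible w φ) (h : D.IsEdge c v w)
    (hm : D.circle v (D.underIn c) ≠ D.circle v (D.underOut c)) (x : D.Circle v → Bool) :
    ∑ y, D.weight w φ y * D.edgeCoeff 1 c ⟨v, x⟩ ⟨w, y⟩ = D.weight v φ x := by
  classical
  have hd := h.differAt
  have hv := hw.of_merge hd hm
  set r := D.circle w (D.underIn c) with hr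
  have hr' : D.circle w (D.underOut c) = r := (hd.circle_eq_iff.2 hm).symm
  have hcr : ∀ a, D.circle v a ≠ D.circle v (D.underIn c) →
      D.circle v a ≠ D.circle v (D.underOut c) → ∀ b, D.circle w a = D.circle w b →
      D.circle v a = D.circle v b := by
    intro a h1 h2 b hab
    rcases circle_eq_or_of_merge hd hab with h3 | ⟨h3 | h3, -⟩
    exacts [h3, absurd h3 h1, absurd h3 h2]
  rw [Fintype.sum_eq_sum_update (fun C => x (D.circle v C.out)) r]
  · have hagree : ∀ z, D.AgreeAway c ⟨v, x⟩
        ⟨w, Function.update (fun C => x (D.circle v C.out)) r z⟩ := by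
      intro z a h1 h2
      simp only at h1 h2 ⊢
      rw [Function.update_of_ne (fun h3 => h1 (hcr a h1 h2 _ h3)),
        hcr a h1 h2 _ (circle_out _).symm]
    have hweight : ∀ z, D.weight w φ (Function.update (fun C => x (D.circle v C.out)) r z) =
        D.weight v φ x * (chi (φ (D.underIn c)) z * (chi (φ (D.underIn c))
          (x (D.circle v (D.underIn c))) * chi (φ (D.underIn c))
          (x (D.circle v (D.underOut c))))) := by
      intro z
      have h1 := prod_circle_merge hd hm (F := fun C => chi (φ C.out) (x C))
        (G := fun C => chi (φ C.out) (Function.update (fun C => x (D.circle v C.out)) r z C))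
        (by
          intro a h1 h2
          rw [Function.update_of_ne (fun h3 => h1 (hcr a h1 h2 _ h3)),
            hcr a h1 h2 _ (circle_out _).symm, hv.apply_out, hw.apply_out])
      simp only [← hr, Function.update_self] at h1
      rw [hr, hw.apply_out, hv.apply_out, hv.apply_out,
        ← hw.apply_eq (hd.circle_eq_iff.2 hm)] at h1
      have h2 := chi_mul_self (φ (D.underIn c)) (x (D.circle v (D.underIn c)))
      have h3 := chi_mul_self (φ (D.underIn c)) (x (D.circle v (D.underOut c)))
      unfold weight
      rw [← mul_assoc, h1]
      linear_combination (-(∏ C, chi (φ C.out)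
        (Function.update (fun C => x (D.circle v C.out)) r z C))) *
        (h2 * (chi (φ (D.underIn c)) (x (D.circle v (D.underOut c))) *
          chi (φ (D.underIn c)) (x (D.circle v (D.underOut c)))) + h3)
    have hcoeff : ∀ z, D.edgeCoeff 1 c ⟨v, x⟩
        ⟨w, Function.update (fun C => x (D.circle v C.out)) r z⟩ =
        mCoeff 1 (x (D.circle v (D.underIn c))) (x (D.circle v (D.underOut c))) z := by
      intro z
      rw [edgeCoeff, if_pos ⟨h, hagree z⟩, if_pos hm]
      simp only [← hr, Function.update_self]
    simp only [hweight, hcoeff, Fintype.sum_bool]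
    cases φ (D.underIn c) <;> cases x (D.circle v (D.underIn c)) <;>
      cases x (D.circle v (D.underOut c)) <;> norm_num [chi, mCoeff]
  · rintro z ⟨C, hC, hz⟩
    have : ¬ D.AgreeAway c ⟨v, x⟩ ⟨w, z⟩ := by
      intro hag
      have hne : ∀ b, D.circle w b = r → D.circle v C.out ≠ D.circle v b := by
        intro b hb h1
        have := circle_eq_of_merge hd hm h1
        rw [circle_out, hb] at this
        exact hC this
      have h1 := hag C.out (hne _ hr.symm) (hne _ hr')
      simp only [circle_out] at h1
      exact hz h1.symm
    rw [edgeCoeff, if_neg fun h1 => this h1.2, mul_zero]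

theorem sum_weight_mul_edgeCoeff_of_split {c : Fin D.n} {v w : D.Vertex} {φ : Arc D.n → Bool}
    (hw : D.Compatible w φ) (h : D.IsEdge c v w)
    (hm : D.circle v (D.underIn c) = D.circle v (D.underOut c)) (x : D.Circle v → Bool) :
    ∑ y, D.weight w φ y * D.edgeCoeff 1 c ⟨v, x⟩ ⟨w, y⟩ =
      if φ (D.underIn c) = φ (D.underOut c) then
        splitFactor (φ (D.underIn c)) * D.weight v φ x else 0 := by
  classical
  have hd := h.differAt.symm
  have hm' : D.circle w (D.underIn c) ≠ D.circle w (D.underOut c) := hd.circle_eq_iff.1 hm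
  set p := D.circle w (D.underIn c) with hp
  set q := D.circle w (D.underOut c) with hq
  set r := D.circle v (D.underIn c) with hr
  have hcr : ∀ a, D.circle v a ≠ r → ∀ b, D.circle v a = D.circle v b →
      D.circle w a = D.circle w b := by
    intro a h1 b hab
    rcases circle_eq_or_of_merge hd hab with h3 | ⟨h3 | h3, -⟩
    · exact h3
    · exact absurd (circle_eq_of_merge hd hm' h3) h1
    · exact absurd ((circle_eq_of_merge hd hm' h3).trans hm.symm) h1
  have hrp : ∀ a, D.circle v a ≠ r → D.circle w a ≠ p ∧ D.circle w a ≠ q := fun a h1 =>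
    ⟨fun h3 => h1 (circle_eq_of_merge hd hm' h3),
      fun h3 => h1 ((circle_eq_of_merge hd hm' h3).trans hm.symm)⟩
  have hpr : ∀ a, D.circle w a ≠ p → D.circle w a ≠ q → D.circle v a ≠ r := by
    intro a h1 h2 h3
    rcases circle_eq_or_of_merge hd h3 with h4 | ⟨h4 | h4, -⟩
    exacts [h1 h4, h1 h4, h2 h4]
  rw [Fintype.sum_eq_sum_update_update (fun C => x (D.circle v C.out)) hm']
  · set y : Bool × Bool → D.Circle w → Bool := fun b =>
      Function.update (Function.update (fun C => x (D.circle v C.out)) p b.1) q b.2 with hy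
    have hyp : ∀ b, y b p = b.1 := fun b => by simp [hy, Function.update_of_ne hm']
    have hyq : ∀ b, y b q = b.2 := fun b => by simp [hy]
    have hya : ∀ b a, D.circle v a ≠ r → y b (D.circle w a) = x (D.circle v a) := by
      intro b a h1
      simp only [hy]
      rw [Function.update_of_ne (hrp a h1).2, Function.update_of_ne (hrp a h1).1]
      exact congrArg x (circle_eq_of_merge hd hm' (circle_out _))
    have hagree : ∀ b, D.AgreeAway c ⟨v, x⟩ ⟨w, y b⟩ := fun b a h1 _ => (hya b a h1).symm
    have hweight : ∀ b, D.weight w φ (y b) = D.weight v φ x * chi (φ r.out) (x r) *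
          (chi (φ (D.underIn c)) b.1 * chi (φ (D.underOut c)) b.2) := by
      intro b
      have h1 := prod_circle_merge hd hm' (F := fun C => chi (φ C.out) (y b C))
        (G := fun C => chi (φ C.out) (x C))
        (by
          intro a h1 h2
          have h3 := hpr a h1 h2
          rw [hya b a h3, hw.apply_out, hw.apply_eq (hcr a h3 _ (circle_out _).symm)])
      simp only [← hp, ← hq, ← hr, hyp, hyq] at h1
      rw [hp, hq, hw.apply_out, hw.apply_out] at h1
      have h2 := chi_mul_self (φ r.out) (x r)
      unfold weight
      linear_combination chi (φ r.out) (x r) * h1 - (∏ C, chi (φ C.out) (y b C)) * h2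
    have hcoeff : ∀ b, D.edgeCoeff 1 c ⟨v, x⟩ ⟨w, y b⟩ = deltaCoeff 1 (x r) b.1 b.2 := by
      intro b
      rw [edgeCoeff, if_pos ⟨h, hagree b⟩, if_neg (not_not.2 hm)]
      simp only [← hp, ← hq, ← hr, hyp, hyq]
    have hout : φ (D.underIn c) = φ (D.underOut c) → φ r.out = φ (D.underIn c) := fun h1 =>
      ((hw.iff_of_split hd.symm hm).2 h1).apply_out _
    change ∑ b, D.weight w φ (y b) * D.edgeCoeff 1 c ⟨v, x⟩ ⟨w, y b⟩ = _
    simp only [hweight, hcoeff, Fintype.sum_prod_type, Fintype.sum_bool]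
    split_ifs with h1
    · rw [hout h1, ← h1]
      cases φ (D.underIn c) <;> cases x r <;> norm_num [chi, deltaCoeff, splitFactor] <;> ring
    · have h2 : φ (D.underOut c) = !φ (D.underIn c) := by
        revert h1
        cases φ (D.underOut c) <;> cases φ (D.underIn c) <;> simp
      rw [h2]
      cases φ (D.underIn c) <;> cases x r <;> norm_num [chi, deltaCoeff]
  · rintro z ⟨C, hC, hC', hz⟩
    have : ¬ D.AgreeAway c ⟨v, x⟩ ⟨w, z⟩ := by
      intro hag
      have hne : D.circle v C.out ≠ r := by
        apply hpr <;> rwa [circle_out]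
      have h1 := hag C.out hne (by simp only; rwa [← hm])
      simp only [circle_out] at h1
      exact hz h1.symm
    rw [edgeCoeff, if_neg fun h1 => this h1.2, mul_zero]

open scoped Classical in
theorem sum_weight_mul_edgeCoeff {c : Fin D.n} {v w : D.Vertex} {φ : Arc D.n → Bool}
    (hw : D.Compatible w φ) (h : D.IsEdge c v w) (x : D.Circle v → Bool) :
    ∑ y, D.weight w φ y * D.edgeCoeff 1 c ⟨v, x⟩ ⟨w, y⟩ =
      if D.Compatible v φ then D.edgeFactor c v φ * D.weight v φ x else 0 := by
  by_cases hm : D.circle v (D.underIn c) = D.circle v (D.underOut c)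
  · rw [sum_weight_mul_edgeCoeff_of_split hw h hm, edgeFactor, if_neg (not_not.2 hm)]
    simp only [hw.iff_of_split h.differAt hm]
  · rw [sum_weight_mul_edgeCoeff_of_merge hw h hm, edgeFactor, if_pos hm,
      if_pos (hw.of_merge h.differAt hm), one_mul]

/-! ### Normalisation -/

variable (D) in
/-- The number of crossings with a `1`-resolution and of circles that have the colour `ψ`. -/
def colorCount (v : D.Vertex) (φ : Arc D.n → Bool) (ψ : Bool) : ℕ :=
  (∑ c, if v c = true ∧ φ (D.underIn c) = ψ then 1 else 0) +
    ∑ C : D.Circle v, if φ C.out = ψ then 1 else 0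

open scoped Classical in
theorem colorCount_edge {c : Fin D.n} {v w : D.Vertex} {φ : Arc D.n → Bool}
    (hv : D.Compatible v φ) (hw : D.Compatible w φ) (h : D.IsEdge c v w) (ψ : Bool) :
    D.colorCount w φ ψ = D.colorCount v φ ψ +
      if D.circle v (D.underIn c) ≠ D.circle v (D.underOut c) then 0 else
        if φ (D.underIn c) = ψ then 2 else 0 := by
  have hd := h.differAt
  have h1 : (∑ c', if w c' = true ∧ φ (D.underIn c') = ψ then 1 else 0) =
      (∑ c', if v c' = true ∧ φ (D.underIn c') = ψ then 1 else 0) +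
        if φ (D.underIn c) = ψ then 1 else 0 := by
    rw [← Finset.sum_erase_add _ _ (Finset.mem_univ c),
      ← Finset.sum_erase_add (a := c) _ (fun c' => if v c' = true ∧ _ then 1 else 0)
        (Finset.mem_univ c)]
    have h2 : w c = true := by rw [h.2]; simp
    have h3 : v c = false := h.1
    simp only [h2, h3, true_and, Bool.false_eq_true, false_and, if_false, add_zero]
    congr 1
    refine Finset.sum_congr rfl fun c' hc' => ?_
    rw [hd.2 c' (Finset.ne_of_mem_erase hc')]
  unfold colorCount
  rw [h1]
  by_cases hm : D.circle v (D.underIn c) = D.circle v (D.underOut c)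
  · have h2 := sum_circle_merge hd.symm (hd.symm.circle_eq_iff.1 hm)
      (F := fun C => if φ C.out = ψ then 1 else 0) (G := fun C => if φ C.out = ψ then 1 else 0)
      (fun a _ _ => by simp only [hv.apply_out, hw.apply_out])
    simp only [hv.apply_out, hw.apply_out, ← hv.apply_eq hm] at h2
    simp only [hm, ne_eq, not_true_eq_false, if_false]
    split_ifs at h2 ⊢ <;> omega
  · have h2 := sum_circle_merge hd hm
      (F := fun C => if φ C.out = ψ then 1 else 0) (G := fun C => if φ C.out = ψ then 1 else 0)
      (fun a _ _ => by simp only [hv.apply_out, hw.apply_out])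
    simp only [hv.apply_out, hw.apply_out, ← hw.apply_eq (hd.circle_eq_iff.2 hm)] at h2
    simp only [hm, ne_eq, not_false_eq_true, if_true]
    split_ifs at h2 ⊢ <;> omega

variable (D) in
/-- The factor that makes all nonzero coefficients of Lee's differential signs. -/
def scale (v : D.Vertex) (φ : Arc D.n → Bool) : ℚ :=
  splitFactor true ^ (D.colorCount v φ true / 2) * splitFactor false ^ (D.colorCount v φ false / 2)

theorem scale_ne_zero (v : D.Vertex) (φ : Arc D.n → Bool) : D.scale v φ ≠ 0 :=
  mul_ne_zero (pow_ne_zero _ (splitFactor_ne_zero _)) (pow_ne_zero _ (splitFactor_ne_zero _))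

theorem scale_edge {c : Fin D.n} {v w : D.Vertex} {φ : Arc D.n → Bool}
    (hv : D.Compatible v φ) (hw : D.Compatible w φ) (h : D.IsEdge c v w) :
    D.scale w φ = D.edgeFactor c v φ * D.scale v φ := by
  unfold scale edgeFactor
  rw [colorCount_edge hv hw h, colorCount_edge hv hw h]
  by_cases hm : D.circle v (D.underIn c) = D.circle v (D.underOut c)
  · simp only [hm, ne_eq, not_true_eq_false, if_false]
    cases φ (D.underIn c)
    · simp only [Bool.false_eq_true, if_false, if_true, add_zero, Nat.add_div_right _ two_pos,
        pow_succ]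
      ring
    · simp only [Bool.true_eq_false, if_false, if_true, add_zero, Nat.add_div_right _ two_pos,
        pow_succ]
      ring
  · simp [hm]

end KnotDiagram
end
noncomputable section

namespace KnotDiagram

variable {D : KnotDiagram}

theorem sum_state {M : Type*} [AddCommMonoid M] (f : D.State → M) :
    ∑ S, f S = ∑ v : D.Vertex, ∑ x : D.Circle v → Bool, f ⟨v, x⟩ := by
  rw [← Fintype.sum_sigma]
  exact Finset.sum_congr (by ext; simp) fun _ _ => rfl

theorem diff_apply (t : ℚ) (g : D.Chain) (S' : D.State) :
    D.diff t g S' = ∑ S, g S * ∑ c, D.edgeSign c S.1 * D.edgeCoeff t c S S' := by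
  rw [diff, Finsupp.linearCombination_apply, Finsupp.sum_fintype _ _ (by simp),
    Finsupp.finsetSum_apply]
  refine Finset.sum_congr rfl fun S _ => ?_
  rw [Finsupp.smul_apply, Finsupp.finsetSum_apply, smul_eq_mul]
  congr 1
  rw [Finset.sum_eq_single S' (fun T _ hT => Finsupp.single_eq_of_ne hT.symm) (by simp),
    Finsupp.single_eq_same]

/-- The coefficients of a chain in the basis of idempotents, before normalisation. -/
def transform (g : D.Chain) (v : D.Vertex) (φ : Arc D.n → Bool) : ℚ :=
  ∑ x, D.weight v φ x * g ⟨v, x⟩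

theorem isEdge_iff {c : Fin D.n} {v w : D.Vertex} :
    D.IsEdge c v w ↔ w c = true ∧ v = Function.update w c false := by
  constructor
  · rintro ⟨h, rfl⟩
    exact ⟨by simp, by rw [Function.update_idem, ← h, Function.update_eq_self]⟩
  · rintro ⟨h, rfl⟩
    exact ⟨by simp, by rw [Function.update_idem, ← h, Function.update_eq_self]⟩

open scoped Classical in
theorem transform_leeDiff (g : D.Chain) {w : D.Vertex} {φ : Arc D.n → Bool}
    (hw : D.Compatible w φ) :
    transform (D.leeDiff g) w φ = ∑ c, if w c = true ∧
      D.Compatible (Function.update w c false) φ then D.edgeSign c w *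
        (D.edgeFactor c (Function.update w c false) φ *
          transform g (Function.update w c false) φ) else 0 := by
  have hsign : ∀ c, D.edgeSign c (Function.update w c false) = D.edgeSign c w := by
    intro c
    unfold edgeSign
    congr 2
    ext c'
    by_cases h : c' = c
    · subst h; simp
    · simp [h]
  calc transform (D.leeDiff g) w φ
      = ∑ y, ∑ S, ∑ c, D.weight w φ y *
          (g S * (D.edgeSign c S.1 * D.edgeCoeff 1 c S ⟨w, y⟩)) := by
        unfold transform leeDiff
        simp only [diff_apply, Finset.mul_sum]
    _ = ∑ c, ∑ S : D.State, g S * (D.edgeSign c S.1 *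
          ∑ y, D.weight w φ y * D.edgeCoeff 1 c S ⟨w, y⟩) := by
        simp only [Finset.mul_sum]
        rw [Finset.sum_comm]
        simp only [fun S : D.State => Finset.sum_comm
          (f := fun y c => D.weight w φ y * (g S * (D.edgeSign c S.1 * D.edgeCoeff 1 c S ⟨w, y⟩)))
          (s := Finset.univ) (t := Finset.univ)]
        rw [Finset.sum_comm]
        refine Finset.sum_congr rfl fun c _ => Finset.sum_congr rfl fun S _ =>
          Finset.sum_congr rfl fun y _ => ?_
        ring
    _ = _ := by
        refine Finset.sum_congr rfl fun c _ => ?_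
        rw [sum_state]
        by_cases hc : w c = true
        · rw [Finset.sum_eq_single (Function.update w c false) _ (by simp)]
          · have he : D.IsEdge c (Function.update w c false) w := isEdge_iff.2 ⟨hc, rfl⟩
            simp only [sum_weight_mul_edgeCoeff hw he, hc, true_and, hsign]
            split_ifs with h
            · simp only [transform, Finset.mul_sum]
              refine Finset.sum_congr rfl fun x _ => ?_
              ring
            · simp
          · intro v _ hv
            refine Finset.sum_eq_zero fun x _ => ?_
            rw [Finset.sum_eq_zero fun y _ => ?_, mul_zero, mul_zero]
            rw [edgeCoeff, if_neg fun h => hv (isEdge_iff.1 h.1).2, mul_zero]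
        · rw [if_neg fun h => hc h.1]
          refine Finset.sum_eq_zero fun v _ => Finset.sum_eq_zero fun x _ => ?_
          rw [Finset.sum_eq_zero fun y _ => ?_, mul_zero, mul_zero]
          rw [edgeCoeff, if_neg fun h => hc (isEdge_iff.1 h.1).1, mul_zero]

open scoped Classical in
variable (D) in
/-- The coefficients of a chain in the normalised basis of idempotents. -/
def idemCoeff : D.Chain →ₗ[ℚ] (D.Vertex → (Arc D.n → Bool) → ℚ) where
  toFun g v φ := if D.Compatible v φ then (D.scale v φ)⁻¹ * transform g v φ else 0
  map_add' g g' := by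
    ext v φ
    simp only [transform, Finsupp.add_apply, mul_add, Finset.sum_add_distrib, Pi.add_apply]
    split_ifs <;> simp
  map_smul' r g := by
    ext v φ
    simp only [transform, Finsupp.smul_apply, smul_eq_mul, RingHom.id_apply, Pi.smul_apply,
      Finset.mul_sum, mul_ite, mul_zero]
    congr 1
    refine Finset.sum_congr rfl fun x _ => ?_
    ring

theorem idemCoeff_of_not_compatible (g : D.Chain) {v : D.Vertex} {φ : Arc D.n → Bool}
    (h : ¬ D.Compatible v φ) : D.idemCoeff g v φ = 0 := if_neg h

theorem idemCoeff_of_compatible (g : D.Chain) {v : D.Vertex} {φ : Arc D.n → Bool}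
    (h : D.Compatible v φ) : D.idemCoeff g v φ = (D.scale v φ)⁻¹ * transform g v φ := if_pos h

theorem idemCoeff_leeDiff (g : D.Chain) {w : D.Vertex} {φ : Arc D.n → Bool}
    (hw : D.Compatible w φ) : D.idemCoeff (D.leeDiff g) w φ =
      ∑ c, if w c = true then D.edgeSign c w * D.idemCoeff g (Function.update w c false) φ
        else 0 := by
  classical
  rw [idemCoeff_of_compatible _ hw, transform_leeDiff g hw, Finset.mul_sum]
  refine Finset.sum_congr rfl fun c _ => ?_
  by_cases hc : w c = true
  · by_cases hv : D.Compatible (Function.update w c false) φ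
    · have hs := scale_edge hv hw (isEdge_iff.2 ⟨hc, rfl⟩)
      have h1 := scale_ne_zero w φ
      have h2 := scale_ne_zero (Function.update w c false) φ
      rw [if_pos ⟨hc, hv⟩, if_pos hc, idemCoeff_of_compatible _ hv]
      rw [hs] at h1 ⊢
      have h3 := left_ne_zero_of_mul h1
      field_simp
    · rw [if_neg fun h => hv h.2, if_pos hc, idemCoeff_of_not_compatible _ hv]
      simp
  · rw [if_neg fun h => hc h.1, if_neg hc, mul_zero]

/-! ### The transform is invertible -/

/-- The colouring of the arcs given by a colouring of the circles. -/
def arcColoring {v : D.Vertex} (ψ : D.Circle v → Bool) (a : Arc D.n) : Bool := ψ (D.circle v a)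

theorem compatible_arcColoring {v : D.Vertex} (ψ : D.Circle v → Bool) :
    D.Compatible v (arcColoring ψ) := fun _ _ h => congrArg ψ (circle_eq_of_joined h)

theorem arcColoring_out {v : D.Vertex} (ψ : D.Circle v → Bool) (C : D.Circle v) :
    arcColoring ψ C.out = ψ C := congrArg ψ (circle_out C)

theorem Compatible.arcColoring_eq {v : D.Vertex} {φ : Arc D.n → Bool} (h : D.Compatible v φ) :
    arcColoring (fun C : D.Circle v => φ C.out) = φ := funext fun a => h.apply_out a

theorem weight_arcColoring {v : D.Vertex} (ψ x : D.Circle v → Bool) :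
    D.weight v (arcColoring ψ) x = ∏ C, chi (ψ C) (x C) := by
  simp only [weight, arcColoring_out]

theorem sum_weight_mul_transform (g : D.Chain) (v : D.Vertex) (y : D.Circle v → Bool) :
    ∑ ψ : D.Circle v → Bool, D.weight v (arcColoring ψ) y * transform g v (arcColoring ψ) =
      2 ^ Fintype.card (D.Circle v) * g ⟨v, y⟩ := by
  have key : ∀ x, ∑ ψ : D.Circle v → Bool, D.weight v (arcColoring ψ) y *
      D.weight v (arcColoring ψ) x = if x = y then 2 ^ Fintype.card (D.Circle v) else 0 := by
    intro x
    simp only [weight_arcColoring, ← Finset.prod_mul_distrib]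
    rw [← Fintype.prod_sum (fun C b => chi b (y C) * chi b (x C))]
    split_ifs with h
    · subst h
      simp [chi_mul_self]
    · obtain ⟨C, hC⟩ := Function.ne_iff.1 h
      refine Finset.prod_eq_zero (Finset.mem_univ C) ?_
      revert hC
      cases x C <;> cases y C <;> simp [chi]
  simp only [transform, Finset.mul_sum, ← mul_assoc]
  rw [Finset.sum_comm]
  simp only [← Finset.sum_mul, key]
  simp

theorem idemCoeff_injective : Function.Injective D.idemCoeff := by
  rw [injective_iff_map_eq_zero]
  intro g hg
  ext ⟨v, y⟩
  have h0 : ∀ ψ : D.Circle v → Bool, transform g v (arcColoring ψ) = 0 := by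
    intro ψ
    have h1 := congrFun (congrFun hg v) (arcColoring ψ)
    rw [idemCoeff_of_compatible _ (compatible_arcColoring ψ)] at h1
    exact (mul_eq_zero.1 h1).resolve_left (inv_ne_zero (scale_ne_zero _ _))
  have h2 := sum_weight_mul_transform g v y
  simp only [h0, mul_zero, Finset.sum_const_zero] at h2
  exact (mul_eq_zero.1 h2.symm).resolve_left (by positivity)

theorem exists_idemCoeff_eq {G : D.Vertex → (Arc D.n → Bool) → ℚ}
    (hG : ∀ v φ, ¬ D.Compatible v φ → G v φ = 0) : ∃ g, D.idemCoeff g = G := by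
  let L : D.Chain →ₗ[ℚ] (D.State → ℚ) :=
    LinearMap.pi fun S => (LinearMap.proj (arcColoring S.2)).comp
      ((LinearMap.proj (φ := fun _ : D.Vertex => (Arc D.n → Bool) → ℚ) S.1).comp D.idemCoeff)
  have hL : ∀ g S, L g S = D.idemCoeff g S.1 (arcColoring S.2) := fun g S => rfl
  have hext : ∀ G' : D.Vertex → (Arc D.n → Bool) → ℚ, (∀ v φ, ¬ D.Compatible v φ → G' v φ = 0) →
      (∀ S : D.State, G' S.1 (arcColoring S.2) = G S.1 (arcColoring S.2)) → G' = G := by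
    intro G' hG' h
    ext v φ
    by_cases hv : D.Compatible v φ
    · rw [← hv.arcColoring_eq]
      exact h ⟨v, _⟩
    · rw [hG' v φ hv, hG v φ hv]
  have hinj : Function.Injective L := by
    rw [injective_iff_map_eq_zero]
    intro g hg
    apply idemCoeff_injective
    rw [map_zero]
    ext v φ
    by_cases hv : D.Compatible v φ
    · rw [← hv.arcColoring_eq]
      exact congrFun hg ⟨v, _⟩
    · exact idemCoeff_of_not_compatible g hv
  have hsurj : Function.Surjective L := by
    rw [← LinearMap.injective_iff_surjective_of_finrank_eq_finrank]
    · exact hinj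
    · simp
  obtain ⟨g, hg⟩ := hsurj fun S => G S.1 (arcColoring S.2)
  exact ⟨g, hext _ (fun v φ h => idemCoeff_of_not_compatible g h) fun S => congrFun hg S⟩

/-! ### Compatibility crossing by crossing -/

variable (D) in
/-- The colouring `φ` is compatible with the resolution of the crossing `c` given by `b`. -/
def LocallyCompatible (φ : Arc D.n → Bool) (c : Fin D.n) (b : Bool) : Prop :=
  (b ≠ D.positive c → φ (D.underIn c) = φ (D.overOut c) ∧ φ (D.overIn c) = φ (D.underOut c)) ∧
  (b = D.positive c → φ (D.underIn c) = φ (D.overIn c) ∧ φ (D.underOut c) = φ (D.overOut c))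

theorem compatible_iff {v : D.Vertex} {φ : Arc D.n → Bool} :
    D.Compatible v φ ↔ ∀ c, D.LocallyCompatible φ c (v c) := by
  constructor
  · exact fun h c => ⟨fun hv => ⟨h _ _ (.oriented_under c hv), h _ _ (.oriented_over c hv)⟩,
      fun hv => ⟨h _ _ (.unoriented_in c hv), h _ _ (.unoriented_out c hv)⟩⟩
  · intro h a b hab
    cases hab with
    | oriented_under c hv => exact ((h c).1 hv).1
    | oriented_over c hv => exact ((h c).1 hv).2
    | unoriented_in c hv => exact ((h c).2 hv).1
    | unoriented_out c hv => exact ((h c).2 hv).2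

theorem compatible_update_iff {v : D.Vertex} {φ : Arc D.n → Bool} {c : Fin D.n} {b : Bool} :
    D.Compatible (Function.update v c b) φ ↔
      D.LocallyCompatible φ c b ∧ ∀ c', c' ≠ c → D.LocallyCompatible φ c' (v c') := by
  rw [compatible_iff]
  constructor
  · intro h
    refine ⟨by simpa using h c, fun c' hc' => ?_⟩
    have := h c'
    rwa [Function.update_of_ne hc'] at this
  · rintro ⟨h1, h2⟩ c'
    by_cases hc' : c' = c
    · subst hc'; simpa using h1
    · rw [Function.update_of_ne hc']; exact h2 c' hc'

theorem edgeSign_update_of_lt {c c' : Fin D.n} (h : c' < c) {v : D.Vertex} (b : Bool) :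
    D.edgeSign c' (Function.update v c b) = D.edgeSign c' v := by
  unfold edgeSign
  congr 2
  ext e
  simp only [Finset.mem_filter, Finset.mem_univ, true_and, and_congr_right_iff]
  intro he
  rw [Function.update_of_ne (he.trans h).ne]

theorem edgeSign_update_self {c : Fin D.n} {v : D.Vertex} (b : Bool) :
    D.edgeSign c (Function.update v c b) = D.edgeSign c v := by
  unfold edgeSign
  congr 2
  ext e
  simp only [Finset.mem_filter, Finset.mem_univ, true_and, and_congr_right_iff]
  intro he
  rw [Function.update_of_ne he.ne]

theorem edgeSign_update_of_gt {c c' : Fin D.n} (h : c < c') {v : D.Vertex} {b : Bool}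
    (hb : v c = !b) : D.edgeSign c' (Function.update v c b) = - D.edgeSign c' v := by
  have key : ∀ u : D.Vertex, u c = false →
      D.edgeSign c' (Function.update u c true) = - D.edgeSign c' u := by
    intro u hu
    unfold edgeSign
    have h3 : (Finset.univ.filter fun e => e < c' ∧ Function.update u c true e = true) =
        insert c (Finset.univ.filter fun e => e < c' ∧ u e = true) := by
      ext e
      by_cases he : e = c
      · subst he; simp [h]
      · simp [he]
    rw [h3, Finset.card_insert_of_notMem (by simp [hu]), pow_succ]
    ring
  cases b
  · have h1 := key (Function.update v c false) (by simp)
    rw [Function.update_idem, show true = v c from hb.symm, Function.update_eq_self] at h1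
    rw [h1, neg_neg]
  · exact key v hb

theorem edgeSign_mul_self (c : Fin D.n) (v : D.Vertex) : D.edgeSign c v * D.edgeSign c v = 1 := by
  unfold edgeSign
  rw [← mul_pow]; norm_num

/-- Two edges of a face of the cube anticommute. -/
theorem edgeSign_mul_edgeSign_update {c c' : Fin D.n} (h : c ≠ c') {v : D.Vertex} {b b' : Bool}
    (hb : v c = !b) (hb' : v c' = !b') :
    D.edgeSign c v * D.edgeSign c' (Function.update v c b) =
      -(D.edgeSign c' v * D.edgeSign c (Function.update v c' b')) := by
  rcases lt_or_gt_of_ne h with h | h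
  · rw [edgeSign_update_of_gt h hb, edgeSign_update_of_lt h]; ring
  · rw [edgeSign_update_of_gt h hb', edgeSign_update_of_lt h]; ring

theorem leeDiff_comp_leeDiff : D.leeDiff ∘ₗ D.leeDiff = 0 := by
  refine LinearMap.ext fun g => ?_
  apply idemCoeff_injective
  simp only [LinearMap.comp_apply, LinearMap.zero_apply, map_zero]
  ext w φ
  by_cases hw : D.Compatible w φ
  swap
  · exact idemCoeff_of_not_compatible _ hw
  set F : Fin D.n → Fin D.n → ℚ := fun c c' =>
    if w c = true ∧ w c' = true ∧ c ≠ c' then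
      D.edgeSign c w * D.edgeSign c' (Function.update w c false) *
        D.idemCoeff g (Function.update (Function.update w c false) c' false) φ else 0 with hF
  have h1 : D.idemCoeff (D.leeDiff (D.leeDiff g)) w φ = ∑ c, ∑ c', F c c' := by
    rw [idemCoeff_leeDiff _ hw]
    refine Finset.sum_congr rfl fun c _ => ?_
    by_cases hc : w c = true
    · rw [if_pos hc]
      by_cases hv : D.Compatible (Function.update w c false) φ
      · rw [idemCoeff_leeDiff _ hv, Finset.mul_sum]
        refine Finset.sum_congr rfl fun c' _ => ?_
        simp only [hF]
        by_cases hcc : c = c'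
        · subst hcc; simp
        · rw [Function.update_of_ne (Ne.symm hcc)]
          simp only [hc, true_and, ne_eq, hcc, not_false_eq_true, and_true]
          split_ifs <;> ring
      · rw [idemCoeff_of_not_compatible _ hv, mul_zero]
        refine (Finset.sum_eq_zero fun c' _ => ?_).symm
        simp only [hF]
        split_ifs with h
        · rw [idemCoeff_of_not_compatible, mul_zero]
          intro h2
          rw [compatible_update_iff] at h2
          refine hv (compatible_update_iff.2 ⟨?_, fun e _ => compatible_iff.1 hw e⟩)
          simpa using h2.2 c h.2.2
        · rfl
    · rw [if_neg hc]
      exact (Finset.sum_eq_zero fun c' _ => if_neg fun h => hc h.1).symm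
  have h2 : ∀ c c', F c c' = - F c' c := by
    intro c c'
    simp only [hF]
    by_cases h : w c = true ∧ w c' = true ∧ c ≠ c'
    · rw [if_pos h, if_pos ⟨h.2.1, h.1, h.2.2.symm⟩,
        edgeSign_mul_edgeSign_update (b := false) (b' := false) h.2.2 h.1 h.2.1,
        Function.update_comm h.2.2]
      ring
    · rw [if_neg h, if_neg fun h' => h ⟨h'.2.1, h'.1, h'.2.2.symm⟩, neg_zero]
  have h3 : ∑ c, ∑ c', F c c' = - ∑ c, ∑ c', F c c' := by
    conv_lhs => rw [Finset.sum_comm]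
    simp only [← Finset.sum_neg_distrib, ← h2]
  rw [h1]
  simp only [Pi.zero_apply]
  linarith

end KnotDiagram
end
noncomputable section

/-! ### Lee homology -/

namespace KnotDiagram

variable {D : KnotDiagram}

variable (D) in
/-- The oriented resolution. -/
def orientedVertex : D.Vertex := fun c => !D.positive c

theorem IsAlternating_not {φ : Arc D.n → Bool} (hφ : D.IsAlternating φ) :
    D.IsAlternating fun a => !φ a :=
  ⟨fun c => by rw [hφ.underIn_eq], fun c => by rw [hφ.overOut_eq], fun c => by rw [hφ.underOut_eq]⟩

theorem locallyCompatible_iff_of_isAlternating {φ : Arc D.n → Bool} (hφ : D.IsAlternating φ)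
    {c : Fin D.n} {b : Bool} : D.LocallyCompatible φ c b ↔ b = !D.positive c := by
  have h1 := hφ.underIn_eq c
  have h2 := hφ.overOut_eq c
  have h3 := hφ.underOut_eq c
  unfold LocallyCompatible
  rw [h1, h2, h3]
  cases b <;> cases D.positive c <;> simp

theorem compatible_iff_of_isAlternating {φ : Arc D.n → Bool} (hφ : D.IsAlternating φ)
    {v : D.Vertex} : D.Compatible v φ ↔ v = D.orientedVertex := by
  rw [compatible_iff, funext_iff]
  exact forall_congr' fun c => locallyCompatible_iff_of_isAlternating hφ

theorem eq_or_eq_not_of_alternating {φ φ' : Arc D.n → Bool} (h : ∀ a, φ (a + 1) = !φ a)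
    (h' : ∀ a, φ' (a + 1) = !φ' a) : φ' = φ ∨ φ' = fun a => !φ a := by
  have h1 := Fin.eq_of_forall_add_one (f := fun a => φ a ^^ φ' a) fun a => by
    rw [h, h', Bool.not_xor_not]
  cases h0 : φ 0 ^^ φ' 0
  · left
    ext1 a
    have := (h1 a 0).trans h0
    exact (by simpa using this : φ a = φ' a).symm
  · right
    ext1 a
    have := (h1 a 0).trans h0
    revert this
    cases φ a <;> cases φ' a <;> simp

/-- A compatible colouring of the arcs that is not constant around any crossing alternates. -/
theorem Compatible.eq_of_forall_not {φ φ' : Arc D.n → Bool} (hφ : D.IsAlternating φ)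
    {v : D.Vertex} (hv : D.Compatible v φ')
    (h : ∀ c, ¬ (D.LocallyCompatible φ' c true ∧ D.LocallyCompatible φ' c false)) :
    v = D.orientedVertex ∧ (φ' = φ ∨ φ' = fun a => !φ a) := by
  have key : φ' = φ ∨ φ' = fun a => !φ a := by
    by_cases hn : D.n = 0
    · have : Subsingleton (Arc D.n) := by
        unfold Arc; rw [hn]; exact inferInstanceAs (Subsingleton (Fin 1))
      cases h0 : φ 0 ^^ φ' 0
      · left
        ext1 a
        rw [Subsingleton.elim a 0]
        exact (by simpa using h0 : φ 0 = φ' 0).symm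
      · right
        ext1 a
        rw [Subsingleton.elim a 0]
        revert h0
        cases φ 0 <;> cases φ' 0 <;> simp
    · refine eq_or_eq_not_of_alternating (fun a => ?_) fun a => ?_
      · obtain ⟨c, rfl | rfl⟩ := D.exists_end hn a
        · have h1 := hφ.underIn_eq c
          rw [h1, Bool.not_not]
          exact hφ.underOut_eq c
        · exact hφ.overOut_eq c
      · obtain ⟨c, ha⟩ := D.exists_end hn a
        have h1 := compatible_iff.1 hv c
        have h2 := h c
        have key : φ' (D.underOut c) = !φ' (D.underIn c) ∧ φ' (D.overOut c) = !φ' (D.overIn c) := by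
          unfold LocallyCompatible at h1 h2
          revert h1 h2
          cases φ' (D.underIn c) <;> cases φ' (D.overIn c) <;> cases φ' (D.underOut c) <;>
            cases φ' (D.overOut c) <;> cases v c <;> cases D.positive c <;> simp
        rcases ha with rfl | rfl
        exacts [key.1, key.2]
  refine ⟨?_, key⟩
  rcases key with rfl | rfl
  · exact (compatible_iff_of_isAlternating hφ).1 hv
  · exact (compatible_iff_of_isAlternating (IsAlternating_not hφ)).1 hv

theorem idemCoeff_leeDiff_of_isAlternating {φ : Arc D.n → Bool} (hφ : D.IsAlternating φ)
    (g : D.Chain) (v : D.Vertex) : D.idemCoeff (D.leeDiff g) v φ = 0 := by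
  by_cases hv : D.Compatible v φ
  · rw [idemCoeff_leeDiff _ hv]
    refine Finset.sum_eq_zero fun c _ => ?_
    split_ifs with hc
    · rw [idemCoeff_of_not_compatible, mul_zero]
      intro h
      rw [compatible_iff_of_isAlternating hφ] at h hv
      have := congrFun (h.trans hv.symm) c
      simp [hc] at this
    · rfl
  · exact idemCoeff_of_not_compatible _ hv

/-- A cycle of Lee's complex is a boundary if its coefficients at the two alternating colourings
vanish. -/
theorem exists_leeDiff_eq {φ : Arc D.n → Bool} (hφ : D.IsAlternating φ) {x : D.Chain}
    (hx : D.leeDiff x = 0) (h1 : D.idemCoeff x D.orientedVertex φ = 0)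
    (h2 : D.idemCoeff x D.orientedVertex (fun a => !φ a) = 0) : ∃ y, D.leeDiff y = x := by
  classical
  let P : (Arc D.n → Bool) → Fin D.n → Prop := fun φ' c =>
    D.LocallyCompatible φ' c true ∧ D.LocallyCompatible φ' c false
  let H : D.Vertex → (Arc D.n → Bool) → ℚ := fun v φ' =>
    if h : ∃ c, P φ' c then
      if v h.choose = false then
        D.edgeSign h.choose v * D.idemCoeff x (Function.update v h.choose true) φ' else 0
    else 0
  have hP : ∀ φ' c, P φ' c → ∀ b, D.LocallyCompatible φ' c b := by
    rintro φ' c ⟨ht, hf⟩ (_ | _)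
    exacts [hf, ht]
  obtain ⟨y, hy⟩ := exists_idemCoeff_eq (D := D) (G := H) fun v φ' hv => by
    simp only [H]
    split_ifs with h h3
    · rw [idemCoeff_of_not_compatible, mul_zero]
      rw [compatible_update_iff]
      rintro ⟨-, h4⟩
      refine hv (compatible_iff.2 fun c => ?_)
      by_cases hc : c = h.choose
      · rw [hc]; exact hP _ _ h.choose_spec _
      · exact h4 c hc
    · rfl
    · rfl
  refine ⟨y, idemCoeff_injective ?_⟩
  ext w φ'
  by_cases hw : D.Compatible w φ'
  swap
  · rw [idemCoeff_of_not_compatible _ hw, idemCoeff_of_not_compatible _ hw]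
  rw [idemCoeff_leeDiff _ hw, hy]
  by_cases hex : ∃ c, P φ' c
  swap
  · have h3 : ∀ v, H v φ' = 0 := fun v => by simp only [H]; rw [dif_neg hex]
    simp only [h3, mul_zero, ite_self, Finset.sum_const_zero]
    obtain ⟨rfl, rfl | rfl⟩ := hw.eq_of_forall_not hφ (not_exists.1 hex)
    exacts [h1.symm, h2.symm]
  · set e := hex.choose with he
    have hH : ∀ v, H v φ' = if v e = false then
        D.edgeSign e v * D.idemCoeff x (Function.update v e true) φ' else 0 := fun v => by
      simp only [H]; rw [dif_pos hex]
    simp only [hH]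
    have hwe : ∀ b, D.Compatible (Function.update w e b) φ' := fun b =>
      compatible_update_iff.2 ⟨hP _ _ hex.choose_spec _, fun c' _ => compatible_iff.1 hw c'⟩
    cases h3 : w e
    · have h4 := congrFun (congrFun (congrArg D.idemCoeff hx) (Function.update w e true)) φ'
      rw [map_zero, Pi.zero_apply, Pi.zero_apply, idemCoeff_leeDiff _ (hwe true),
        ← Finset.add_sum_erase _ _ (Finset.mem_univ e)] at h4
      rw [← Finset.add_sum_erase _ _ (Finset.mem_univ e)]
      simp only [h3, Bool.false_eq_true, if_false, zero_add]
      simp only [Function.update_self, if_true, Function.update_idem] at h4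
      rw [edgeSign_update_self, show Function.update w e false = w by
        rw [← h3, Function.update_eq_self]] at h4
      have h5 : ∑ c ∈ Finset.univ.erase e, (if w c = true then D.edgeSign c w *
          (if Function.update w c false e = false then
            D.edgeSign e (Function.update w c false) * D.idemCoeff x
              (Function.update (Function.update w c false) e true) φ' else 0) else 0) =
          -D.edgeSign e w * ∑ c ∈ Finset.univ.erase e,
            if Function.update w e true c = true then
              D.edgeSign c (Function.update w e true) * D.idemCoeff x
                (Function.update (Function.update w e true) c false) φ' else 0 := by
        rw [Finset.mul_sum]
        refine Finset.sum_congr rfl fun c hc => ?_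
        have hce := Finset.ne_of_mem_erase hc
        rw [Function.update_of_ne hce, Function.update_of_ne hce.symm, if_pos h3,
          Function.update_comm hce]
        split_ifs with h6
        · have h7 := edgeSign_mul_edgeSign_update (D := D) hce (v := w) (b := false) (b' := true) h6 h3
          linear_combination (D.idemCoeff x
            (Function.update (Function.update w e true) c false) φ') * h7
        · rw [mul_zero]
      rw [h5]
      have h8 := edgeSign_mul_self e w
      linear_combination (-D.edgeSign e w) * h4 + D.idemCoeff x w φ' * h8
    · rw [Finset.sum_eq_single e]
      · simp only [h3, Function.update_self, if_true, Function.update_idem]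
        rw [edgeSign_update_self, ← mul_assoc, edgeSign_mul_self, one_mul, ← h3,
          Function.update_eq_self]
      · intro c _ hc
        rw [Function.update_of_ne hc.symm, h3]
        simp
      · simp

theorem exists_leeCycle {φ : Arc D.n → Bool} (hφ : D.IsAlternating φ) :
    ∃ x, D.leeDiff x = 0 ∧ D.idemCoeff x D.orientedVertex φ = 1 := by
  classical
  obtain ⟨x, hx⟩ := exists_idemCoeff_eq (D := D)
    (G := fun v φ' => if v = D.orientedVertex ∧ φ' = φ then 1 else 0) fun v φ' hv => by
      rw [if_neg]
      rintro ⟨rfl, rfl⟩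
      exact hv ((compatible_iff_of_isAlternating hφ).2 rfl)
  refine ⟨x, idemCoeff_injective ?_, by rw [hx]; simp⟩
  ext w φ'
  rw [map_zero, Pi.zero_apply, Pi.zero_apply]
  by_cases hφ' : φ' = φ
  · rw [hφ']; exact idemCoeff_leeDiff_of_isAlternating hφ x w
  · by_cases hw : D.Compatible w φ'
    · rw [idemCoeff_leeDiff _ hw, hx]
      simp [hφ']
    · exact idemCoeff_of_not_compatible _ hw

theorem gr_orientedVertex (x : D.Circle D.orientedVertex → Bool) :
    D.gr ⟨D.orientedVertex, x⟩ = 0 := by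
  simp [gr, orientedVertex, nNeg]

theorem idemCoeff_of_forall_gr {x : D.Chain} (hx : ∀ S, D.gr S = 0 → x S = 0)
    (φ : Arc D.n → Bool) : D.idemCoeff x D.orientedVertex φ = 0 := by
  by_cases h : D.Compatible D.orientedVertex φ
  · rw [idemCoeff_of_compatible _ h, transform, Finset.sum_eq_zero, mul_zero]
    intro y _
    rw [hx _ (gr_orientedVertex y), mul_zero]
  · exact idemCoeff_of_not_compatible _ h

/-! ### The action of `X` at the base point -/

/-- Change the label of the circle through the first arc. -/
def flip (S : D.State) : D.State :=
  ⟨S.1, Function.update S.2 (D.circle S.1 0) (!S.2 (D.circle S.1 0))⟩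

theorem flip_flip (S : D.State) : flip (flip S) = S := by
  obtain ⟨v, x⟩ := S
  have h : Function.update (Function.update x (D.circle v 0) (!x (D.circle v 0))) (D.circle v 0)
      (!Function.update x (D.circle v 0) (!x (D.circle v 0)) (D.circle v 0)) = x := by
    rw [Function.update_self, Bool.not_not, Function.update_idem, Function.update_eq_self]
  exact congrArg (Sigma.mk v) h

variable (D) in
/-- The action of `X` on the circle through the first arc. -/
def basepointMap : D.Chain ≃ₗ[ℚ] D.Chain :=
  Finsupp.domLCongr (Function.Involutive.toPerm (flip (D := D)) flip_flip)

theorem basepointMap_apply (g : D.Chain) (S : D.State) : D.basepointMap g S = g (flip S) := by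
  simp only [basepointMap, Finsupp.domLCongr_apply, Finsupp.domCongr_apply,
    Finsupp.equivMapDomain_apply]
  rfl

theorem basepointMap_basepointMap (g : D.Chain) : D.basepointMap (D.basepointMap g) = g := by
  ext S
  rw [basepointMap_apply, basepointMap_apply, flip_flip]

theorem idemCoeff_basepointMap (g : D.Chain) (v : D.Vertex) (φ : Arc D.n → Bool) :
    D.idemCoeff (D.basepointMap g) v φ = chi (φ 0) false * D.idemCoeff g v φ := by
  by_cases hv : D.Compatible v φ
  swap
  · rw [idemCoeff_of_not_compatible _ hv, idemCoeff_of_not_compatible _ hv, mul_zero]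
  rw [idemCoeff_of_compatible _ hv, idemCoeff_of_compatible _ hv]
  have key : transform (D.basepointMap g) v φ = chi (φ 0) false * transform g v φ := by
    set C := D.circle v 0 with hC
    let f : (D.Circle v → Bool) → (D.Circle v → Bool) := fun x => Function.update x C (!x C)
    have hf : Function.Involutive f := fun x => by simp [f]
    unfold transform
    rw [← Equiv.sum_comp (Function.Involutive.toPerm f hf), Finset.mul_sum]
    refine Finset.sum_congr rfl fun x _ => ?_
    rw [basepointMap_apply]
    have h1 : flip (D := D) ⟨v, f x⟩ = ⟨v, x⟩ := by
      have := hf x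
      simp only [flip, ← hC]
      exact congrArg _ this
    change D.weight v φ (f x) * g (flip ⟨v, f x⟩) = _
    rw [h1, ← mul_assoc]
    congr 1
    unfold weight
    rw [← Finset.mul_prod_erase _ _ (Finset.mem_univ C),
      ← Finset.mul_prod_erase _ (fun C => chi (φ C.out) (x C)) (Finset.mem_univ C), ← mul_assoc]
    congr 1
    · rw [hC, hv.apply_out, ← hC]
      simp only [f, Function.update_self]
      cases φ 0 <;> cases x C <;> norm_num [chi]
    · refine Finset.prod_congr rfl fun C' hC' => ?_
      simp only [f]
      rw [Function.update_of_ne (Finset.ne_of_mem_erase hC')]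
  rw [key]; ring

theorem leeDiff_basepointMap (g : D.Chain) :
    D.leeDiff (D.basepointMap g) = D.basepointMap (D.leeDiff g) := by
  apply idemCoeff_injective
  ext w φ
  rw [idemCoeff_basepointMap]
  by_cases hw : D.Compatible w φ
  · rw [idemCoeff_leeDiff _ hw, idemCoeff_leeDiff _ hw, Finset.mul_sum]
    refine Finset.sum_congr rfl fun c _ => ?_
    rw [idemCoeff_basepointMap]
    split_ifs <;> ring
  · rw [idemCoeff_of_not_compatible _ hw, idemCoeff_of_not_compatible _ hw, mul_zero]

/-! ### Degrees -/

theorem sum_label_flip (v : D.Vertex) (x : D.Circle v → Bool) (C : D.Circle v) :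
    (∑ C', if Function.update x C (!x C) C' = true then (1 : ℤ) else -1) =
      (∑ C', if x C' = true then 1 else -1) + if x C = true then -2 else 2 := by
  rw [← Finset.add_sum_erase _ _ (Finset.mem_univ C),
    ← Finset.add_sum_erase _ (fun C' => if x C' = true then (1 : ℤ) else -1) (Finset.mem_univ C),
    Finset.sum_congr rfl fun C' hC' => by rw [Function.update_of_ne (Finset.ne_of_mem_erase hC')]]
  simp only [Function.update_self]
  cases x C <;> simp <;> ring

theorem qGrading_flip (S : D.State) :
    D.qGrading (flip S) = D.qGrading S + 2 ∨ D.qGrading (flip S) = D.qGrading S - 2 := by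
  obtain ⟨v, x⟩ := S
  have h1 := sum_label_flip v x (D.circle v 0)
  have h2 : D.gr (flip ⟨v, x⟩) = D.gr ⟨v, x⟩ := rfl
  simp only [qGrading, h2]
  have h3 : D.pGrading (flip ⟨v, x⟩) = D.pGrading ⟨v, x⟩ +
    if x (D.circle v 0) = true then -2 else 2 := h1
  rw [h3]
  split_ifs
  · right; ring
  · left; ring

theorem gr_of_isEdge {c : Fin D.n} {S S' : D.State} (h : D.IsEdge c S.1 S'.1) :
    D.gr S' = D.gr S + 1 := by
  obtain ⟨h1, h2⟩ := h
  have h3 : (Finset.univ.filter fun c' => S'.1 c' = true) =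
      insert c (Finset.univ.filter fun c' => S.1 c' = true) := by
    ext c'
    by_cases h4 : c' = c
    · subst h4; simp [h2]
    · simp [h2, h4]
  rw [gr, gr, h3, Finset.card_insert_of_notMem (by simp [h1])]
  push_cast
  ring

theorem qGrading_of_merge {c : Fin D.n} {S S' : D.State} (h : D.IsEdge c S.1 S'.1)
    (ha : D.AgreeAway c S S') (hm : D.circle S.1 (D.underIn c) ≠ D.circle S.1 (D.underOut c)) :
    D.qGrading S' + (if S.2 (D.circle S.1 (D.underIn c)) = true then 1 else -1) +
      (if S.2 (D.circle S.1 (D.underOut c)) = true then 1 else -1) =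
    D.qGrading S + 1 + if S'.2 (D.circle S'.1 (D.underIn c)) = true then 1 else -1 := by
  have h1 := sum_circle_merge h.differAt hm (F := fun C => if S.2 C = true then (1 : ℤ) else -1)
    (G := fun C => if S'.2 C = true then (1 : ℤ) else -1) fun a h2 h3 => by rw [ha a h2 h3]
  rw [qGrading, qGrading, gr_of_isEdge h, pGrading, pGrading]
  linarith

theorem qGrading_of_split {c : Fin D.n} {S S' : D.State} (h : D.IsEdge c S.1 S'.1)
    (ha : D.AgreeAway c S S') (hm : D.circle S.1 (D.underIn c) = D.circle S.1 (D.underOut c)) :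
    D.qGrading S' + (if S.2 (D.circle S.1 (D.underIn c)) = true then 1 else -1) =
    D.qGrading S + 1 + (if S'.2 (D.circle S'.1 (D.underIn c)) = true then 1 else -1) +
      if S'.2 (D.circle S'.1 (D.underOut c)) = true then 1 else -1 := by
  have hd := h.differAt.symm
  have hm' := hd.circle_eq_iff.1 hm
  have h1 := sum_circle_merge hd hm' (F := fun C => if S'.2 C = true then (1 : ℤ) else -1)
    (G := fun C => if S.2 C = true then (1 : ℤ) else -1) fun a h2 h3 => by
      have h4 : ∀ b, D.circle S.1 b = D.circle S.1 (D.underIn c) →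
          D.circle S.1 a ≠ D.circle S.1 b := by
        intro b hb h4
        rcases circle_eq_or_of_merge hd (h4.trans hb) with h5 | ⟨h5 | h5, -⟩
        exacts [h2 h5, h2 h5, h3 h5]
      rw [ha a (h4 _ rfl) (h4 _ hm.symm)]
  rw [qGrading, qGrading, gr_of_isEdge h, pGrading, pGrading]
  linarith

theorem edgeCoeff_zero_eq (c : Fin D.n) (S S' : D.State) [Decidable (D.qGrading S' = D.qGrading S)] :
    D.edgeCoeff 0 c S S' = if D.qGrading S' = D.qGrading S then D.edgeCoeff 1 c S S' else 0 := by
  unfold edgeCoeff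
  by_cases h : D.IsEdge c S.1 S'.1 ∧ D.AgreeAway c S S'
  · simp only [if_pos h]
    by_cases hm : D.circle S.1 (D.underIn c) = D.circle S.1 (D.underOut c)
    · have h1 := qGrading_of_split h.1 h.2 hm
      simp only [hm, ne_eq, not_true_eq_false, if_false]
      rw [hm] at h1
      revert h1
      cases S.2 (D.circle S.1 (D.underOut c)) <;> cases S'.2 (D.circle S'.1 (D.underIn c)) <;>
        cases S'.2 (D.circle S'.1 (D.underOut c)) <;> intro h1 <;>
        simp only [deltaCoeff, ite_self] <;> simp at h1 <;> split_ifs <;> first | rfl | omega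
    · have h1 := qGrading_of_merge h.1 h.2 hm
      simp only [hm, ne_eq, not_false_eq_true, if_true]
      revert h1
      cases S.2 (D.circle S.1 (D.underOut c)) <;> cases S'.2 (D.circle S'.1 (D.underIn c)) <;>
        cases S.2 (D.circle S.1 (D.underIn c)) <;> intro h1 <;>
        simp only [mCoeff, ite_self] <;> simp at h1 <;> split_ifs <;> first | rfl | omega
  · simp only [if_neg h, ite_self]

theorem qGrading_of_edgeCoeff_ne_zero {c : Fin D.n} {S S' : D.State}
    (h0 : D.edgeCoeff 1 c S S' ≠ 0) :
    D.qGrading S' = D.qGrading S ∨ D.qGrading S' = D.qGrading S + 4 := by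
  unfold edgeCoeff at h0
  by_cases h : D.IsEdge c S.1 S'.1 ∧ D.AgreeAway c S S'
  · simp only [if_pos h] at h0
    by_cases hm : D.circle S.1 (D.underIn c) = D.circle S.1 (D.underOut c)
    · have h1 := qGrading_of_split h.1 h.2 hm
      simp only [hm, ne_eq, not_true_eq_false, if_false] at h0
      rw [hm] at h1
      revert h1 h0
      cases S.2 (D.circle S.1 (D.underOut c)) <;> cases S'.2 (D.circle S'.1 (D.underIn c)) <;>
        cases S'.2 (D.circle S'.1 (D.underOut c)) <;> intro h0 h1 <;>
        simp [deltaCoeff] at h0 h1 <;> omega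
    · have h1 := qGrading_of_merge h.1 h.2 hm
      simp only [hm, ne_eq, not_false_eq_true, if_true] at h0
      revert h1 h0
      cases S.2 (D.circle S.1 (D.underOut c)) <;> cases S'.2 (D.circle S'.1 (D.underIn c)) <;>
        cases S.2 (D.circle S.1 (D.underIn c)) <;> intro h0 h1 <;>
        simp [mCoeff] at h0 h1 <;> omega
  · simp only [if_neg h] at h0
    exact absurd rfl h0

theorem khovanovDiff_mem_qDegree {a : ℤ} {x : D.Chain} (hx : x ∈ D.qDegree a) :
    D.khovanovDiff x ∈ D.qDegree a := by
  refine (Finsupp.mem_supported' ℚ _).2 fun S' hS' => ?_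
  rw [khovanovDiff, diff_apply]
  refine Finset.sum_eq_zero fun S _ => ?_
  by_cases hS : D.qGrading S = a
  · rw [Finset.sum_eq_zero, mul_zero]
    intro c _
    rw [edgeCoeff_zero_eq, if_neg, mul_zero]
    rw [hS]; exact hS'
  · rw [(Finsupp.mem_supported' ℚ x).1 hx S hS, zero_mul]

theorem leeDiff_sub_khovanovDiff_mem_qDegree {a : ℤ} {x : D.Chain} (hx : x ∈ D.qDegree a) :
    D.leeDiff x - D.khovanovDiff x ∈ D.qDegree (a + 4) := by
  refine (Finsupp.mem_supported' ℚ _).2 fun S' hS' => ?_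
  rw [Finsupp.sub_apply, khovanovDiff, leeDiff, diff_apply, diff_apply, sub_eq_zero]
  refine Finset.sum_congr rfl fun S _ => ?_
  by_cases hS : D.qGrading S = a
  · congr 1
    refine Finset.sum_congr rfl fun c _ => ?_
    rw [edgeCoeff_zero_eq]
    split_ifs with h
    · rfl
    · congr 1
      by_contra h0
      rcases qGrading_of_edgeCoeff_ne_zero h0 with h1 | h1
      · exact h h1
      · exact hS' (by rw [Set.mem_ofPred_eq, h1, hS])
  · rw [(Finsupp.mem_supported' ℚ x).1 hx S hS, zero_mul, zero_mul]

theorem even_card_circle_add_of_merge {c : Fin D.n} {v w : D.Vertex} (h : DifferAt c v w) :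
    Even (Fintype.card (D.Circle v) + Fintype.card (D.Circle w) + 1) := by
  by_cases hm : D.circle v (D.underIn c) = D.circle v (D.underOut c)
  · have h1 := sum_circle_merge h.symm (h.symm.circle_eq_iff.1 hm) (F := fun _ => 1)
      (G := fun _ => 1) fun _ _ _ => rfl
    simp only [Finset.sum_const, Finset.card_univ, smul_eq_mul, mul_one] at h1
    exact ⟨Fintype.card (D.Circle v) + 1, by omega⟩
  · have h1 := sum_circle_merge h hm (F := fun _ => 1)
      (G := fun _ => 1) fun _ _ _ => rfl
    simp only [Finset.sum_const, Finset.card_univ, smul_eq_mul, mul_one] at h1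
    exact ⟨Fintype.card (D.Circle w) + 1, by omega⟩

theorem even_pGrading_sub (S : D.State) :
    Even (D.pGrading S - Fintype.card (D.Circle S.1)) := by
  have h1 : (Fintype.card (D.Circle S.1) : ℤ) = ∑ C : D.Circle S.1, 1 := by simp
  rw [pGrading, h1, ← Finset.sum_sub_distrib]
  refine Finset.even_sum _ fun C _ => ?_
  split_ifs <;> decide

/-- All `q`-gradings of states have the same parity. -/
theorem even_qGrading_sub (S S' : D.State) : Even (D.qGrading S - D.qGrading S') := by
  let par : D.Vertex → ZMod 2 := fun v =>
    (Fintype.card (D.Circle v) : ZMod 2) + ((Finset.univ.filter fun c => v c = true).card : ℕ)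
  have hstep : ∀ (v : D.Vertex) c, v c = false → par (Function.update v c true) = par v := by
    intro v c hc
    have he : D.IsEdge c v (Function.update v c true) := ⟨hc, rfl⟩
    have h1 := even_card_circle_add_of_merge he.differAt
    have h3 : (Finset.univ.filter fun c' => Function.update v c true c' = true) =
        insert c (Finset.univ.filter fun c' => v c' = true) := by
      ext c'
      by_cases h4 : c' = c
      · subst h4; simp
      · simp [h4]
    simp only [par]
    rw [h3, Finset.card_insert_of_notMem (by simp [hc])]
    have h4 := (ZMod.natCast_eq_zero_iff_even).2 h1
    push_cast at h4 ⊢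
    have h5 := CharTwo.add_self_eq_zero (Fintype.card (D.Circle v) : ZMod 2)
    linear_combination h4 - h5
  have hstep' : ∀ (v : D.Vertex) c b, par (Function.update v c b) = par v := by
    intro v c b
    cases hv : v c <;> cases b
    · rw [← hv, Function.update_eq_self]
    · exact hstep v c hv
    · have := hstep (Function.update v c false) c (by simp)
      rw [← this, Function.update_idem, ← hv, Function.update_eq_self]
    · rw [← hv, Function.update_eq_self]
  have hconst : ∀ v w : D.Vertex, par v = par w := by
    classical
    intro v w
    have key : ∀ s : Finset (Fin D.n), par (s.piecewise v w) = par w := by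
      intro s
      induction s using Finset.induction_on with
      | empty => simp
      | insert c s _ ih => rw [Finset.piecewise_insert, hstep', ih]
    simpa using key Finset.univ
  have hq : ∀ S : D.State, ((D.qGrading S : ℤ) : ZMod 2) = par S.1 + (D.nPos : ZMod 2) := by
    intro S
    have h1 := (ZMod.intCast_eq_zero_iff_even).2 (even_pGrading_sub S)
    have h2 := CharTwo.add_self_eq_zero (D.nNeg : ZMod 2)
    simp only [qGrading, gr, par]
    push_cast at h1 ⊢
    linear_combination h1 - h2
  rw [← ZMod.intCast_eq_zero_iff_even]
  push_cast
  rw [hq, hq, hconst S.1 S'.1, sub_self]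

end KnotDiagram
end
noncomputable section

/-! ### Filtered complexes with a graded leading term -/

theorem Module.nonempty_equiv_of_ker_eq {Z A B : Type*} [AddCommGroup Z] [Module ℚ Z]
    [AddCommGroup A] [Module ℚ A] [AddCommGroup B] [Module ℚ B] {f : Z →ₗ[ℚ] A} {g : Z →ₗ[ℚ] B}
    (hf : Function.Surjective f) (hg : Function.Surjective g)
    (h : ∀ x, f x = 0 ↔ g x = 0) : Nonempty (A ≃ₗ[ℚ] B) := by
  have hk : LinearMap.ker f = LinearMap.ker g := by
    ext x; exact h x
  exact ⟨(f.quotKerEquivOfSurjective hf).symm.trans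
    ((Submodule.quotEquivOfEq _ _ hk).trans (g.quotKerEquivOfSurjective hg))⟩

section Subquotient

variable {M : Type*} [AddCommGroup M] [Module ℚ M]

/-- The class of an element in a subquotient. -/
def Subquotient.mk (Z B : Submodule ℚ M) : Z →ₗ[ℚ] Subquotient Z B := (B.submoduleOf Z).mkQ

theorem Subquotient.mk_surjective (Z B : Submodule ℚ M) :
    Function.Surjective (Subquotient.mk Z B) := Submodule.mkQ_surjective _

theorem Subquotient.mk_eq_zero {Z B : Submodule ℚ M} {x : Z} :
    Subquotient.mk Z B x = 0 ↔ (x : M) ∈ B := by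
  rw [Subquotient.mk, Submodule.mkQ_apply, Submodule.Quotient.mk_eq_zero]; rfl

theorem Subquotient.subsingleton {Z B : Submodule ℚ M} (h : Z ≤ B) :
    Subsingleton (Subquotient Z B) := by
  refine ⟨fun x y => ?_⟩
  obtain ⟨x, rfl⟩ := Subquotient.mk_surjective Z B x
  obtain ⟨y, rfl⟩ := Subquotient.mk_surjective Z B y
  rw [← sub_eq_zero, ← map_sub, Subquotient.mk_eq_zero]
  exact h (x - y).2

theorem Subquotient.finrank_add [FiniteDimensional ℚ M] {Z B : Submodule ℚ M} (h : B ≤ Z) :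
    Module.finrank ℚ (Subquotient Z B) + Module.finrank ℚ B = Module.finrank ℚ Z := by
  rw [← (Submodule.submoduleOfEquivOfLe h).finrank_eq]
  exact Submodule.finrank_quotient_add_finrank _

theorem Submodule.finrank_map_add_finrank_inf_ker [FiniteDimensional ℚ M] (d : M →ₗ[ℚ] M)
    (Z : Submodule ℚ M) : Module.finrank ℚ (Z.map d) + Module.finrank ℚ (Z ⊓ LinearMap.ker d :
      Submodule ℚ M) = Module.finrank ℚ Z := by
  have h := LinearMap.finrank_range_add_finrank_ker (d.domRestrict Z)
  rw [LinearMap.range_domRestrict] at h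
  rw [← h]
  congr 1
  have h1 : LinearMap.ker (d.domRestrict Z) = (Z ⊓ LinearMap.ker d).submoduleOf Z := by
    ext x; simp [Submodule.submoduleOf]
  rw [h1]
  exact (Submodule.submoduleOfEquivOfLe inf_le_left).finrank_eq.symm

end Subquotient

namespace Filtered

variable {M : Type*} [AddCommGroup M] [Module ℚ M]

/-- The differential `d` of a complex `C` with a bounded filtration `F` that is split by a grading
`A`; its leading term is `d₀`, and all other terms raise the degree by multiples of `4`. -/
structure IsSplitFiltered (d d₀ : M →ₗ[ℚ] M) (C A F : ℤ → Submodule ℚ M) : Prop where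
  comp_self : d ∘ₗ d = 0
  map_hom : ∀ b, ∀ x ∈ C b, d x ∈ C (b + 1)
  grading_le : ∀ a, A a ≤ F a
  antitone : Antitone F
  eq_zero : ∀ a, ∀ x ∈ A a, x ∈ F (a + 1) → x = 0
  exists_leading : ∀ b a, ∀ x ∈ C b ⊓ F a, ∃ y ∈ C b ⊓ A a, x - y ∈ F (a + 1)
  leading_grading : ∀ a, ∀ x ∈ A a, d₀ x ∈ A a
  sub_leading : ∀ a, ∀ x ∈ A a, d x - d₀ x ∈ F (a + 1)
  map_filtration : ∀ a, ∀ x ∈ F a, d x ∈ F a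
  exists_eq_top : ∃ a, F a = ⊤
  exists_eq_bot : ∃ a, F a = ⊥
  exists_hom : ∀ b y, d y ∈ C b → ∃ z ∈ C (b - 1), d z = d y
  exists_mod : ∀ r b a, ¬ 4 ∣ r → ∀ x ∈ C b ⊓ F a, d x ∈ F (a + r) →
    ∃ y ∈ C b ⊓ F a, x - y ∈ F (a + 1) ∧ d y ∈ F (a + r + 1)

/-- The homology of the leading term vanishes in homological degree `b` and degree `a`. -/
def LeadingExact (d₀ : M →ₗ[ℚ] M) (C A : ℤ → Submodule ℚ M) (b a : ℤ) : Prop :=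
  ∀ x ∈ C b ⊓ A a, d₀ x = 0 → ∃ y ∈ C (b - 1) ⊓ A a, d₀ y = x

theorem mem_cycles {d : M →ₗ[ℚ] M} {C F : ℤ → Submodule ℚ M} {r b a : ℤ} {x : M} :
    x ∈ cycles d C F r b a ↔ x ∈ C b ∧ x ∈ F a ∧ d x ∈ F (a + r) :=
  ⟨fun h => ⟨h.1.1, h.1.2, h.2⟩, fun h => ⟨⟨h.1, h.2.1⟩, h.2.2⟩⟩

theorem homologyImage_mono {d : M →ₗ[ℚ] M} {N N' : Submodule ℚ M} (hN : N ≤ N') :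
    homologyImage d N ≤ homologyImage d N' :=
  Submodule.map_mono fun _ hx => hN hx

namespace IsSplitFiltered

variable {d d₀ : M →ₗ[ℚ] M} {C A F : ℤ → Submodule ℚ M} (h : IsSplitFiltered d d₀ C A F)
include h

theorem map_map (x : M) : d (d x) = 0 := LinearMap.congr_fun h.comp_self x

theorem map_hom_sub (b : ℤ) {x : M} (hx : x ∈ C (b - 1)) : d x ∈ C b := by
  have := h.map_hom _ x hx
  rwa [sub_add_cancel] at this

/-- Where the homology of the leading term vanishes, a chain can be moved up in the filtration by
a boundary. -/
theorem exists_sub_mem {b p q : ℤ} (hpq : p ≤ q) (hex : ∀ a, p ≤ a → a < q → LeadingExact d₀ C A b a)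
    {w : M} (hwC : w ∈ C b) (hwF : w ∈ F p) (hw : d w ∈ F q) :
    ∃ y ∈ C (b - 1), y ∈ F p ∧ w - d y ∈ F q := by
  induction q, hpq using Int.leInduction with
  | base => exact ⟨0, zero_mem _, zero_mem _, by simpa using hwF⟩
  | succ q hpq ih =>
    obtain ⟨y, hyC, hyF, hy⟩ := ih (fun a h1 h2 => hex a h1 (by omega))
      (h.antitone (by omega : q ≤ q + 1) hw)
    have hC : w - d y ∈ C b := sub_mem hwC (h.map_hom_sub b hyC)
    obtain ⟨z, hz, hz'⟩ := h.exists_leading b q (w - d y) ⟨hC, hy⟩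
    have hdz : d₀ z = 0 := by
      refine h.eq_zero q _ (h.leading_grading q z hz.2) ?_
      have h1 : d₀ z = d w - d (w - d y - z) - (d z - d₀ z) := by
        rw [map_sub, map_sub, h.map_map]; abel
      rw [h1]
      exact sub_mem (sub_mem hw (h.map_filtration _ _ hz')) (h.sub_leading q z hz.2)
    obtain ⟨u, hu, rfl⟩ := hex q hpq (by omega) z hz hdz
    refine ⟨y + u, add_mem hyC hu.1, add_mem hyF (h.antitone hpq (h.grading_le q hu.2)), ?_⟩
    have h1 : w - d (y + u) = (w - d y - d₀ u) - (d u - d₀ u) := by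
      rw [map_add]; abel
    rw [h1]
    exact sub_mem hz' (h.sub_leading q u hu.2)

theorem cycles_le_boundaries {r b a : ℤ} (hr : 1 ≤ r) (hex : LeadingExact d₀ C A b a) :
    cycles d C F r b a ≤ boundaries d C F r b a := by
  intro x hx
  rw [mem_cycles] at hx
  obtain ⟨y, hyC, hyF, hy⟩ := h.exists_sub_mem (by omega : a ≤ a + 1)
    (fun a' h1 h2 => by rwa [show a' = a by omega]) hx.1 hx.2.1
    (h.antitone (by omega : a + 1 ≤ a + r) hx.2.2)
  have hdy : d (x - d y) = d x := by rw [map_sub, h.map_map, sub_zero]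
  rw [← sub_add_cancel x (d y)]
  refine Submodule.add_mem_sup ?_ (Submodule.mem_map_of_mem ?_)
  · rw [mem_cycles, hdy]
    exact ⟨sub_mem hx.1 (h.map_hom_sub b hyC), hy,
      h.antitone (by omega : a + 1 + (r - 1) ≤ a + r) hx.2.2⟩
  · rw [mem_cycles]
    refine ⟨hyC, h.antitone (by omega) hyF, ?_⟩
    rw [show a - r + 1 + (r - 1) = a by ring]
    exact h.map_filtration _ _ hyF

theorem subsingleton_page {r b a : ℤ} (hr : 1 ≤ r) (hex : LeadingExact d₀ C A b a) :
    Subsingleton (Page d C F r b a) :=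
  Subquotient.subsingleton (h.cycles_le_boundaries hr hex)

theorem mem_homologyImage {N : Submodule ℚ M} {x : LinearMap.ker d} :
    Subquotient.mk (LinearMap.ker d) (LinearMap.range d) x ∈ homologyImage d N ↔
      ∃ z ∈ N, ∃ y, (x : M) = z + d y := by
  constructor
  · rintro ⟨z, hz, hzx⟩
    refine ⟨z, hz, ?_⟩
    have h1 : Subquotient.mk (LinearMap.ker d) (LinearMap.range d) (x - z) = 0 := by
      rw [map_sub, sub_eq_zero]; exact hzx.symm
    obtain ⟨y, hy⟩ := Subquotient.mk_eq_zero.1 h1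
    refine ⟨y, ?_⟩
    rw [hy]; simp
  · rintro ⟨z, hz, y, hx⟩
    have hzk : z ∈ LinearMap.ker d := by
      have h1 := congrArg d hx
      rw [map_add, h.map_map, add_zero, LinearMap.mem_ker.1 x.2] at h1
      exact h1.symm
    refine ⟨⟨z, hzk⟩, hz, ?_⟩
    change Subquotient.mk (LinearMap.ker d) (LinearMap.range d) ⟨z, hzk⟩ = _
    rw [← sub_eq_zero, ← map_sub, Subquotient.mk_eq_zero]
    refine ⟨-y, ?_⟩
    simp only [Submodule.coe_sub]
    rw [hx, map_neg]; abel

/-- If the homology of the leading term vanishes wherever a differential of the page `r` or a later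
one could lead to or come from, then the term of the page `r` is the limit term. -/
theorem nonempty_page_equiv_limitTerm {r b a : ℤ} (hr : 1 ≤ r)
    (h1 : ∀ a', a + r ≤ a' → LeadingExact d₀ C A (b + 1) a')
    (h2 : ∀ a', a' ≤ a - r → LeadingExact d₀ C A (b - 1) a') :
    Nonempty (Page d C F r b a ≃ₗ[ℚ] LimitTerm d C F b a) := by
  let Z : Submodule ℚ M := LinearMap.ker d ⊓ (C b ⊓ F a)
  have hZ : Z ≤ cycles d C F r b a := fun x hx =>
    mem_cycles.2 ⟨hx.2.1, hx.2.2, by rw [LinearMap.mem_ker.1 hx.1]; exact zero_mem _⟩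
  let f : Z →ₗ[ℚ] Page d C F r b a := (Subquotient.mk _ _).comp (Submodule.inclusion hZ)
  let k : Z →ₗ[ℚ] homologyImage d (C b ⊓ F a) :=
    ((Subquotient.mk (LinearMap.ker d) (LinearMap.range d)).comp
      (Submodule.inclusion inf_le_left)).codRestrict _ fun x =>
        h.mem_homologyImage.2 ⟨x, x.2.2, 0, by simp⟩
  let g : Z →ₗ[ℚ] LimitTerm d C F b a := (Subquotient.mk _ _).comp k
  refine Module.nonempty_equiv_of_ker_eq (f := f) (g := g) ?_ ?_ ?_
  · intro w
    obtain ⟨x, rfl⟩ := Subquotient.mk_surjective _ _ w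
    have hx := mem_cycles.1 x.2
    obtain ⟨top, htop⟩ := h.exists_eq_bot
    obtain ⟨y, hyC, hyF, hy⟩ := h.exists_sub_mem (le_max_left (a + r) top)
      (fun a' h3 _ => h1 a' h3) (h.map_hom b _ hx.1) hx.2.2
      (by rw [h.map_map]; exact zero_mem _)
    have hy0 : d x - d y = 0 := by
      have := h.antitone (le_max_right (a + r) top) hy
      rwa [htop, Submodule.mem_bot] at this
    rw [add_sub_cancel_right] at hyC
    have hmem : (x : M) - y ∈ Z := by
      refine ⟨?_, sub_mem hx.1 hyC, sub_mem hx.2.1 (h.antitone (by omega) hyF)⟩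
      exact (map_sub d _ _).trans hy0
    refine ⟨⟨x - y, hmem⟩, ?_⟩
    change Subquotient.mk _ _ _ = _
    rw [← sub_eq_zero, ← map_sub, Subquotient.mk_eq_zero]
    refine Submodule.mem_sup_left (mem_cycles.2 ?_)
    have he : ((Submodule.inclusion hZ ⟨x - y, hmem⟩ - x : cycles d C F r b a) : M) = -y := by
      simp
    rw [he, map_neg, ← sub_eq_zero.1 hy0]
    refine ⟨neg_mem hyC, neg_mem (h.antitone (by omega) hyF), neg_mem ?_⟩
    rw [show a + 1 + (r - 1) = a + r by ring]
    exact hx.2.2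
  · refine (Subquotient.mk_surjective _ _).comp ?_
    rintro ⟨w, z, hz, rfl⟩
    exact ⟨⟨z, z.2, hz⟩, rfl⟩
  · rintro ⟨x, hxk, hxC, hxF⟩
    have hf : f ⟨x, hxk, hxC, hxF⟩ = 0 ↔ x ∈ boundaries d C F r b a := Subquotient.mk_eq_zero
    have hg : g ⟨x, hxk, hxC, hxF⟩ = 0 ↔ ∃ z ∈ C b ⊓ F (a + 1), ∃ y, x = z + d y :=
      Subquotient.mk_eq_zero.trans (h.mem_homologyImage (x := ⟨x, hxk⟩))
    rw [hf, hg]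
    constructor
    · intro hx
      obtain ⟨z, hz, _, ⟨y, -, rfl⟩, rfl⟩ := Submodule.mem_sup.1 hx
      exact ⟨z, ⟨hz.1.1, hz.1.2⟩, y, rfl⟩
    · rintro ⟨z, ⟨hzC, hzF⟩, y, rfl⟩
      have hzF' := h.antitone (by omega : a ≤ a + 1) hzF
      obtain ⟨y', hy'C, hy'⟩ := h.exists_hom b y (by simpa using sub_mem hxC hzC)
      have hdy : d y' ∈ F a := by rw [hy']; simpa using sub_mem hxF hzF'
      obtain ⟨low, hlow⟩ := h.exists_eq_top
      obtain ⟨u, huC, -, hu⟩ := h.exists_sub_mem (min_le_left (a - r + 1) low)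
        (fun a' _ h4 => h2 a' (by omega)) hy'C
        (h.antitone (min_le_right (a - r + 1) low) (by rw [hlow]; trivial))
        (h.antitone (by omega) hdy)
      have hdu : d (y' - d u) = d y := by rw [map_sub, h.map_map, sub_zero, hy']
      rw [← hdu]
      refine Submodule.add_mem_sup (mem_cycles.2 ⟨hzC, hzF, ?_⟩)
        (Submodule.mem_map_of_mem (mem_cycles.2 ⟨sub_mem hy'C (h.map_hom_sub _ huC), hu, ?_⟩))
      · have h5 : d z = 0 := by
          have hk : d (z + d y) = 0 := hxk
          rwa [map_add, h.map_map, add_zero] at hk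
        rw [h5]; exact zero_mem _
      · rw [hdu, ← hy', show a - r + 1 + (r - 1) = a by ring]
        exact hdy

theorem subsingleton_limitTerm {b a : ℤ} (hex : LeadingExact d₀ C A b a) :
    Subsingleton (LimitTerm d C F b a) := by
  refine Subquotient.subsingleton ?_
  rintro _ ⟨⟨x, hx⟩, ⟨hxC, hxF⟩, rfl⟩
  simp only [Submodule.coe_subtype, SetLike.mem_coe] at hxC hxF
  obtain ⟨y, hyC, -, hy⟩ := h.exists_sub_mem (by omega : a ≤ a + 1)
    (fun a' h1 h2 => by rwa [show a' = a by omega]) hxC hxF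
    (by rw [show d x = 0 from hx]; exact zero_mem _)
  exact h.mem_homologyImage.2 ⟨x - d y, ⟨sub_mem hxC (h.map_hom_sub b hyC), hy⟩, y, by simp⟩

/-- The first page is the homology of the leading term. -/
theorem nonempty_leading_equiv_page (b a : ℤ) :
    Nonempty (Subquotient (LinearMap.ker d₀ ⊓ (C b ⊓ A a)) ((C (b - 1) ⊓ A a).map d₀) ≃ₗ[ℚ]
      Page d C F 1 b a) := by
  let K : Submodule ℚ M := LinearMap.ker d₀ ⊓ (C b ⊓ A a)
  have hK : K ≤ cycles d C F 1 b a := fun x hx => by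
    refine mem_cycles.2 ⟨hx.2.1, h.grading_le a hx.2.2, ?_⟩
    have h1 := h.sub_leading a x hx.2.2
    rwa [LinearMap.mem_ker.1 hx.1, sub_zero] at h1
  let g : K →ₗ[ℚ] Page d C F 1 b a := (Subquotient.mk _ _).comp (Submodule.inclusion hK)
  refine Module.nonempty_equiv_of_ker_eq (f := Subquotient.mk K _) (g := g)
    (Subquotient.mk_surjective _ _) ?_ ?_
  · intro w
    obtain ⟨x, rfl⟩ := Subquotient.mk_surjective _ _ w
    have hx := mem_cycles.1 x.2
    obtain ⟨y, hy, hxy⟩ := h.exists_leading b a x ⟨hx.1, hx.2.1⟩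
    have hy0 : d₀ y = 0 := by
      refine h.eq_zero a _ (h.leading_grading a y hy.2) ?_
      have h1 : d₀ y = d x - d (x - y) - (d y - d₀ y) := by rw [map_sub]; abel
      rw [h1]
      exact sub_mem (sub_mem hx.2.2 (h.map_filtration _ _ hxy)) (h.sub_leading a y hy.2)
    refine ⟨⟨y, hy0, hy⟩, ?_⟩
    change Subquotient.mk _ _ _ = _
    rw [← sub_eq_zero, ← map_sub, Subquotient.mk_eq_zero]
    refine Submodule.mem_sup_left (mem_cycles.2 ?_)
    have he : ((Submodule.inclusion hK ⟨y, hy0, hy⟩ - x : cycles d C F 1 b a) : M) = -(x - y) := by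
      simp
    rw [he, map_neg]
    refine ⟨neg_mem (sub_mem hx.1 hy.1), neg_mem hxy, neg_mem ?_⟩
    rw [sub_self, add_zero]
    exact h.map_filtration _ _ hxy
  · rintro ⟨x, hxk, hx⟩
    have hg : g ⟨x, hxk, hx⟩ = 0 ↔ x ∈ boundaries d C F 1 b a := Subquotient.mk_eq_zero
    rw [hg, Subquotient.mk_eq_zero]
    constructor
    · rintro ⟨y, hy, hyx⟩
      simp only at hyx
      have h1 : x = -(d y - d₀ y) + d y := by rw [hyx]; abel
      have h2 := h.sub_leading a y hy.2
      rw [h1]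
      refine Submodule.add_mem_sup (mem_cycles.2 ⟨neg_mem (sub_mem (h.map_hom_sub b hy.1) ?_),
        neg_mem h2, ?_⟩) (Submodule.mem_map_of_mem (mem_cycles.2 ⟨hy.1, ?_, ?_⟩))
      · rw [hyx]; exact hx.1
      · rw [sub_self, add_zero]; exact h.map_filtration _ _ (neg_mem h2)
      · rw [sub_add_cancel]; exact h.grading_le a hy.2
      · rw [sub_add_cancel, sub_self, add_zero]; exact h.map_filtration _ _ (h.grading_le a hy.2)
    · intro hxB
      obtain ⟨u, hu, _, ⟨w, hw, rfl⟩, hux⟩ := Submodule.mem_sup.1 hxB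
      rw [mem_cycles] at hu
      have hw' := mem_cycles.1 hw
      rw [sub_add_cancel] at hw'
      obtain ⟨y, hy, hwy⟩ := h.exists_leading (b - 1) a w ⟨hw'.1, hw'.2.1⟩
      refine ⟨y, hy, ?_⟩
      have h1 : x - d₀ y = u + d (w - y) + (d y - d₀ y) := by rw [← hux, map_sub]; abel
      refine (sub_eq_zero.1 (h.eq_zero a _ (sub_mem hx.2 (h.leading_grading a y hy.2)) ?_)).symm
      rw [h1]
      exact add_mem (add_mem hu.2.1 (h.map_filtration _ _ hwy)) (h.sub_leading a y hy.2)

theorem cycles_pred_le (r b a : ℤ) : cycles d C F (r - 1) b (a + 1) ≤ cycles d C F r b a := by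
  intro x hx
  rw [mem_cycles] at hx ⊢
  exact ⟨hx.1, h.antitone (by omega) hx.2.1, by
    rw [show a + r = a + 1 + (r - 1) by ring]; exact hx.2.2⟩

theorem cycles_succ_le (r b a : ℤ) : cycles d C F (r + 1) b a ≤ cycles d C F r b a := by
  intro x hx
  rw [mem_cycles] at hx ⊢
  exact ⟨hx.1, hx.2.1, h.antitone (by omega) hx.2.2⟩

end IsSplitFiltered

/-! ### Dimensions of the pages -/

/-- The rank of the differential of the page `r` in terms of the dimensions of the cycles. -/
def diffRank (d : M →ₗ[ℚ] M) (C F : ℤ → Submodule ℚ M) (r b a : ℤ) : ℤ :=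
  Module.finrank ℚ (cycles d C F r b a) - Module.finrank ℚ (cycles d C F (r + 1) b a) -
    (Module.finrank ℚ (cycles d C F (r - 1) b (a + 1)) - Module.finrank ℚ (cycles d C F r b (a + 1)))

namespace IsSplitFiltered

variable {d d₀ : M →ₗ[ℚ] M} {C A F : ℤ → Submodule ℚ M} (h : IsSplitFiltered d d₀ C A F)
  [FiniteDimensional ℚ M]
include h

theorem finrank_cycles_sup (r b a : ℤ) :
    (Module.finrank ℚ (cycles d C F r b a) : ℤ) - Module.finrank ℚ
      (cycles d C F (r + 1) b a ⊔ cycles d C F (r - 1) b (a + 1) : Submodule ℚ M) =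
      diffRank d C F r b a := by
  have h1 := Submodule.finrank_sup_add_finrank_inf_eq (cycles d C F (r + 1) b a)
    (cycles d C F (r - 1) b (a + 1))
  have h2 : cycles d C F (r + 1) b a ⊓ cycles d C F (r - 1) b (a + 1) =
      cycles d C F r b (a + 1) := by
    ext x
    rw [Submodule.mem_inf, mem_cycles, mem_cycles, mem_cycles,
      show a + (r + 1) = a + 1 + r by ring]
    refine ⟨fun hx => ⟨hx.1.1, hx.2.2.1, hx.1.2.2⟩, fun hx => ⟨⟨hx.1, ?_, hx.2.2⟩, hx.1, hx.2.1, ?_⟩⟩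
    · exact h.antitone (by omega) hx.2.1
    · exact h.antitone (by omega) hx.2.2
  rw [h2] at h1
  unfold diffRank
  omega

theorem diffRank_nonneg (r b a : ℤ) : 0 ≤ diffRank d C F r b a := by
  rw [← h.finrank_cycles_sup]
  have := Submodule.finrank_mono (sup_le (h.cycles_succ_le r b a) (h.cycles_pred_le r b a))
  omega

theorem diffRank_eq_zero {r : ℤ} (hr : ¬ 4 ∣ r) (b a : ℤ) : diffRank d C F r b a = 0 := by
  suffices hle : cycles d C F r b a ≤ cycles d C F (r + 1) b a ⊔ cycles d C F (r - 1) b (a + 1) by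
    rw [← h.finrank_cycles_sup,
      ← le_antisymm hle (sup_le (h.cycles_succ_le r b a) (h.cycles_pred_le r b a)), sub_self]
  intro x hx
  rw [mem_cycles] at hx
  obtain ⟨y, hy, hxy, hdy⟩ := h.exists_mod r b a hr x ⟨hx.1, hx.2.1⟩ hx.2.2
  rw [← add_sub_cancel y x]
  refine Submodule.add_mem_sup (mem_cycles.2 ⟨hy.1, hy.2, ?_⟩)
    (mem_cycles.2 ⟨sub_mem hx.1 hy.1, hxy, ?_⟩)
  · rwa [← add_assoc]
  · rw [map_sub, show a + 1 + (r - 1) = a + r by ring]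
    exact sub_mem hx.2.2 (h.antitone (by omega) hdy)

theorem finrank_page (r b a : ℤ) : (Module.finrank ℚ (Page d C F r b a) : ℤ) =
    Module.finrank ℚ (cycles d C F r b a) - Module.finrank ℚ (cycles d C F (r - 1) b (a + 1)) -
      (Module.finrank ℚ (cycles d C F (r - 1) (b - 1) (a - r + 1)) -
        Module.finrank ℚ (cycles d C F r (b - 1) (a - r + 1))) := by
  have hle : (cycles d C F (r - 1) (b - 1) (a - r + 1)).map d ≤ cycles d C F r b a := by
    rintro _ ⟨x, hx, rfl⟩
    have hx' := mem_cycles.1 hx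
    rw [show a - r + 1 + (r - 1) = a by ring] at hx'
    exact mem_cycles.2 ⟨h.map_hom_sub b hx'.1, hx'.2.2, by rw [h.map_map]; exact zero_mem _⟩
  have h1 : Module.finrank ℚ (Page d C F r b a) + Module.finrank ℚ (boundaries d C F r b a) = _ :=
    Subquotient.finrank_add (sup_le (h.cycles_pred_le r b a) hle)
  have h2 : Module.finrank ℚ (boundaries d C F r b a) + _ = _ :=
    Submodule.finrank_sup_add_finrank_inf_eq (cycles d C F (r - 1) b (a + 1))
    ((cycles d C F (r - 1) (b - 1) (a - r + 1)).map d)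
  have h3 : cycles d C F (r - 1) b (a + 1) ⊓ (cycles d C F (r - 1) (b - 1) (a - r + 1)).map d =
      (cycles d C F r (b - 1) (a - r + 1)).map d := by
    ext x
    constructor
    · rintro ⟨hx, w, hw, rfl⟩
      have hx' := mem_cycles.1 hx
      have hw' := mem_cycles.1 hw
      refine ⟨w, mem_cycles.2 ⟨hw'.1, hw'.2.1, ?_⟩, rfl⟩
      rw [show a - r + 1 + r = a + 1 by ring]
      exact hx'.2.1
    · rintro ⟨w, hw, rfl⟩
      have hw' := mem_cycles.1 hw
      rw [show a - r + 1 + r = a + 1 by ring] at hw'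
      refine ⟨mem_cycles.2 ⟨h.map_hom_sub b hw'.1, hw'.2.2, by rw [h.map_map]; exact zero_mem _⟩,
        w, mem_cycles.2 ⟨hw'.1, hw'.2.1, ?_⟩, rfl⟩
      exact h.antitone (by omega) hw'.2.2
  have h4 := Submodule.finrank_map_add_finrank_inf_ker d (cycles d C F (r - 1) (b - 1) (a - r + 1))
  have h5 := Submodule.finrank_map_add_finrank_inf_ker d (cycles d C F r (b - 1) (a - r + 1))
  have h6 : cycles d C F (r - 1) (b - 1) (a - r + 1) ⊓ LinearMap.ker d =
      cycles d C F r (b - 1) (a - r + 1) ⊓ LinearMap.ker d := by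
    ext x
    simp only [Submodule.mem_inf, mem_cycles, LinearMap.mem_ker]
    refine and_congr_left fun hx => ?_
    simp [hx]
  rw [h3] at h2
  rw [h6] at h4
  omega

theorem finrank_page_eq_add (r b a : ℤ) : (Module.finrank ℚ (Page d C F r b a) : ℤ) =
    Module.finrank ℚ (Page d C F (r + 1) b a) + diffRank d C F r b a +
      diffRank d C F r (b - 1) (a - r) := by
  rw [h.finrank_page, h.finrank_page, diffRank, diffRank, add_sub_cancel_right,
    show a - (r + 1) + 1 = a - r by ring]
  ring

/-- Only the differentials on the pages whose number is a multiple of `4` matter. -/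
theorem finrank_page_one (b a : ℤ) : (Module.finrank ℚ (Page d C F 1 b a) : ℤ) =
    Module.finrank ℚ (Page d C F 8 b a) + diffRank d C F 4 b a + diffRank d C F 4 (b - 1) (a - 4) := by
  have key : ∀ r, ¬ 4 ∣ r → (Module.finrank ℚ (Page d C F r b a) : ℤ) =
      Module.finrank ℚ (Page d C F (r + 1) b a) := fun r hr => by
    rw [h.finrank_page_eq_add, h.diffRank_eq_zero hr, h.diffRank_eq_zero hr, add_zero, add_zero]
  rw [key 1 (by decide), show (1 : ℤ) + 1 = 2 from rfl, key 2 (by decide),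
    show (2 : ℤ) + 1 = 3 from rfl, key 3 (by decide), show (3 : ℤ) + 1 = 4 from rfl,
    h.finrank_page_eq_add, show (4 : ℤ) + 1 = 5 from rfl, key 5 (by decide),
    show (5 : ℤ) + 1 = 6 from rfl, key 6 (by decide), show (6 : ℤ) + 1 = 7 from rfl,
    key 7 (by decide), show (7 : ℤ) + 1 = 8 from rfl]

end IsSplitFiltered

end Filtered
end
noncomputable section

namespace Finsupp

variable {ι : Type*}

/-- The part of a finitely supported function on the indices that satisfy `p`. -/
def restrictTo (p : ι → Prop) [DecidablePred p] : (ι →₀ ℚ) →ₗ[ℚ] (ι →₀ ℚ) where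
  toFun := Finsupp.filter p
  map_add' _ _ := Finsupp.filter_add
  map_smul' _ _ := Finsupp.filter_smul

theorem restrictTo_apply (p : ι → Prop) [DecidablePred p] (x : ι →₀ ℚ) (i : ι) :
    restrictTo p x i = if p i then x i else 0 := Finsupp.filter_apply p x i

theorem mem_supported_iff {s : ι → Prop} {x : ι →₀ ℚ} :
    x ∈ Finsupp.supported ℚ ℚ {i | s i} ↔ ∀ i, ¬ s i → x i = 0 := Finsupp.mem_supported' ℚ x

theorem map_mem_supported {T : (ι →₀ ℚ) →ₗ[ℚ] (ι →₀ ℚ)} {s t : ι → Prop}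
    (h : ∀ i, s i → T (Finsupp.single i 1) ∈ Finsupp.supported ℚ ℚ {i | t i}) {x : ι →₀ ℚ}
    (hx : x ∈ Finsupp.supported ℚ ℚ {i | s i}) : T x ∈ Finsupp.supported ℚ ℚ {i | t i} := by
  rw [Finsupp.supported_eq_span_single] at hx
  have h1 : Submodule.span ℚ ((fun i => Finsupp.single i (1 : ℚ)) '' {i | s i}) ≤
      (Finsupp.supported ℚ ℚ {i | t i}).comap T := by
    rw [Submodule.span_le]
    rintro _ ⟨i, hi, rfl⟩
    exact h i hi
  exact h1 hx

theorem map_restrictTo {T : (ι →₀ ℚ) →ₗ[ℚ] (ι →₀ ℚ)} {s t : ι → Prop} [DecidablePred s]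
    [DecidablePred t] (h : ∀ i, s i → T (Finsupp.single i 1) ∈ Finsupp.supported ℚ ℚ {i | t i})
    (h' : ∀ i, ¬ s i → T (Finsupp.single i 1) ∈ Finsupp.supported ℚ ℚ {i | ¬ t i}) (x : ι →₀ ℚ) :
    T (restrictTo s x) = restrictTo t (T x) := by
  have h1 : T (restrictTo s x) ∈ Finsupp.supported ℚ ℚ {i | t i} :=
    map_mem_supported h (mem_supported_iff.2 fun i hi => by rw [restrictTo_apply, if_neg hi])
  have h2 : T (x - restrictTo s x) ∈ Finsupp.supported ℚ ℚ {i | ¬ t i} :=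
    map_mem_supported h' (mem_supported_iff.2 fun i hi => by
      rw [Finsupp.sub_apply, restrictTo_apply, if_pos (not_not.1 hi), sub_self])
  rw [mem_supported_iff] at h1 h2
  ext i
  rw [restrictTo_apply]
  split_ifs with hi
  · have := h2 i (not_not.2 hi)
    rw [map_sub, Finsupp.sub_apply] at this
    linarith
  · exact h1 i hi

end Finsupp

namespace KnotDiagram

open Finsupp (restrictTo restrictTo_apply mem_supported_iff map_mem_supported map_restrictTo)

variable {D : KnotDiagram}

theorem mem_homDegree {b : ℤ} {x : D.Chain} : x ∈ D.homDegree b ↔ ∀ S, D.gr S ≠ b → x S = 0 :=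
  mem_supported_iff

theorem mem_qDegree {a : ℤ} {x : D.Chain} : x ∈ D.qDegree a ↔ ∀ S, D.qGrading S ≠ a → x S = 0 :=
  mem_supported_iff

theorem mem_qFiltration {a : ℤ} {x : D.Chain} :
    x ∈ D.qFiltration a ↔ ∀ S, D.qGrading S < a → x S = 0 := by
  simp only [qFiltration, mem_supported_iff, not_le]

theorem leeDiff_single_apply (S S' : D.State) (h : D.leeDiff (Finsupp.single S 1) S' ≠ 0) :
    D.qGrading S' = D.qGrading S ∨ D.qGrading S' = D.qGrading S + 4 := by
  by_contra! hne
  have hS : (Finsupp.single S 1 : D.Chain) ∈ D.qDegree (D.qGrading S) :=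
    Finsupp.single_mem_supported ℚ _ rfl
  have h1 := mem_qDegree.1 (khovanovDiff_mem_qDegree hS) S' hne.1
  have h2 := mem_qDegree.1 (leeDiff_sub_khovanovDiff_mem_qDegree hS) S' hne.2
  rw [Finsupp.sub_apply, h1, sub_zero] at h2
  exact h h2

theorem leeDiff_restrictTo_mod (κ : ℤ) (x : D.Chain) :
    D.leeDiff (restrictTo (fun S => 4 ∣ D.qGrading S - κ) x) =
      restrictTo (fun S => 4 ∣ D.qGrading S - κ) (D.leeDiff x) := by
  refine map_restrictTo (fun S hS => ?_) (fun S hS => ?_) x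
  · refine mem_supported_iff.2 fun S' hS' => ?_
    by_contra h
    rcases leeDiff_single_apply S S' h with h1 | h1 <;> omega
  · refine mem_supported_iff.2 fun S' hS' => ?_
    by_contra h
    rcases leeDiff_single_apply S S' h with h1 | h1 <;> omega

theorem leeDiff_restrictTo_gr (b : ℤ) (x : D.Chain) :
    D.leeDiff (restrictTo (fun S => D.gr S = b) x) =
      restrictTo (fun S => D.gr S = b + 1) (D.leeDiff x) := by
  have key : ∀ S : D.State, D.leeDiff (Finsupp.single S 1) ∈ D.homDegree (D.gr S + 1) := fun S =>
    D.diff_mem_homDegree 1 _ _ (Finsupp.single_mem_supported ℚ _ rfl)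
  refine map_restrictTo (fun S hS => ?_) (fun S hS => ?_) x
  · have := key S
    rw [hS] at this
    exact this
  · exact mem_supported_iff.2 fun S' hS' => mem_homDegree.1 (key S) S' (by omega)

variable (D) in
theorem isSplitFiltered : Filtered.IsSplitFiltered D.leeDiff D.khovanovDiff D.homDegree D.qDegree
    D.qFiltration where
  comp_self := leeDiff_comp_leeDiff
  map_hom := D.diff_mem_homDegree 1
  grading_le a x hx := mem_qFiltration.2 fun S hS => mem_qDegree.1 hx S hS.ne
  antitone a a' haa' x hx := mem_qFiltration.2 fun S hS =>
    mem_qFiltration.1 hx S (hS.trans_le haa')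
  eq_zero a x hx hx' := by
    ext S
    by_cases hS : D.qGrading S = a
    · exact mem_qFiltration.1 hx' S (by omega)
    · exact mem_qDegree.1 hx S hS
  exists_leading b a x hx := by
    refine ⟨restrictTo (fun S => D.qGrading S = a) x, ⟨mem_homDegree.2 fun S hS => ?_,
      mem_qDegree.2 fun S hS => ?_⟩, mem_qFiltration.2 fun S hS => ?_⟩
    · rw [restrictTo_apply, mem_homDegree.1 hx.1 S hS, ite_self]
    · rw [restrictTo_apply, if_neg hS]
    · rw [Finsupp.sub_apply, restrictTo_apply]
      split_ifs with h
      · exact sub_self _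
      · rw [mem_qFiltration.1 hx.2 S (by omega), sub_zero]
  leading_grading a x hx := khovanovDiff_mem_qDegree hx
  sub_leading a x hx := mem_qFiltration.2 fun S hS =>
    mem_qDegree.1 (leeDiff_sub_khovanovDiff_mem_qDegree hx) S (by omega)
  map_filtration a x hx := by
    refine map_mem_supported (fun S hS => mem_supported_iff.2 fun S' hS' => ?_) hx
    by_contra h
    rcases leeDiff_single_apply S S' h with h1 | h1 <;> omega
  exists_eq_top := by
    obtain ⟨m, hm⟩ := (Set.finite_range D.qGrading).bddBelow
    refine ⟨m, eq_top_iff.2 fun x _ => mem_qFiltration.2 fun S hS => ?_⟩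
    exact absurd (hm ⟨S, rfl⟩) (not_le.2 hS)
  exists_eq_bot := by
    obtain ⟨m, hm⟩ := (Set.finite_range D.qGrading).bddAbove
    refine ⟨m + 1, eq_bot_iff.2 fun x hx => ?_⟩
    ext S
    exact mem_qFiltration.1 hx S (Int.lt_add_one_iff.2 (hm ⟨S, rfl⟩))
  exists_hom b y hy := by
    refine ⟨restrictTo (fun S => D.gr S = b - 1) y, mem_homDegree.2 fun S hS => ?_, ?_⟩
    · rw [restrictTo_apply, if_neg hS]
    · rw [leeDiff_restrictTo_gr]
      ext S
      rw [restrictTo_apply, sub_add_cancel]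
      split_ifs with h
      · rfl
      · exact (mem_homDegree.1 hy S h).symm
  exists_mod r b a hr x hx hdx := by
    refine ⟨restrictTo (fun S => 4 ∣ D.qGrading S - a) x, ⟨mem_homDegree.2 fun S hS => ?_,
      mem_qFiltration.2 fun S hS => ?_⟩, mem_qFiltration.2 fun S hS => ?_,
      mem_qFiltration.2 fun S hS => ?_⟩
    · rw [restrictTo_apply, mem_homDegree.1 hx.1 S hS, ite_self]
    · rw [restrictTo_apply, mem_qFiltration.1 hx.2 S hS, ite_self]
    · rw [Finsupp.sub_apply, restrictTo_apply]
      split_ifs with h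
      · exact sub_self _
      · rw [mem_qFiltration.1 hx.2 S (by omega), sub_zero]
    · rw [leeDiff_restrictTo_mod, restrictTo_apply]
      split_ifs with h
      · exact mem_qFiltration.1 hdx S (by omega)
      · rfl

/-! ### A basis of Lee homology adapted to the filtration -/

variable (D) in
/-- The chain `x` is homologous to an element of the filtration step `a`. -/
def InFiltration (a : ℤ) (x : D.Chain) : Prop :=
  ∃ z ∈ D.qFiltration a, ∃ y, x = z + D.leeDiff y

theorem InFiltration.mono {a a' : ℤ} (haa' : a' ≤ a) {x : D.Chain} (h : D.InFiltration a x) :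
    D.InFiltration a' x := by
  obtain ⟨z, hz, hy⟩ := h
  exact ⟨z, D.isSplitFiltered.antitone haa' hz, hy⟩

theorem InFiltration.add {a : ℤ} {x x' : D.Chain} (h : D.InFiltration a x)
    (h' : D.InFiltration a x') : D.InFiltration a (x + x') := by
  obtain ⟨z, hz, y, rfl⟩ := h
  obtain ⟨z', hz', y', rfl⟩ := h'
  exact ⟨z + z', add_mem hz hz', y + y', by rw [map_add]; abel⟩

theorem InFiltration.smul {a : ℤ} {x : D.Chain} (r : ℚ) (h : D.InFiltration a x) :
    D.InFiltration a (r • x) := by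
  obtain ⟨z, hz, y, rfl⟩ := h
  exact ⟨r • z, Submodule.smul_mem _ _ hz, r • y, by rw [map_smul, smul_add]⟩

theorem InFiltration.of_smul {a : ℤ} {x : D.Chain} {r : ℚ} (hr : r ≠ 0)
    (h : D.InFiltration a (r • x)) : D.InFiltration a x := by
  have := h.smul r⁻¹
  rwa [smul_smul, inv_mul_cancel₀ hr, one_smul] at this

theorem InFiltration.restrictTo {a : ℤ} {x : D.Chain} (κ : ℤ) (h : D.InFiltration a x) :
    ∃ z ∈ D.qFiltration a, (∀ S, ¬ 4 ∣ D.qGrading S - κ → z S = 0) ∧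
      ∃ y, Finsupp.restrictTo (fun S => 4 ∣ D.qGrading S - κ) x = z + D.leeDiff y := by
  obtain ⟨z, hz, y, rfl⟩ := h
  refine ⟨Finsupp.restrictTo (fun S => 4 ∣ D.qGrading S - κ) z, mem_qFiltration.2 fun S hS => ?_,
    fun S hS => ?_, Finsupp.restrictTo (fun S => 4 ∣ D.qGrading S - κ) y, ?_⟩
  · rw [restrictTo_apply, mem_qFiltration.1 hz S hS, ite_self]
  · rw [restrictTo_apply, if_neg hS]
  · rw [map_add, leeDiff_restrictTo_mod]

theorem InFiltration.basepointMap {a : ℤ} {x : D.Chain} (h : D.InFiltration a x) :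
    D.InFiltration (a - 2) (D.basepointMap x) := by
  obtain ⟨z, hz, y, rfl⟩ := h
  refine ⟨D.basepointMap z, mem_qFiltration.2 fun S hS => ?_, D.basepointMap y, ?_⟩
  · rw [basepointMap_apply]
    refine mem_qFiltration.1 hz _ ?_
    rcases qGrading_flip S with h1 | h1 <;> omega
  · rw [map_add, leeDiff_basepointMap]

/-- The filtration degree of a homology class that is supported in one residue class modulo `4`. -/
theorem exists_inFiltration_iff {κ : ℤ} {u : D.Chain} (hub : ∀ y, D.leeDiff y ≠ u)
    (hκ : ∀ S, ¬ 4 ∣ D.qGrading S - κ → u S = 0) :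
    ∃ m, 4 ∣ m - κ ∧ ∀ a, D.InFiltration a u ↔ a ≤ m := by
  obtain ⟨low, hlow⟩ := D.isSplitFiltered.exists_eq_top
  obtain ⟨top, htop⟩ := D.isSplitFiltered.exists_eq_bot
  have h1 : D.InFiltration low u := ⟨u, by rw [hlow]; trivial, 0, by simp⟩
  have h2 : ∀ a, D.InFiltration a u → a ≤ top := by
    intro a ha
    by_contra! hlt
    obtain ⟨z, hz, y, hy⟩ := ha.mono hlt.le
    rw [htop, Submodule.mem_bot] at hz
    rw [hz, zero_add] at hy
    exact hub y hy.symm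
  obtain ⟨m, hm, hmax⟩ := Int.exists_greatest_of_bdd ⟨top, h2⟩ ⟨low, h1⟩
  refine ⟨m, ?_, fun a => ⟨hmax a, fun ha => hm.mono ha⟩⟩
  by_contra hmod
  obtain ⟨z, hz, hzκ, y, hy⟩ := hm.restrictTo κ
  have hu : Finsupp.restrictTo (fun S => 4 ∣ D.qGrading S - κ) u = u := by
    ext S
    rw [restrictTo_apply]
    split_ifs with h
    · rfl
    · exact (hκ S h).symm
  rw [hu] at hy
  have := hmax (m + 1) ⟨z, mem_qFiltration.2 fun S hS => ?_, y, hy⟩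
  · omega
  · by_cases hS' : D.qGrading S = m
    · exact hzκ S (by rwa [hS'])
    · exact mem_qFiltration.1 hz S (by omega)

/-- There are a cycle `u` that is not a boundary and a residue class modulo `4` that contains the
`q`-gradings of its terms. -/
theorem exists_homogeneous_cycle {φ : Arc D.n → Bool} (hφ : D.IsAlternating φ) :
    ∃ (κ : ℤ) (u : D.Chain), D.leeDiff u = 0 ∧ (∀ y, D.leeDiff y ≠ u) ∧
      (∀ S, 2 ∣ D.qGrading S - κ) ∧ ∀ S, ¬ 4 ∣ D.qGrading S - κ → u S = 0 := by
  obtain ⟨x, hx, hx1⟩ := exists_leeCycle hφ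
  have hxb : ∀ y, D.leeDiff y ≠ x := by
    rintro y rfl
    rw [idemCoeff_leeDiff_of_isAlternating hφ] at hx1
    exact zero_ne_one hx1
  let S₀ : D.State := ⟨fun _ => true, fun _ => true⟩
  have hpar : ∀ S, 2 ∣ D.qGrading S - D.qGrading S₀ := fun S =>
    even_iff_two_dvd.1 (even_qGrading_sub S S₀)
  set u := restrictTo (fun S => 4 ∣ D.qGrading S - D.qGrading S₀) x with hu
  have hdu : D.leeDiff u = 0 := by rw [hu, leeDiff_restrictTo_mod, hx, map_zero]
  have hu0 : ∀ S, u S = if 4 ∣ D.qGrading S - D.qGrading S₀ then x S else 0 :=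
    fun S => restrictTo_apply _ x S
  by_cases hub : ∀ y, D.leeDiff y ≠ u
  · exact ⟨D.qGrading S₀, u, hdu, hub, hpar, fun S hS => by rw [hu0, if_neg hS]⟩
  · push Not at hub
    obtain ⟨y, hy⟩ := hub
    refine ⟨D.qGrading S₀ + 2, x - u, by rw [map_sub, hx, hdu, sub_zero], fun y' hy' => ?_,
      fun S => ?_, fun S hS => ?_⟩
    · exact hxb (y + y') (by rw [map_add, hy, hy']; abel)
    · have := hpar S; omega
    · rw [Finsupp.sub_apply, hu0, if_pos, sub_self]
      have := hpar S; omega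

/-- Lee homology has a basis of two classes, whose filtration degrees differ by `2` and which
split the filtration. -/
theorem exists_leeBasis : ∃ (u w : D.Chain) (m : ℤ), D.leeDiff u = 0 ∧ D.leeDiff w = 0 ∧
    (∀ x, D.leeDiff x = 0 → ∃ (α β : ℚ) (y : D.Chain), x = α • u + β • w + D.leeDiff y) ∧
    ∀ (a : ℤ) (α β : ℚ), D.InFiltration a (α • u + β • w) ↔
      (α = 0 ∨ a ≤ m) ∧ (β = 0 ∨ a ≤ m + 2) := by
  obtain ⟨φ, hφ⟩ := D.planar.exists_isAlternating
  obtain ⟨κ, u, hu, hub, hpar, huκ⟩ := exists_homogeneous_cycle hφ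
  set w := D.basepointMap u with hw
  have hwu : D.basepointMap w = u := basepointMap_basepointMap u
  have hdw : D.leeDiff w = 0 := by rw [hw, leeDiff_basepointMap, hu, map_zero]
  have hwb : ∀ y, D.leeDiff y ≠ w := fun y hy =>
    hub (D.basepointMap y) (by rw [leeDiff_basepointMap, hy, hwu])
  have hwκ : ∀ S, ¬ 4 ∣ D.qGrading S - (κ + 2) → w S = 0 := by
    intro S hS
    rw [hw, basepointMap_apply]
    apply huκ
    have := hpar S
    rcases qGrading_flip S with h1 | h1 <;> omega
  have hwκ' : ∀ S, 4 ∣ D.qGrading S - κ → w S = 0 := fun S hS => hwκ S (by omega)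
  have huκ' : ∀ S, 4 ∣ D.qGrading S - (κ + 2) → u S = 0 := fun S hS => huκ S (by omega)
  have hru : ∀ α β : ℚ, restrictTo (fun S => 4 ∣ D.qGrading S - κ) (α • u + β • w) = α • u := by
    intro α β
    ext S
    rw [restrictTo_apply]
    simp only [Finsupp.add_apply, Finsupp.smul_apply, smul_eq_mul]
    split_ifs with h
    · rw [hwκ' S h]; ring
    · rw [huκ S h]; ring
  have hrw : ∀ α β : ℚ, restrictTo (fun S => 4 ∣ D.qGrading S - (κ + 2)) (α • u + β • w) =
      β • w := by
    intro α β
    ext S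
    rw [restrictTo_apply]
    simp only [Finsupp.add_apply, Finsupp.smul_apply, smul_eq_mul]
    split_ifs with h
    · rw [huκ' S h]; ring
    · rw [hwκ S h]; ring
  have hsplit : ∀ (a : ℤ) (α β : ℚ), D.InFiltration a (α • u + β • w) ↔
      D.InFiltration a (α • u) ∧ D.InFiltration a (β • w) := by
    intro a α β
    refine ⟨fun h => ⟨?_, ?_⟩, fun h => h.1.add h.2⟩
    · obtain ⟨z, hz, -, y, hy⟩ := h.restrictTo κ
      rw [hru] at hy
      exact ⟨z, hz, y, hy⟩
    · obtain ⟨z, hz, -, y, hy⟩ := h.restrictTo (κ + 2)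
      rw [hrw] at hy
      exact ⟨z, hz, y, hy⟩
  obtain ⟨m, hm4, hm⟩ := exists_inFiltration_iff hub huκ
  obtain ⟨m', hm4', hm'⟩ := exists_inFiltration_iff hwb hwκ
  have h1 : m - 2 ≤ m' := (hm' _).1 ((hm m).2 le_rfl).basepointMap
  have h2 : m' - 2 ≤ m := by
    have := ((hm' m').2 le_rfl).basepointMap
    rw [hwu] at this
    exact (hm _).1 this
  have hsmul : ∀ (x : D.Chain) (k : ℤ), (∀ a, D.InFiltration a x ↔ a ≤ k) → ∀ (a : ℤ) (r : ℚ),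
      D.InFiltration a (r • x) ↔ r = 0 ∨ a ≤ k := by
    intro x k hk a r
    by_cases hr : r = 0
    · simp only [hr, zero_smul, true_or, iff_true]
      exact ⟨0, zero_mem _, 0, by simp⟩
    · rw [← hk]
      simp only [hr, false_or]
      exact ⟨fun h => h.of_smul hr, fun h => h.smul r⟩
  have hspan : ∀ x, D.leeDiff x = 0 →
      ∃ (α β : ℚ) (y : D.Chain), x = α • u + β • w + D.leeDiff y := by
    set φ' : Arc D.n → Bool := fun a => !φ a with hφ'
    set σ := chi (φ 0) false with hσ
    have hσ1 : σ * σ = 1 := chi_mul_self _ _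
    set p := D.idemCoeff u D.orientedVertex φ with hp
    set q := D.idemCoeff u D.orientedVertex φ' with hq
    have hwp : D.idemCoeff w D.orientedVertex φ = σ * p := idemCoeff_basepointMap _ _ _
    have hwq : D.idemCoeff w D.orientedVertex φ' = -σ * q := by
      have hneg : ∀ b : Bool, chi (!b) false = -chi b false := by
        intro b
        cases b <;> norm_num [chi]
      rw [hw, idemCoeff_basepointMap]
      exact congrArg (· * q) (hneg (φ 0))
    have hindep : ∀ ε : ℚ, ∀ y, D.leeDiff y ≠ w + ε • u := by
      intro ε y hy
      have h4 : w + ε • u = ε • u + (1 : ℚ) • w := by rw [one_smul, add_comm]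
      rw [h4] at hy
      have h3 := congrArg (restrictTo (fun S => 4 ∣ D.qGrading S - (κ + 2))) hy
      rw [← leeDiff_restrictTo_mod, hrw, one_smul] at h3
      exact hwb _ h3
    have hp0 : p ≠ 0 := by
      intro h0
      obtain ⟨y, hy⟩ := exists_leeDiff_eq hφ (x := w + σ • u)
        (by rw [map_add, map_smul, hu, hdw, smul_zero, add_zero])
        (by simp only [map_add, map_smul, Pi.add_apply, Pi.smul_apply, smul_eq_mul, hwp, ← hp, h0]
            ring)
        (by simp only [map_add, map_smul, Pi.add_apply, Pi.smul_apply, smul_eq_mul]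
            rw [hwq, ← hq]; ring)
      exact hindep _ y hy
    have hq0 : q ≠ 0 := by
      intro h0
      obtain ⟨y, hy⟩ := exists_leeDiff_eq hφ (x := w + (-σ) • u)
        (by rw [map_add, map_smul, hu, hdw, smul_zero, add_zero])
        (by simp only [map_add, map_smul, Pi.add_apply, Pi.smul_apply, smul_eq_mul, hwp, ← hp]
            ring)
        (by simp only [map_add, map_smul, Pi.add_apply, Pi.smul_apply, smul_eq_mul]
            rw [hwq, ← hq, h0]; ring)
      exact hindep _ y hy
    intro x hx
    set x₁ := D.idemCoeff x D.orientedVertex φ with hx₁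
    set x₂ := D.idemCoeff x D.orientedVertex φ' with hx₂
    set α := (x₁ / p + x₂ / q) / 2 with hα
    set β := σ * (x₁ / p - x₂ / q) / 2 with hβ
    have e1 : x₁ / p * p = x₁ := div_mul_cancel₀ _ hp0
    have e2 : x₂ / q * q = x₂ := div_mul_cancel₀ _ hq0
    obtain ⟨y, hy⟩ := exists_leeDiff_eq hφ (x := x - (α • u + β • w))
      (by simp only [map_sub, map_add, map_smul, hx, hu, hdw, smul_zero, add_zero, sub_zero])
      (by simp only [map_sub, map_add, map_smul, Pi.sub_apply, Pi.add_apply, Pi.smul_apply,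
            smul_eq_mul, hwp, ← hp, ← hx₁]
          rw [hα, hβ]
          linear_combination (-1 : ℚ) * e1 - (x₁ / p - x₂ / q) / 2 * p * hσ1)
      (by simp only [map_sub, map_add, map_smul, Pi.sub_apply, Pi.add_apply, Pi.smul_apply,
            smul_eq_mul]
          rw [hwq, ← hq, ← hx₂, hα, hβ]
          linear_combination (-1 : ℚ) * e2 + (x₁ / p - x₂ / q) / 2 * q * hσ1)
    exact ⟨α, β, y, by rw [hy]; abel⟩
  have hcase : m' = m + 2 ∨ m = m' + 2 := by omega
  rcases hcase with rfl | rfl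
  · refine ⟨u, w, m, hu, hdw, hspan, fun a α β => ?_⟩
    rw [hsplit, hsmul u m hm, hsmul w _ hm']
  · refine ⟨w, u, m', hdw, hu, fun x hx => ?_, fun a α β => ?_⟩
    · obtain ⟨α, β, y, rfl⟩ := hspan x hx
      exact ⟨β, α, y, by abel⟩
    · rw [add_comm, hsplit, hsmul u _ hm, hsmul w _ hm', and_comm]

end KnotDiagram
end
noncomputable section

namespace KnotDiagram

variable {D : KnotDiagram}

/-! ### The filtration on Lee homology -/

/-- The homology class of a cycle of Lee's complex. -/
def leeClass : LinearMap.ker D.leeDiff →ₗ[ℚ] D.LeeHomology :=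
  Subquotient.mk (LinearMap.ker D.leeDiff) (LinearMap.range D.leeDiff)

theorem leeClass_surjective : Function.Surjective (leeClass (D := D)) :=
  Subquotient.mk_surjective _ _

theorem leeClass_mem_iff {a : ℤ} {x : LinearMap.ker D.leeDiff} :
    leeClass x ∈ Filtered.homologyImage D.leeDiff (D.qFiltration a) ↔ D.InFiltration a x :=
  D.isSplitFiltered.mem_homologyImage

theorem finrank_submodule_prod {V W : Type*} [AddCommGroup V] [Module ℚ V] [AddCommGroup W]
    [Module ℚ W] [FiniteDimensional ℚ V] [FiniteDimensional ℚ W] (p : Submodule ℚ V)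
    (q : Submodule ℚ W) :
    Module.finrank ℚ (p.prod q) = Module.finrank ℚ p + Module.finrank ℚ q := by
  let e : p.prod q ≃ₗ[ℚ] p × q :=
    { toFun := fun x => (⟨x.1.1, x.2.1⟩, ⟨x.1.2, x.2.2⟩)
      invFun := fun y => ⟨(y.1, y.2), y.1.2, y.2.2⟩
      map_add' := fun _ _ => rfl
      map_smul' := fun _ _ => rfl
      left_inv := fun _ => rfl
      right_inv := fun _ => rfl }
  rw [e.finrank_eq, Module.finrank_prod]

theorem exists_sum_leeHomology : ∃ (L : (ℚ × ℚ) ≃ₗ[ℚ] D.LeeHomology) (m : ℤ), ∀ (a : ℤ) (p : ℚ × ℚ),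
    L p ∈ Filtered.homologyImage D.leeDiff (D.qFiltration a) ↔
      (p.1 = 0 ∨ a ≤ m) ∧ (p.2 = 0 ∨ a ≤ m + 2) := by
  obtain ⟨u, w, m, hu, hw, hspan, hfil⟩ := exists_leeBasis (D := D)
  let U : LinearMap.ker D.leeDiff := ⟨u, hu⟩
  let W : LinearMap.ker D.leeDiff := ⟨w, hw⟩
  let L : (ℚ × ℚ) →ₗ[ℚ] D.LeeHomology := leeClass.comp
    ((LinearMap.toSpanSingleton ℚ _ U).coprod (LinearMap.toSpanSingleton ℚ _ W))
  have hL : ∀ p, L p = leeClass (p.1 • U + p.2 • W) := fun p => rfl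
  have hmem : ∀ (a : ℤ) (p : ℚ × ℚ),
      L p ∈ Filtered.homologyImage D.leeDiff (D.qFiltration a) ↔
      (p.1 = 0 ∨ a ≤ m) ∧ (p.2 = 0 ∨ a ≤ m + 2) := by
    intro a p
    rw [hL, leeClass_mem_iff]
    exact hfil a p.1 p.2
  have hinj : Function.Injective L := by
    rw [injective_iff_map_eq_zero]
    intro p hp
    have h1 := (hmem (m + 3) p).1 (by rw [hp]; exact zero_mem _)
    refine Prod.ext (h1.1.resolve_right (by omega)) (h1.2.resolve_right (by omega))
  have hsurj : Function.Surjective L := by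
    intro x
    obtain ⟨x, rfl⟩ := leeClass_surjective x
    obtain ⟨α, β, y, hx⟩ := hspan x x.2
    refine ⟨(α, β), ?_⟩
    rw [hL, ← sub_eq_zero, ← map_sub]
    refine Subquotient.mk_eq_zero.2 ⟨-y, ?_⟩
    change D.leeDiff (-y) = α • u + β • w - x
    rw [hx, map_neg]; abel
  exact ⟨LinearEquiv.ofBijective L ⟨hinj, hsurj⟩, m, hmem⟩

theorem homologyImage_homDegree_zero (a : ℤ) :
    Filtered.homologyImage D.leeDiff (D.homDegree 0 ⊓ D.qFiltration a) =
      Filtered.homologyImage D.leeDiff (D.qFiltration a) := by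
  refine le_antisymm (Filtered.homologyImage_mono inf_le_right) fun x hx => ?_
  obtain ⟨⟨z, hz⟩, hza, rfl⟩ := hx
  change z ∈ D.qFiltration a at hza
  obtain ⟨φ, hφ⟩ := D.planar.exists_isAlternating
  set z₀ := Finsupp.restrictTo (fun S => D.gr S = 0) z with hz₀
  have hdz : D.leeDiff z₀ = 0 := by
    rw [hz₀, leeDiff_restrictTo_gr, show D.leeDiff z = 0 from hz, map_zero]
  have hcoeff : ∀ φ', D.idemCoeff (z - z₀) D.orientedVertex φ' = 0 := fun φ' =>
    idemCoeff_of_forall_gr (fun S hS => by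
      rw [Finsupp.sub_apply, hz₀, Finsupp.restrictTo_apply, if_pos hS, sub_self]) φ'
  obtain ⟨y, hy⟩ := exists_leeDiff_eq hφ (x := z - z₀)
    (by rw [map_sub, hdz, sub_zero]; exact hz) (hcoeff _) (hcoeff _)
  refine D.isSplitFiltered.mem_homologyImage.2 ⟨z₀, ⟨mem_homDegree.2 fun S hS => ?_,
    mem_qFiltration.2 fun S hS => ?_⟩, y, by rw [hy]; simp⟩
  · rw [hz₀, Finsupp.restrictTo_apply, if_neg hS]
  · rw [hz₀, Finsupp.restrictTo_apply, mem_qFiltration.1 hza S hS, ite_self]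

theorem homologyImage_homDegree_of_ne_zero {b : ℤ} (hb : b ≠ 0) (a : ℤ) :
    Filtered.homologyImage D.leeDiff (D.homDegree b ⊓ D.qFiltration a) = ⊥ := by
  refine eq_bot_iff.2 fun x hx => ?_
  obtain ⟨⟨z, hz⟩, hza, rfl⟩ := hx
  obtain ⟨φ, hφ⟩ := D.planar.exists_isAlternating
  have hcoeff : ∀ φ', D.idemCoeff z D.orientedVertex φ' = 0 := fun φ' =>
    idemCoeff_of_forall_gr (fun S hS => mem_homDegree.1 hza.1 S (by omega)) φ'
  obtain ⟨y, hy⟩ := exists_leeDiff_eq hφ hz (hcoeff _) (hcoeff _)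
  exact Subquotient.mk_eq_zero.2 ⟨y, hy⟩

variable (D) in
/-- The filtration degrees of Lee homology are `m` and `m + 2`. -/
theorem exists_leeGradings : ∃ m : ℤ, D.leeGradings = {m, m + 2} ∧
    ∀ b a : ℤ, Module.finrank ℚ (D.LeeLimit b a) =
      if b = 0 ∧ (a = m ∨ a = m + 2) then 1 else 0 := by
  obtain ⟨L, m, hL⟩ := exists_sum_leeHomology (D := D)
  refine ⟨m, ?_, fun b a => ?_⟩
  · have hgr : ∀ p : ℚ × ℚ, p ≠ 0 → Filtered.grading D.leeDiff D.qFiltration (L p) =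
        if p.1 = 0 then m + 2 else m := by
      intro p hp
      have hset : {a : ℤ | L p ∈ Filtered.homologyImage D.leeDiff (D.qFiltration a)} =
          Set.Iic (if p.1 = 0 then m + 2 else m) := by
        ext a
        change L p ∈ Filtered.homologyImage D.leeDiff (D.qFiltration a) ↔ a ≤ _
        rw [hL]
        split_ifs with h1
        · have h2 : p.2 ≠ 0 := fun h2 => hp (Prod.ext h1 h2)
          simp [h1, h2]
        · simp only [h1, false_or]
          exact ⟨fun h => h.1, fun h => ⟨h, Or.inr (by omega)⟩⟩
      rw [Filtered.grading, hset, csSup_Iic]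
    ext k
    constructor
    · rintro ⟨x, hx, rfl⟩
      obtain ⟨p, rfl⟩ := L.surjective x
      rw [hgr p fun hp => hx (by rw [hp, map_zero])]
      split_ifs <;> simp
    · rintro (rfl | rfl)
      · refine ⟨L (1, 0), by simp, ?_⟩
        rw [hgr _ (by simp)]; simp
      · refine ⟨L (0, 1), by simp, ?_⟩
        rw [hgr _ (by simp)]; simp
  · have hle : Filtered.homologyImage D.leeDiff (D.homDegree b ⊓ D.qFiltration (a + 1)) ≤
        Filtered.homologyImage D.leeDiff (D.homDegree b ⊓ D.qFiltration a) :=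
      Filtered.homologyImage_mono (inf_le_inf_left _ (D.isSplitFiltered.antitone (by omega)))
    have : FiniteDimensional ℚ D.LeeHomology := L.finiteDimensional
    have h1 : Module.finrank ℚ (D.LeeLimit b a) + _ = _ := Subquotient.finrank_add hle
    by_cases hb : b = 0
    · subst hb
      have hdim : ∀ a : ℤ, Module.finrank ℚ
          (Filtered.homologyImage D.leeDiff (D.homDegree 0 ⊓ D.qFiltration a)) =
          (if a ≤ m then 1 else 0) + if a ≤ m + 2 then 1 else 0 := by
        intro a
        have hG : Filtered.homologyImage D.leeDiff (D.homDegree 0 ⊓ D.qFiltration a) =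
            Submodule.map L.toLinearMap (Submodule.prod (if a ≤ m then ⊤ else ⊥)
              (if a ≤ m + 2 then ⊤ else ⊥)) := by
          rw [homologyImage_homDegree_zero]
          ext x
          obtain ⟨p, rfl⟩ := L.surjective x
          rw [hL]
          constructor
          · intro h
            refine ⟨p, ⟨?_, ?_⟩, rfl⟩
            · split_ifs with h3
              · trivial
              · exact h.1.resolve_right h3
            · split_ifs with h3
              · trivial
              · exact h.2.resolve_right h3
          · rintro ⟨p', ⟨h3, h4⟩, h5⟩
            obtain rfl := L.injective h5
            constructor
            · split_ifs at h3 with h6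
              · exact Or.inr h6
              · exact Or.inl h3
            · split_ifs at h4 with h6
              · exact Or.inr h6
              · exact Or.inl h4
        rw [hG]
        have h3 := LinearEquiv.finrank_map_eq L (Submodule.prod (if a ≤ m then ⊤ else ⊥)
              (if a ≤ m + 2 then ⊤ else ⊥) : Submodule ℚ (ℚ × ℚ))
        refine h3.trans ?_
        rw [finrank_submodule_prod]
        have h4 : ∀ (c : Prop) [Decidable c],
            Module.finrank ℚ (if c then ⊤ else ⊥ : Submodule ℚ ℚ) = if c then 1 else 0 := by
          intro c _
          by_cases h : c
          · rw [if_pos h, if_pos h, finrank_top, Module.finrank_self]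
          · rw [if_neg h, if_neg h, finrank_bot]
        rw [h4, h4]
      rw [hdim, hdim] at h1
      simp only [true_and]
      split_ifs at h1 ⊢ <;> omega
    · rw [if_neg fun h => hb h.1]
      have h2 : Module.finrank ℚ
          (Filtered.homologyImage D.leeDiff (D.homDegree b ⊓ D.qFiltration a)) = 0 := by
        rw [homologyImage_homDegree_of_ne_zero hb, finrank_bot]
      omega

/-! ### Khovanov homology and its width -/

theorem leadingExact_iff {b a : ℤ} :
    Filtered.LeadingExact D.khovanovDiff D.homDegree D.qDegree b a ↔
      Module.finrank ℚ (D.Kh b a) = 0 := by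
  rw [Module.finrank_eq_zero_iff_of_free]
  constructor
  · intro h
    refine Subquotient.subsingleton fun x hx => ?_
    obtain ⟨y, hy, hyx⟩ := h x hx.2 hx.1
    exact ⟨y, hy, hyx⟩
  · intro h x hx hdx
    have h1 : Subquotient.mk (LinearMap.ker D.khovanovDiff ⊓ (D.homDegree b ⊓ D.qDegree a))
      ((D.homDegree (b - 1) ⊓ D.qDegree a).map D.khovanovDiff) ⟨x, hdx, hx⟩ = 0 :=
      Subsingleton.elim _ _
    exact Subquotient.mk_eq_zero.1 h1

theorem finrank_kh_of_notMem {b a : ℤ} (h : (b, a) ∉ D.bidegrees) :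
    Module.finrank ℚ (D.Kh b a) = 0 := by
  refine leadingExact_iff.1 fun x hx _ => ⟨0, zero_mem _, ?_⟩
  rw [map_zero]
  ext S
  by_contra hS
  refine h (Finset.mem_image.2 ⟨S, Finset.mem_univ _, Prod.ext ?_ ?_⟩)
  · by_contra hb
    exact hS (mem_homDegree.1 hx.1 S hb).symm
  · by_contra hb
    exact hS (mem_qDegree.1 hx.2 S hb).symm

theorem coeff_sum_tq (s : Finset (ℤ × ℤ)) (f : ℤ × ℤ → ℤ) (hf : ∀ p ∉ s, f p = 0) (p : ℤ × ℤ) :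
    (∑ p ∈ s, f p • tq p.1 p.2).coeff p = f p := by
  classical
  rw [AddMonoidAlgebra.coeff_sum, Finsupp.finsetSum_apply]
  have h1 : ∀ p' ∈ s, (f p' • tq p'.1 p'.2).coeff p = if p' = p then f p' else 0 := by
    intro p' _
    rw [AddMonoidAlgebra.coeff_smul_apply, tq, AddMonoidAlgebra.coeff_single,
      Finsupp.single_apply]
    simp
  rw [Finset.sum_congr rfl h1, Finset.sum_ite_eq']
  split_ifs with h
  · rfl
  · exact (hf p h).symm

theorem coeff_poincare (b a : ℤ) :
    D.poincare.coeff (b, a) = (Module.finrank ℚ (D.Kh b a) : ℤ) :=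
  coeff_sum_tq D.bidegrees (fun p => (Module.finrank ℚ (D.Kh p.1 p.2) : ℤ))
    (fun p hp => by rw [finrank_kh_of_notMem (b := p.1) (a := p.2) hp]; rfl) (b, a)

theorem diagonals_finite : D.diagonals.Finite := by
  refine (D.bidegrees.finite_toSet.image fun p => p.2 - 2 * p.1).subset ?_
  rintro m ⟨b, a, h, rfl⟩
  refine ⟨(b, a), ?_, rfl⟩
  by_contra hp
  rw [coeff_poincare, finrank_kh_of_notMem hp] at h
  exact h rfl

/-- The support of Khovanov homology lies within the width. -/
theorem diagonal_sub_le (hW : D.width ≤ 3) {b a b' a' : ℤ}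
    (h : ¬ Filtered.LeadingExact D.khovanovDiff D.homDegree D.qDegree b a)
    (h' : ¬ Filtered.LeadingExact D.khovanovDiff D.homDegree D.qDegree b' a') :
    (a' - 2 * b') - (a - 2 * b) ≤ 5 := by
  have hmem : ∀ {b a : ℤ}, ¬ Filtered.LeadingExact D.khovanovDiff D.homDegree D.qDegree b a →
      a - 2 * b ∈ D.diagonals := by
    intro b a h
    refine ⟨b, a, ?_, rfl⟩
    rw [coeff_poincare]
    exact fun h0 => h (leadingExact_iff.2 (by exact_mod_cast h0))
  have h1 := csInf_le diagonals_finite.bddBelow (hmem h)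
  have h2 := le_csSup diagonals_finite.bddAbove (hmem h')
  unfold width at hW
  omega

theorem leePageDiff_eq_zero (hW : D.width ≤ 3) (hd : D.leeDiff ∘ₗ D.leeDiff = 0) {k : ℕ}
    (hk : 3 ≤ k) (b a : ℤ) : D.leePageDiff hd k b a = 0 := by
  by_cases h : Filtered.LeadingExact D.khovanovDiff D.homDegree D.qDegree b a
  · have : Subsingleton (D.LeePage k b a) := D.isSplitFiltered.subsingleton_page (by omega) h
    refine LinearMap.ext fun x => ?_
    rw [Subsingleton.elim x 0, map_zero, map_zero]
  · have h1 : Filtered.LeadingExact D.khovanovDiff D.homDegree D.qDegree (b + 1)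
        (a + 4 * ((k : ℤ) - 1)) := by
      by_contra h'
      have := diagonal_sub_le hW h h'
      omega
    have : Subsingleton (D.LeePage k (b + 1) (a + 4 * ((k : ℤ) - 1))) :=
      D.isSplitFiltered.subsingleton_page (by omega) h1
    exact LinearMap.ext fun x => Subsingleton.elim _ _

theorem nonempty_leePage_equiv (hW : D.width ≤ 3) {k : ℕ} (hk : 3 ≤ k) (b a : ℤ) :
    Nonempty (D.LeePage k b a ≃ₗ[ℚ] D.LeeLimit b a) := by
  by_cases h : Filtered.LeadingExact D.khovanovDiff D.homDegree D.qDegree b a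
  · have h1 : Subsingleton (D.LeePage k b a) := D.isSplitFiltered.subsingleton_page (by omega) h
    have h2 : Subsingleton (D.LeeLimit b a) := D.isSplitFiltered.subsingleton_limitTerm h
    exact ⟨0⟩
  · refine D.isSplitFiltered.nonempty_page_equiv_limitTerm (by omega) (fun a' ha' => ?_)
      fun a' ha' => ?_
    · by_contra h'
      have := diagonal_sub_le hW h h'
      omega
    · by_contra h'
      have := diagonal_sub_le hW h' h
      omega

/-! ### Bar-Natan's form of the Poincaré polynomial -/

theorem coeff_barNatan (e : ℤ) (Q : Laurent) (b a : ℤ) :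
    (tq 0 e * (tq 0 1 + tq 0 (-1)) + (1 + tq 1 4) * Q).coeff (b, a) =
      (if b = 0 ∧ (a = e + 1 ∨ a = e - 1) then 1 else 0) +
        (Q.coeff (b, a) + Q.coeff (b - 1, a - 4)) := by
  have h1 : ∀ k, tq 0 e * tq 0 k = tq 0 (e + k) := fun k => by
    simp [tq, AddMonoidAlgebra.single_mul_single]
  have h2 : ∀ k, (tq 0 k).coeff (b, a) = if b = 0 ∧ a = k then 1 else 0 := fun k => by
    rw [tq, AddMonoidAlgebra.coeff_single, Finsupp.single_apply]
    congr 1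
    rw [Prod.mk.injEq]
    exact propext ⟨fun h => ⟨h.1.symm, h.2.symm⟩, fun h => ⟨h.1.symm, h.2.symm⟩⟩
  rw [mul_add, add_mul, one_mul, h1, h1]
  simp only [AddMonoidAlgebra.coeff_add, Finsupp.add_apply, h2]
  have h3 : (tq 1 4 * Q).coeff (b, a) = Q.coeff (b - 1, a - 4) := by
    rw [tq, AddMonoidAlgebra.coeff_single_mul_apply, one_mul]
    congr 1
    ext <;> simp <;> ring
  rw [h3]
  congr 1
  split_ifs <;> omega

theorem eq_of_barNatan {e e' : ℤ} {Q Q' : Laurent}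
    (h : tq 0 e * (tq 0 1 + tq 0 (-1)) + (1 + tq 1 4) * Q =
      tq 0 e' * (tq 0 1 + tq 0 (-1)) + (1 + tq 1 4) * Q') : e = e' := by
  classical
  set R : Laurent := Q - Q' with hR
  set c : ℤ → ℤ := fun a => (if a = e' + 1 ∨ a = e' - 1 then 1 else 0) -
    (if a = e + 1 ∨ a = e - 1 then 1 else 0) with hc
  have hrec : ∀ b a : ℤ, R.coeff (b, a) + R.coeff (b - 1, a - 4) = if b = 0 then c a else 0 := by
    intro b a
    have h1 := congrArg (fun P : Laurent => P.coeff (b, a)) h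
    simp only [coeff_barNatan] at h1
    simp only [hR, AddMonoidAlgebra.coeff_sub, Finsupp.sub_apply, hc]
    by_cases hb : b = 0 <;> simp only [hb, true_and, false_and, if_true, if_false] at h1 ⊢ <;>
      linarith
  obtain ⟨B, hB⟩ : ∃ B : ℕ, ∀ b a : ℤ, (B : ℤ) ≤ |b| → R.coeff (b, a) = 0 := by
    refine ⟨R.coeff.support.sup (fun p => p.1.natAbs) + 1, fun b a hba => ?_⟩
    by_contra h0
    have := Finset.le_sup (f := fun p : ℤ × ℤ => p.1.natAbs) (Finsupp.mem_support_iff.2 h0)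
    change b.natAbs ≤ _ at this
    rw [Int.abs_eq_natAbs] at hba
    omega
  have hneg : ∀ n : ℕ, ∀ b a : ℤ, b < 0 → b + B ≤ n → R.coeff (b, a) = 0 := by
    intro n
    induction n with
    | zero => intro b a hb hn; exact hB b a (by rw [abs_of_neg hb]; push_cast at hn; omega)
    | succ n ih =>
      intro b a hb hn
      have h1 := hrec b a
      rw [if_neg hb.ne, ih (b - 1) (a - 4) (by omega) (by push_cast at hn; omega), add_zero] at h1
      exact h1
  have hpos : ∀ n : ℕ, ∀ b a : ℤ, 0 ≤ b → B - b ≤ n → R.coeff (b, a) = 0 := by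
    intro n
    induction n with
    | zero => intro b a hb hn; exact hB b a (by rw [abs_of_nonneg hb]; push_cast at hn; omega)
    | succ n ih =>
      intro b a hb hn
      have h1 := hrec (b + 1) (a + 4)
      rw [if_neg (by omega), ih (b + 1) (a + 4) (by omega) (by push_cast at hn; omega), zero_add,
        add_sub_cancel_right, add_sub_cancel_right] at h1
      exact h1
  have hc0 : ∀ a, c a = 0 := by
    intro a
    have h1 := hrec 0 a
    rw [if_pos rfl, hpos B 0 a le_rfl (by omega), hneg B (0 - 1) (a - 4) (by omega) (by omega)] at h1
    exact h1.symm
  have h1 := hc0 (e + 1)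
  have h2 := hc0 (e - 1)
  simp only [hc, true_or, or_true, if_true] at h1 h2
  by_contra hne
  split_ifs at h1 h2 <;> omega

theorem hasBarNatanForm_of_leeLimit (hW : D.width ≤ 3) {m : ℤ}
    (hm : ∀ b a : ℤ, Module.finrank ℚ (D.LeeLimit b a) =
      if b = 0 ∧ (a = m ∨ a = m + 2) then 1 else 0) : D.HasBarNatanForm (m + 1) := by
  set δ : ℤ × ℤ → ℤ := fun p => Filtered.diffRank D.leeDiff D.homDegree D.qFiltration 4 p.1 p.2
  have hδ : ∀ p, 0 ≤ δ p := fun p => D.isSplitFiltered.diffRank_nonneg 4 p.1 p.2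
  have hkh : ∀ b a : ℤ, (Module.finrank ℚ (D.Kh b a) : ℤ) =
      (if b = 0 ∧ (a = m ∨ a = m + 2) then 1 else 0) + (δ (b, a) + δ (b - 1, a - 4)) := by
    intro b a
    obtain ⟨e₁⟩ := D.isSplitFiltered.nonempty_leading_equiv_page b a
    have e₂ : Nonempty (Filtered.Page D.leeDiff D.homDegree D.qFiltration 8 b a ≃ₗ[ℚ]
      D.LeeLimit b a) := nonempty_leePage_equiv hW le_rfl b a
    have h1 := D.isSplitFiltered.finrank_page_one b a
    rw [← e₁.finrank_eq, e₂.some.finrank_eq, hm] at h1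
    rw [h1]
    push_cast
    ring
  have hout : ∀ p ∉ D.bidegrees, δ p = 0 := by
    rintro ⟨b, a⟩ hp
    have h1 := hkh b a
    rw [finrank_kh_of_notMem hp] at h1
    have h2 := hδ (b, a)
    have h3 := hδ (b - 1, a - 4)
    split_ifs at h1 <;> push_cast at h1 <;> omega
  refine ⟨∑ p ∈ D.bidegrees, δ p • tq p.1 p.2, fun p => ?_, ?_⟩
  · rw [coeff_sum_tq _ _ hout]
    exact hδ p
  · ext ⟨b, a⟩
    rw [coeff_poincare, hkh, coeff_barNatan, coeff_sum_tq _ _ hout, coeff_sum_tq _ _ hout]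
    congr 1
    split_ifs <;> omega

end KnotDiagram
end

theorem mainTheorem11 (D : KnotDiagram) (hW : D.width ≤ 3) :
    (∃ hd : D.leeDiff ∘ₗ D.leeDiff = 0,
      ∀ k : ℕ, 3 ≤ k → ∀ b a : ℤ, D.leePageDiff hd k b a = 0) ∧
    (∀ k : ℕ, 3 ≤ k → ∀ b a : ℤ, Nonempty (D.LeePage k b a ≃ₗ[ℚ] D.LeeLimit b a)) ∧
    D.sMax = D.s + 1 ∧
    (∀ e : ℤ, D.HasBarNatanForm e ↔ e = D.s) := by
  obtain ⟨m, hgr, hm⟩ := D.exists_leeGradings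
  have hs : D.s = m + 1 := by
    rw [KnotDiagram.s, KnotDiagram.sMin, hgr, csInf_pair, inf_eq_left.2 (by omega)]
  have hsMax : D.sMax = m + 2 := by
    rw [KnotDiagram.sMax, hgr, csSup_pair, sup_eq_right.2 (by omega)]
  have hform := KnotDiagram.hasBarNatanForm_of_leeLimit hW hm
  refine ⟨⟨KnotDiagram.leeDiff_comp_leeDiff, fun k hk b a =>
    KnotDiagram.leePageDiff_eq_zero hW _ hk b a⟩,
    fun k hk b a => KnotDiagram.nonempty_leePage_equiv hW hk b a, by omega, fun e => ?_⟩
  rw [hs]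
  refine ⟨fun h => ?_, fun h => h ▸ hform⟩
  obtain ⟨Q, -, hQ⟩ := h
  obtain ⟨Q', -, hQ'⟩ := hform
  exact KnotDiagram.eq_of_barNatan (hQ.symm.trans hQ')
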